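/- Let $\phi,\psi\in L^2(\mathbb R)$ be complex-valued with $\phi\psi=0$ almost everywhere, and assume that either ($\phi\in L^{2+\varepsilon}(\mathbb R)$ for some $\varepsilon>0$ and $\psi\in L^\infty(\mathbb R)$) or $\phi,\psi\in L^4(\mathbb R)$. Write $\langle f,g\rangle=\int_{\mathbb R}f\overline g$. **The Friedrichs model.** Let $\widetilde A$ be the operator $(\widetilde Af)(x)=xf(x)+\langle f,\psi\rangle\phi(x)$ in $L^2(\mathbb R)$ with the dense domain $\{f\in L^2: xf\in L^2,\ \lim_{R\to\infty}\int_{-R}^Rf(x)\,dx=0\}$. For $u\in D(\widetilde A^*)$ let $\Gamma_2u=c_u$ be the unique constant with $xu(x)-c_u\in L^2(\mathbb R)$, and let $\Gamma_1u=\lim_{R\to\infty}\int_{-R}^Ru(x)\,dx$. For $B\in\mathbb C$ let $A_B$ be the restriction of $\widetilde A^*$ to $\ker(\Gamma_1-B\Gamma_2)$. For $\mu\in\rho(A_B)$ the solution operator $S_{\mu,B}$ assigns to $c\in\mathbb C$ the solution $u\in D(\widetilde A^*)$ of $(\widetilde A^*-\mu)u=0$, $(\Gamma_1-B\Gamma_2)u=c$.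 For $\mu_0\in\rho(A_B)$ put $$\mathcal S=\mathcal S_B=\operatorname{Span}_{\delta\in\rho(A_B)}(A_B-\delta)^{-1}\operatorname{Ran}(S_{\mu_0,B});$$ its closure $\overline{\mathcal S}$ is the detectable subspace. Assume that $\rho(A_B)$ meets both the open upper and the open lower half-plane. **Boundary values.** Let $\widehat{\overline\phi}(z)=\int_{\mathbb R}\frac{\overline{\phi(x)}}{x-z}\,dx$ for $z\in\mathbb C\setminus\mathbb R$, and let $\widehat{\overline\phi}(k+i0)$ be the limit of $\widehat{\overline\phi}(k+i\varepsilon)$ as $\varepsilon\downarrow0$, taken in $L^2(\mathbb R,dk)$; this limit exists. **Theorem.** We have $$\overline{\mathcal S}=L^2(\mathbb R)\iff 1-\psi(k)\,\widehat{\overline\phi}(k+i0)\neq0\ \text{ for a.e. }k\in\mathbb R.$$ Moreover, the defect $\operatorname{def}\mathcal S=\dim\mathcal S^\perp$ equals $0$ if $\overline{\mathcal S}=L^2(\mathbb R)$ and equals $\infty$ otherwise. -/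

import Mathlib

open MeasureTheory Filter Topology
open scoped ENNReal ComplexConjugate

noncomputable section

/-- The Hilbert space `L²(ℝ)` of complex-valued functions, with Lebesgue measure. -/
abbrev L2R : Type := Lp ℂ 2 (volume : Measure ℝ)

/-! ### Unbounded operators -/

/-- `IsResolvent T z R`: the bounded operator `R` is the inverse of `T - z`. -/
def IsResolvent {H : Type*} [NormedAddCommGroup H] [InnerProductSpace ℂ H]
    (T : H →ₗ.[ℂ] H) (z : ℂ) (R : H →L[ℂ] H) : Prop :=
  (∀ g : H, ∃ h : R g ∈ T.domain, T ⟨R g, h⟩ - z • R g = g) ∧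
    ∀ f : T.domain, R (T f - z • (f : H)) = f

/-- The resolvent set `ρ(T)` of an unbounded operator: all `z` for which `T - z` is a bijection
from its domain onto the whole space with bounded inverse. -/
def unboundedResolventSet {H : Type*} [NormedAddCommGroup H] [InnerProductSpace ℂ H]
    (T : H →ₗ.[ℂ] H) : Set ℂ :=
  {z | ∃ R : H →L[ℂ] H, IsResolvent T z R}

namespace Friedrichs

/-! ### The Friedrichs model -/

lemma intervalIntegrable_L2R (f : L2R) (a b : ℝ) :
    IntervalIntegrable (f : ℝ → ℂ) volume a b :=
  (((Lp.memLp f).locallyIntegrable (by norm_num)).integrableOn_isCompact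
    isCompact_uIcc).intervalIntegrable

lemma intervalIntegral_add_L2R (f g : L2R) (a b : ℝ) :
    ∫ x in a..b, (f + g : L2R) x = (∫ x in a..b, f x) + ∫ x in a..b, g x := by
  rw [← intervalIntegral.integral_add (intervalIntegrable_L2R f a b)
    (intervalIntegrable_L2R g a b)]
  apply intervalIntegral.integral_congr_ae
  filter_upwards [Lp.coeFn_add f g] with x hx _
  simpa using hx

lemma intervalIntegral_smul_L2R (c : ℂ) (f : L2R) (a b : ℝ) :
    ∫ x in a..b, (c • f : L2R) x = c * ∫ x in a..b, f x := by
  rw [← intervalIntegral.integral_const_mul]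
  apply intervalIntegral.integral_congr_ae
  filter_upwards [Lp.coeFn_smul c f] with x hx _
  simpa using hx

/-- `HasTraces f a b`: the trace values of `f` are `Γ₁ f = a` and `Γ₂ f = b`. Here `Γ₂ f` is the
constant `b = c_f` for which `x f(x) - c_f` is in `L²(ℝ)`, and `Γ₁ f` is the limit of the symmetric
integrals of `f`. -/
def HasTraces (f : L2R) (a b : ℂ) : Prop :=
  MemLp (fun x : ℝ => (x : ℂ) * f x - b) 2 volume ∧
    Tendsto (fun R : ℝ => ∫ x in (-R)..R, f x) atTop (𝓝 a)

lemma hasTraces_zero : HasTraces 0 0 0 := by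
  have h0 : ((0 : L2R) : ℝ → ℂ) =ᵐ[volume] 0 := Lp.coeFn_zero ..
  constructor
  · refine (MemLp.zero (ε := ℂ)).ae_eq ?_
    filter_upwards [h0] with x hx
    rw [hx]
    simp
  · have : ∀ R : ℝ, ∫ x in (-R)..R, (0 : L2R) x = 0 := fun R => by
      rw [intervalIntegral.integral_congr_ae (g := fun _ => (0 : ℂ))]
      · simp
      · filter_upwards [h0] with x hx _ using hx
    simpa only [this] using tendsto_const_nhds

lemma HasTraces.add {f g : L2R} {a b c d : ℂ} (hf : HasTraces f a b) (hg : HasTraces g c d) :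
    HasTraces (f + g) (a + c) (b + d) := by
  constructor
  · refine (hf.1.add hg.1).ae_eq ?_
    filter_upwards [Lp.coeFn_add f g] with x hx
    simp only [hx, Pi.add_apply]
    ring
  · simpa only [intervalIntegral_add_L2R] using hf.2.add hg.2

lemma HasTraces.smul {f : L2R} {a b : ℂ} (k : ℂ) (hf : HasTraces f a b) :
    HasTraces (k • f) (k * a) (k * b) := by
  constructor
  · refine (hf.1.const_mul k).ae_eq ?_
    filter_upwards [Lp.coeFn_smul k f] with x hx
    simp only [hx, Pi.smul_apply, smul_eq_mul]
    ring
  · simpa only [intervalIntegral_smul_L2R] using hf.2.const_mul k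

/-- The domain `{f ∈ L² : x f ∈ L², lim_{R → ∞} ∫_{-R}^R f = 0}` of the minimal operator. -/
def minimalDomain : Submodule ℂ L2R where
  carrier := {f | HasTraces f 0 0}
  zero_mem' := hasTraces_zero
  add_mem' hf hg := by simpa using HasTraces.add hf hg
  smul_mem' k f hf := by simpa using HasTraces.smul k hf

lemma memLp_of_mem_minimalDomain (f : minimalDomain) :
    MemLp (fun x : ℝ => (x : ℂ) * (f : L2R) x) 2 volume := by
  simpa using f.2.1

/-- Multiplication by the independent variable on the minimal domain. -/
def mulVar : minimalDomain →ₗ[ℂ] L2R where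
  toFun f := (memLp_of_mem_minimalDomain f).toLp _
  map_add' f g := by
    rw [← MemLp.toLp_add]
    apply MemLp.toLp_congr
    filter_upwards [Lp.coeFn_add (f : L2R) (g : L2R)] with x hx
    simp only [Submodule.coe_add, hx, Pi.add_apply]
    ring
  map_smul' k f := by
    simp only [RingHom.id_apply]
    rw [← MemLp.toLp_const_smul]
    apply MemLp.toLp_congr
    filter_upwards [Lp.coeFn_smul k (f : L2R)] with x hx
    simp only [Submodule.coe_smul, hx, Pi.smul_apply, smul_eq_mul]
    ring

/-- The minimal Friedrichs operator `(A f)(x) = x f(x) + ⟨f, φ⟩ ψ(x)`, where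
`⟨f, φ⟩ = ∫ f (conj φ)` (linear in the first entry, so `inner ℂ φ f` here). -/
def minimalOp (φ ψ : L2R) : L2R →ₗ.[ℂ] L2R where
  domain := minimalDomain
  toFun := mulVar + ((innerSL ℂ φ).toLinearMap.smulRight ψ).comp minimalDomain.subtype

/-- The adjoint `Ã^*` of the operator `(Ã f)(x) = x f(x) + ⟨f, ψ⟩ φ(x)`, in which `φ` and `ψ` have
changed places. -/
def maximalOp (φ ψ : L2R) : L2R →ₗ.[ℂ] L2R := (minimalOp ψ φ).adjoint

/-- The subspace `ker (Γ₁ - B Γ₂)`. -/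
def boundaryCondition (B : ℂ) : Submodule ℂ L2R where
  carrier := {f | ∃ a b : ℂ, HasTraces f a b ∧ a - B * b = 0}
  zero_mem' := ⟨0, 0, hasTraces_zero, by simp⟩
  add_mem' := by
    rintro f g ⟨a, b, hf, h⟩ ⟨c, d, hg, h'⟩
    exact ⟨a + c, b + d, hf.add hg, by linear_combination h + h'⟩
  smul_mem' := by
    rintro k f ⟨a, b, hf, h⟩
    exact ⟨k * a, k * b, hf.smul k, by linear_combination k * h⟩

/-- The extension `A_B`: the restriction of `Ã^*` to `ker (Γ₁ - B Γ₂)`. -/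
def extensionOp (φ ψ : L2R) (B : ℂ) : L2R →ₗ.[ℂ] L2R :=
  (maximalOp φ ψ).domRestrict (boundaryCondition B)

/-- The resolvent set `ρ(A_B)`. -/
def rho (φ ψ : L2R) (B : ℂ) : Set ℂ := unboundedResolventSet (extensionOp φ ψ B)

/-- `IsSolution φ ψ B μ c u`: `u` is the value at `c ∈ ℂ` of the solution operator `S_{μ,B}`, i.e.
`(Ã^* - μ) u = 0` and `(Γ₁ - B Γ₂) u = c`. -/
def IsSolution (φ ψ : L2R) (B μ c : ℂ) (u : L2R) : Prop :=
  (∃ h : u ∈ (maximalOp φ ψ).domain, maximalOp φ ψ ⟨u, h⟩ - μ • u = 0) ∧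
    ∃ a b : ℂ, HasTraces u a b ∧ a - B * b = c

/-- The space `S_B`: the linear span of all `(A_B - δ)⁻¹ u` with `δ ∈ ρ(A_B)` and `u` in the range
of the solution operator `S_{μ₀,B}`. Its closure is the detectable subspace. -/
def detectableSpan (φ ψ : L2R) (B μ₀ : ℂ) : Submodule ℂ L2R :=
  Submodule.span ℂ {v | ∃ (δ : ℂ) (R : L2R →L[ℂ] L2R) (c : ℂ) (u : L2R),
    IsResolvent (extensionOp φ ψ B) δ R ∧ IsSolution φ ψ B μ₀ c u ∧ v = R u}

/-- The defect `dim V^⊥` of a subspace, as a natural number or `∞`. -/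
def defect (V : Submodule ℂ L2R) : ℕ∞ := Cardinal.toENat (Module.rank ℂ Vᗮ)

/-! ### The Cauchy transform and its boundary values -/

/-- The Cauchy transform `ĥ(z) = ∫ h(x) / (x - z) dx`. -/
def cauchyTransform (h : ℝ → ℂ) (z : ℂ) : ℂ := ∫ x : ℝ, h x / ((x : ℂ) - z)

/-- `F` is the boundary function `k ↦ ĥ(k + i0)`, the limit of `ĥ(k + iε)` in `L²(ℝ, dk)` as
`ε ↓ 0`. -/
def IsUpperBoundaryValue (h F : ℝ → ℂ) : Prop :=
  MemLp F 2 volume ∧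
    Tendsto (fun ε : ℝ =>
      eLpNorm (fun k : ℝ => cauchyTransform h ((k : ℂ) + (ε : ℂ) * Complex.I) - F k) 2 volume)
      (𝓝[>] 0) (𝓝 0)

end Friedrichs

end

/-! Write `F` for the Cauchy transform of `conj φ`. Off the real line every solution of `(Ã^* - z) u
= 0` is a multiple of `u_z(x) = (x - z)⁻¹ (1 - F(z) ψ(x))`, because `φ ψ = 0` forces `⟨u_z, φ⟩ =
F(z)`. With `D(z) = (Γ₁ - B Γ₂) u_z`, the resolvent satisfies `(A_B - δ)⁻¹ u_z = (z - δ)⁻¹ (u_z -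
D(z) / D(δ) u_δ)`. Hence `g ⊥ 𝒮` says `P(μ₀) D(δ) = D(μ₀) P(δ)` on `ρ(A_B)`, where `P(z) = ⟨u_z, g⟩
= ĥ(z) - F(z) (hψ)^(z)` and `h = conj g`. Analytic continuation in each half-plane and the limits `P
→ 0`, `D → ±πi - B` at `±i∞` give `P(μ₀) = 0`, and then `P = 0` in both half-planes. So `𝒮^⊥`
consists of the conjugates of all `h` with `ĥ = F (hψ)^` off the line
(`mem_orthogonal_detectableSpan_iff`).

Uniqueness. Take the jump of this identity across the line and multiply by `ψ`. Since `ψ conj φ =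
0`, the jump of `F` drops out and `hψ (1 - ψ F₊) = 0` a.e. (`mul_eq_zero_of_cauchyTransform_eq`). If
`1 - ψ F₊ ≠ 0` a.e., then `hψ = 0`, so `ĥ = 0` and `h = 0`. As `hψ` is only integrable, this uses
convergence in measure of Poisson integrals and Kolmogorov's estimate with Fatou's lemma in place of
pointwise boundary values.

Failure of uniqueness. Let `1 - ψ F₊` vanish on a bounded set `E` of positive measure. Take `v`,
nonzero exactly on `E`, whose Cauchy transform has bounded boundary values `v₊`, `v₋`
(`exists_bounded_bdry`): apply a Möbius map to the Cauchy transform of the indicator of `E`, whose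
imaginary part is at most `π` in modulus. Then `h = (F₊ v₊ - F₋ v₋) / (2πi)` is in `L²`, `hψ = ψ F₊
v = v`, and `ĥ = F v̂ = F (hψ)^` by multiplicativity of boundary values
(`cauchyTransform_bdry_mul_bdry`). Infinitely many disjoint subsets of `E` give linearly independent
`h`, so the defect is infinite (`exists_linearIndependent_cauchyTransform_eq`). -/

/-! ### Resolvents near a point of the resolvent set -/

/-- On the domain `T - w = (1 - (w - z) R) (T - z)`, and the first factor is invertible for `w` near
`z`. This gives openness of `ρ(A_B)` and, through the limit of `Q`, the case `δ = μ₀` of the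
orthogonality relation. -/
theorem eventually_isResolvent {H : Type*} [NormedAddCommGroup H] [InnerProductSpace ℂ H]
    [CompleteSpace H] {T : H →ₗ.[ℂ] H} {z : ℂ} {R : H →L[ℂ] H} (hR : IsResolvent T z R) :
    ∃ Q : ℂ → H →L[ℂ] H, (∀ᶠ w in 𝓝 z, IsResolvent T w (Q w)) ∧ Tendsto Q (𝓝 z) (𝓝 R) := by
  have hc : Tendsto (fun w : ℂ => 1 - (w - z) • R) (𝓝 z) (𝓝 1) := by
    have : Continuous fun w : ℂ => 1 - (w - z) • R := by fun_prop
    simpa using this.tendsto z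
  refine ⟨fun w => R * Ring.inverse (1 - (w - z) • R), ?_, ?_⟩
  · have hu : ∀ᶠ w in 𝓝 z, IsUnit (1 - (w - z) • R) :=
      hc.eventually (Units.nhds (1 : (H →L[ℂ] H)ˣ))
    filter_upwards [hu] with w hw
    set N := Ring.inverse (1 - (w - z) • R) with hN
    have h1 : (1 - (w - z) • R) * N = 1 := Ring.mul_inverse_cancel _ hw
    have h2 : N * (1 - (w - z) • R) = 1 := Ring.inverse_mul_cancel _ hw
    have hcomm : R * N = N * R := by
      have : R * (1 - (w - z) • R) = (1 - (w - z) • R) * R := by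
        rw [mul_sub, sub_mul, mul_smul_comm, smul_mul_assoc, mul_one, one_mul]
      calc R * N = N * (1 - (w - z) • R) * (R * N) := by rw [h2, one_mul]
        _ = N * ((1 - (w - z) • R) * R) * N := by simp only [mul_assoc]
        _ = N * R * ((1 - (w - z) • R) * N) := by rw [← this]; simp only [mul_assoc]
        _ = N * R := by rw [h1, mul_one]
    constructor
    · intro g
      obtain ⟨h, hh⟩ := hR.1 (N g)
      refine ⟨h, ?_⟩
      have h3 : N g - (w - z) • R (N g) = g := by
        simpa using congrArg (fun S : H →L[ℂ] H => S g) h1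
      change T ⟨R (N g), h⟩ - w • R (N g) = g
      rw [sub_eq_iff_eq_add.1 hh]
      conv_rhs => rw [← h3]
      rw [sub_smul]
      abel
    · intro f
      have h3 : N (f : H) - (w - z) • N (R f) = f := by
        simpa using congrArg (fun S : H →L[ℂ] H => S (f : H)) h2
      rw [hcomm]
      change N (R (T f - w • (f : H))) = f
      have h4 : T f - w • (f : H) = (T f - z • (f : H)) - (w - z) • (f : H) := by
        rw [sub_smul]; abel
      rw [h4, map_sub, hR.2 f, map_smul, map_sub, map_smul, h3]
  · have h1 : Tendsto (fun w : ℂ => Ring.inverse (1 - (w - z) • R)) (𝓝 z) (𝓝 1) := by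
      have := (NormedRing.inverse_continuousAt (1 : (H →L[ℂ] H)ˣ)).tendsto.comp hc
      simpa [Function.comp_def] using this
    simpa using h1.const_mul R

noncomputable section

namespace Friedrichs

open scoped FourierTransform Real

/-! ### The Fourier transform on `L²(ℝ)` -/

section

open scoped SchwartzMap ContDiff

/-- On `L¹ ∩ L²` the inverse Fourier transform of `L²` is given by the Fourier integral. -/
lemma fourierInv_toLp_ae {f : ℝ → ℂ} (h1 : Integrable f) (h2 : MemLp f 2 volume) :
    ((𝓕⁻ (h2.toLp f) : L2R) : ℝ → ℂ) =ᵐ[volume] 𝓕⁻ f := by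
  have hcont : Continuous (𝓕⁻ f : ℝ → ℂ) := by
    rw [Real.fourierInv_eq_fourier_comp_neg]
    exact VectorFourier.fourierIntegral_continuous Real.continuous_fourierChar
      (by exact (innerSL ℝ).continuous₂) (h1.comp_neg)
  -- Both sides are tested against smooth compactly supported functions: the `L²` transform through
  -- tempered distributions, the Fourier integral through Fubini.
  apply ae_eq_of_integral_contDiff_smul_eq
    ((Lp.memLp _).locallyIntegrable (by norm_num)) hcont.locallyIntegrable
  intro g hg hg'
  have hg2 : HasCompactSupport (fun x : ℝ => (g x : ℂ)) := hg'.comp_left Complex.ofReal_zero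
  have hg3 : ContDiff ℝ ∞ (fun x : ℝ => (g x : ℂ)) := Complex.ofRealCLM.contDiff.comp hg
  let G : 𝓢(ℝ, ℂ) := hg2.toSchwartzMap hg3
  have h := congrArg (fun T : 𝓢'(ℝ, ℂ) => T G)
    (Lp.fourierInv_toTemperedDistribution_eq (E := ℝ) (F := ℂ) (h2.toLp f))
  simp only [TemperedDistribution.fourierInv_apply, Lp.toTemperedDistribution_apply] at h
  have hGx : ∀ x, G x = (g x : ℂ) := fun x => rfl
  have e1 : ∫ x, g x • ((𝓕⁻ (h2.toLp f) : L2R) : ℝ → ℂ) x =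
      ∫ x, G x • ((𝓕⁻ (h2.toLp f) : L2R) : ℝ → ℂ) x := by
    simp [hGx]
  have e2 : ∫ x, (𝓕⁻ G : 𝓢(ℝ, ℂ)) x • (h2.toLp f) x = ∫ x, (𝓕⁻ G : 𝓢(ℝ, ℂ)) x • f x := by
    apply integral_congr_ae
    filter_upwards [h2.coeFn_toLp] with x hx
    rw [hx]
  have e3 := VectorFourier.integral_fourierIntegral_smul_eq_flip (μ := (volume : Measure ℝ))
    (ν := (volume : Measure ℝ)) (L := -innerₗ ℝ) (e := Real.fourierChar) (f := G) (g := f)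
    Real.continuous_fourierChar (by exact ((innerSL ℝ).continuous₂).neg) G.integrable h1
  rw [e1, ← h, e2, SchwartzMap.fourierInv_coe]
  refine e3.trans (integral_congr_ae (Eventually.of_forall fun x => ?_))
  have hL : (-innerₗ ℝ).flip = -innerₗ ℝ := by
    ext; simp
  rw [hL]
  change G x • (𝓕⁻ f) x = _
  simp [hGx]

/-! ### Fourier representation of the Cauchy kernel -/

/-- The sign of `s` on the half-line of all `t` with the sign of `s`, and `0` elsewhere. -/
def signCut (s t : ℝ) : ℂ := if 0 < s * t then ((s / |s| : ℝ) : ℂ) else 0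

lemma norm_signCut_le (s t : ℝ) : ‖signCut s t‖ ≤ 1 := by
  unfold signCut
  split_ifs with h
  · have : s ≠ 0 := fun h' => by simp [h'] at h
    simp [abs_ne_zero.2 this]
  · simp

lemma measurable_signCut (s : ℝ) : Measurable (signCut s) := by
  unfold signCut
  exact Measurable.ite (measurableSet_lt measurable_const (by fun_prop)) measurable_const
    measurable_const

/-- The Fourier transform of the Cauchy kernel with pole `z`, up to normalization. -/
def fourierKernel (z : ℂ) (t : ℝ) : ℂ := signCut z.im t * Complex.exp (2 * π * Complex.I * z * t)

lemma norm_fourierKernel_le (z : ℂ) (t : ℝ) :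
    ‖fourierKernel z t‖ ≤ Real.exp (-(2 * π * |z.im|) * |t|) := by
  by_cases h : 0 < z.im * t
  · have e : (2 * π * Complex.I * z * t).re = -(2 * π * |z.im|) * |t| := by
      have : |z.im| * |t| = z.im * t := by rw [← abs_mul, abs_of_pos h]
      rw [neg_mul, mul_assoc (2 * π), this]
      simp
      ring
    rw [fourierKernel, norm_mul, Complex.norm_exp, e]
    exact mul_le_of_le_one_left (Real.exp_pos _).le (norm_signCut_le _ _)
  · simp [fourierKernel, signCut, h, Real.exp_nonneg]

lemma measurable_fourierKernel (z : ℂ) : Measurable (fourierKernel z) :=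
  (measurable_signCut _).mul (by fun_prop)

lemma integrable_exp_neg_mul_abs {a : ℝ} (ha : 0 < a) :
    Integrable (fun t : ℝ => Real.exp (-a * |t|)) := by
  have h1 : IntegrableOn (fun t : ℝ => Real.exp (-a * |t|)) (Set.Iic 0) :=
    (integrableOn_exp_mul_Iic ha 0).congr_fun
      (fun t ht => by simp [abs_of_nonpos (Set.mem_Iic.1 ht)]) measurableSet_Iic
  have h2 : IntegrableOn (fun t : ℝ => Real.exp (-a * |t|)) (Set.Ioi 0) :=
    (exp_neg_integrableOn_Ioi 0 ha).congr_fun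
      (fun t ht => by simp [abs_of_pos (Set.mem_Ioi.1 ht)]) measurableSet_Ioi
  simpa using h1.union h2

lemma integrable_fourierKernel {z : ℂ} (hz : z.im ≠ 0) : Integrable (fourierKernel z) :=
  (integrable_exp_neg_mul_abs (a := 2 * π * |z.im|) (by positivity)).mono'
    (measurable_fourierKernel z).aestronglyMeasurable
    (Eventually.of_forall (norm_fourierKernel_le z))

lemma memLp_two_fourierKernel {z : ℂ} (hz : z.im ≠ 0) : MemLp (fourierKernel z) 2 volume := by
  rw [memLp_two_iff_integrable_sq_norm (measurable_fourierKernel z).aestronglyMeasurable]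
  refine (integrable_exp_neg_mul_abs (a := 2 * (2 * π * |z.im|)) (by positivity)).mono'
    ((measurable_fourierKernel z).norm.pow_const 2).aestronglyMeasurable
    (Eventually.of_forall fun t => ?_)
  rw [Real.norm_of_nonneg (by positivity)]
  calc ‖fourierKernel z t‖ ^ 2 ≤ Real.exp (-(2 * π * |z.im|) * |t|) ^ 2 := by
        gcongr; exact norm_fourierKernel_le z t
    _ = _ := by rw [← Real.exp_nat_mul]; congr 1; push_cast; ring

/-- The exponential is integrated over the half-line on which it decays; the sign in `signCut`
compensates the orientation of the negative half-line. -/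
lemma integral_fourierKernel_mul_exp {z : ℂ} (hz : z.im ≠ 0) (x : ℝ) :
    2 * π * Complex.I * ∫ t : ℝ, fourierKernel z t * Complex.exp (-(2 * π * Complex.I * x * t)) =
      1 / (x - z) := by
  set a : ℂ := 2 * π * Complex.I * (z - x) with ha
  have hare : a.re = -(2 * π * z.im) := by simp [ha]
  have hxz : (x : ℂ) - z ≠ 0 := fun h => hz (by simpa using congrArg Complex.im h)
  have hpi : (π : ℂ) ≠ 0 := by exact_mod_cast Real.pi_ne_zero
  have e : ∀ t : ℝ, fourierKernel z t * Complex.exp (-(2 * π * Complex.I * x * t)) =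
      signCut z.im t * Complex.exp (a * t) := fun t => by
    rw [fourierKernel, mul_assoc, ← Complex.exp_add]
    congr 2
    rw [ha]; ring
  simp_rw [e]
  rcases lt_or_gt_of_ne hz with h | h
  · have : ∀ t : ℝ, signCut z.im t * Complex.exp (a * t) =
        (Set.Iio 0).indicator (fun t : ℝ => - Complex.exp (a * t)) t := fun t => by
      have h' : 0 < z.im * t ↔ t < 0 := by
        constructor
        · intro h2; by_contra h3; push Not at h3; nlinarith
        · intro h2; exact mul_pos_of_neg_of_neg h h2
      by_cases ht : t < 0
      · simp [signCut, h', ht, abs_of_neg h, h.ne]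
      · simp [signCut, h', ht]
    simp_rw [this]
    rw [integral_indicator measurableSet_Iio, integral_neg, ← integral_Iic_eq_integral_Iio,
      integral_exp_mul_complex_Iic (by rw [hare]; nlinarith [Real.pi_pos])]
    simp only [Complex.ofReal_zero, mul_zero, Complex.exp_zero, ha]
    have : z - x ≠ 0 := sub_ne_zero.2 (sub_ne_zero.1 hxz).symm
    field_simp
    ring
  · have : ∀ t : ℝ, signCut z.im t * Complex.exp (a * t) =
        (Set.Ioi 0).indicator (fun t : ℝ => Complex.exp (a * t)) t := fun t => by
      have h' : 0 < z.im * t ↔ 0 < t := mul_pos_iff_of_pos_left h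
      by_cases ht : 0 < t
      · simp [signCut, h', ht, abs_of_pos h, h.ne']
      · simp [signCut, h', ht]
    simp_rw [this]
    rw [integral_indicator measurableSet_Ioi,
      integral_exp_mul_complex_Ioi (by rw [hare]; nlinarith [Real.pi_pos])]
    simp only [Complex.ofReal_zero, mul_zero, Complex.exp_zero, ha]
    have : z - x ≠ 0 := sub_ne_zero.2 (sub_ne_zero.1 hxz).symm
    field_simp
    ring

end

/-! ### The Cauchy transform on `L²(ℝ)` -/

lemma ofReal_sub_ne_zero {z : ℂ} (hz : z.im ≠ 0) (x : ℝ) : (x : ℂ) - z ≠ 0 :=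
  fun h => hz (by simpa using congrArg Complex.im h)

lemma abs_im_le_norm_ofReal_sub (z : ℂ) (x : ℝ) : |z.im| ≤ ‖(x : ℂ) - z‖ := by
  simpa using Complex.abs_im_le_norm ((x : ℂ) - z)

lemma continuous_inv_sub {z : ℂ} (hz : z.im ≠ 0) : Continuous fun x : ℝ => ((x : ℂ) - z)⁻¹ :=
  (by fun_prop : Continuous fun x : ℝ => (x : ℂ) - z).inv₀ (ofReal_sub_ne_zero hz)

lemma norm_inv_sub_le {z : ℂ} (hz : z.im ≠ 0) (x : ℝ) : ‖((x : ℂ) - z)⁻¹‖ ≤ |z.im|⁻¹ := by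
  rw [norm_inv]
  exact inv_anti₀ (abs_pos.2 hz) (abs_im_le_norm_ofReal_sub z x)

lemma memLp_top_inv_sub {z : ℂ} (hz : z.im ≠ 0) :
    MemLp (fun x : ℝ => ((x : ℂ) - z)⁻¹) ∞ volume :=
  memLp_top_of_bound (continuous_inv_sub hz).aestronglyMeasurable _
    (Eventually.of_forall (norm_inv_sub_le hz))

lemma fourierInv_conj_fourierKernel {z : ℂ} (hz : z.im ≠ 0) (x : ℝ) :
    𝓕⁻ (fun t => conj (fourierKernel z t)) x = conj ((2 * π * Complex.I)⁻¹ * ((x : ℂ) - z)⁻¹) := by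
  have hpi : (π : ℂ) ≠ 0 := by exact_mod_cast Real.pi_ne_zero
  have h2 := integral_fourierKernel_mul_exp hz x
  have h3 : ((2 * π * Complex.I)⁻¹ * ((x : ℂ) - z)⁻¹) =
      ∫ t : ℝ, fourierKernel z t * Complex.exp (-(2 * π * Complex.I * x * t)) := by
    rw [← one_div ((x : ℂ) - z), ← h2, inv_mul_cancel_left₀ (by simp [hpi])]
  rw [h3, ← integral_conj, Real.fourierInv_eq']
  congr 1; ext t
  simp only [smul_eq_mul, map_mul, ← Complex.exp_conj]
  rw [mul_comm]
  congr 2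
  simp [Complex.conj_ofNat]
  ring

/-- By Plancherel: up to a constant and conjugation the function is the inverse Fourier transform of
an element of `L¹ ∩ L²`. -/
lemma memLp_two_inv_sub {z : ℂ} (hz : z.im ≠ 0) :
    MemLp (fun x : ℝ => ((x : ℂ) - z)⁻¹) 2 volume := by
  have hpi : (π : ℂ) ≠ 0 := by exact_mod_cast Real.pi_ne_zero
  have h1 : Integrable (fun t => conj (fourierKernel z t)) :=
    Complex.conjCLE.toContinuousLinearMap.integrable_comp (integrable_fourierKernel hz)
  have h2 : MemLp (fun t => conj (fourierKernel z t)) 2 volume :=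
    (memLp_two_fourierKernel hz).star
  have h := (Lp.memLp (𝓕⁻ (h2.toLp _) : L2R)).ae_eq (fourierInv_toLp_ae h1 h2)
  have h' := h.star.const_mul (2 * π * Complex.I)
  refine h'.ae_eq (Eventually.of_forall fun x => ?_)
  simp only [Pi.star_apply, RCLike.star_def, fourierInv_conj_fourierKernel hz, Complex.conj_conj]
  rw [mul_inv_cancel_left₀ (by simp [hpi])]

lemma integrable_div_sub (h : L2R) {z : ℂ} (hz : z.im ≠ 0) :
    Integrable (fun x : ℝ => h x / ((x : ℂ) - z)) := by
  simpa only [div_eq_mul_inv] using! (Lp.memLp h).integrable_mul (memLp_two_inv_sub hz)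

/-- The Cauchy transform on the Fourier side. -/
lemma cauchyTransform_eq_integral_fourier (h : L2R) {z : ℂ} (hz : z.im ≠ 0) :
    cauchyTransform h z = 2 * π * Complex.I * ∫ t : ℝ, fourierKernel z t * (𝓕 h : L2R) t := by
  have hpi : (π : ℂ) ≠ 0 := by exact_mod_cast Real.pi_ne_zero
  have h1 : Integrable (fun t => conj (fourierKernel z t)) :=
    Complex.conjCLE.toContinuousLinearMap.integrable_comp (integrable_fourierKernel hz)
  have h2 : MemLp (fun t => conj (fourierKernel z t)) 2 volume :=
    (memLp_two_fourierKernel hz).star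
  have e := Lp.inner_fourier_eq (𝓕⁻ (h2.toLp _) : L2R) h
  rw [FourierTransform.fourier_fourierInv_eq, L2.inner_def, L2.inner_def] at e
  have e1 : ∫ t, inner ℂ ((h2.toLp _ : L2R) t) ((𝓕 h : L2R) t) =
      ∫ t : ℝ, fourierKernel z t * (𝓕 h : L2R) t := by
    apply integral_congr_ae
    filter_upwards [h2.coeFn_toLp] with t ht
    rw [ht, RCLike.inner_apply, Complex.conj_conj, mul_comm]
  have e2 : ∫ x, inner ℂ ((𝓕⁻ (h2.toLp _ : L2R) : L2R) x) (h x) =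
      ∫ x : ℝ, (2 * π * Complex.I)⁻¹ * (h x / ((x : ℂ) - z)) := by
    apply integral_congr_ae
    filter_upwards [fourierInv_toLp_ae h1 h2] with t ht
    rw [ht, RCLike.inner_apply, fourierInv_conj_fourierKernel hz, Complex.conj_conj]
    ring
  rw [e1, e2, integral_const_mul] at e
  rw [e, mul_inv_cancel_left₀ (by simp [hpi]), cauchyTransform]

/-- Multiplication of an `L²` function by a bounded function. -/
lemma memLp_bdd_mul {m : ℝ → ℂ} (hm : Measurable m) (hb : ∀ t, ‖m t‖ ≤ 1) (h : L2R) :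
    MemLp (fun t => m t * h t) 2 volume :=
  (Lp.memLp h).of_le (hm.aestronglyMeasurable.mul (Lp.aestronglyMeasurable h))
    (Eventually.of_forall fun t => by
      rw [norm_mul]; exact mul_le_of_le_one_left (norm_nonneg _) (hb t))

lemma norm_fourierKernel_le_one (z : ℂ) (t : ℝ) : ‖fourierKernel z t‖ ≤ 1 :=
  (norm_fourierKernel_le z t).trans (Real.exp_le_one_iff.2 (by
    rw [neg_mul]; exact neg_nonpos.2 (by positivity)))

/-- The boundary value of the Cauchy transform of `h` on the real line, taken from the half-plane
of all `z` for which `z.im` has the sign of `s`. -/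
def bdry (s : ℝ) (h : L2R) : L2R :=
  (2 * π * Complex.I) •
    𝓕⁻ ((memLp_bdd_mul (measurable_signCut s) (norm_signCut_le s) (𝓕 h)).toLp : L2R)

lemma signCut_mul_pos (s t : ℝ) {ε : ℝ} (hε : 0 < ε) : signCut (s * ε) t = signCut s t := by
  unfold signCut
  have h1 : 0 < s * ε * t ↔ 0 < s * t := by
    rw [mul_right_comm]; exact mul_pos_iff_of_pos_right hε
  have h2 : s * ε / |s * ε| = s / |s| := by
    rw [abs_mul, abs_of_pos hε, mul_div_mul_right _ _ hε.ne']
  rw [h2]; simp only [h1]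

/-- A real shift `k` of the pole multiplies `fourierKernel` by `exp(2πikt)`. On a horizontal line
the Cauchy transform is therefore a Fourier multiplier with a bounded symbol. -/
lemma cauchyTransform_line_ae (h : L2R) {η : ℝ} (hη : η ≠ 0) :
    (fun k : ℝ => cauchyTransform h (k + η * Complex.I)) =ᵐ[volume]
      ((2 * π * Complex.I) • 𝓕⁻ ((memLp_bdd_mul (measurable_fourierKernel (η * Complex.I))
        (norm_fourierKernel_le_one _) (𝓕 h)).toLp : L2R) : L2R) := by
  set m := memLp_bdd_mul (measurable_fourierKernel (η * Complex.I))
        (norm_fourierKernel_le_one _) (𝓕 h)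
  have h1 : Integrable (fun t => fourierKernel (η * Complex.I) t * (𝓕 h : L2R) t) :=
    (memLp_two_fourierKernel (by simpa using hη)).integrable_mul (Lp.memLp _)
  filter_upwards [fourierInv_toLp_ae h1 m, Lp.coeFn_smul (2 * π * Complex.I)
    (𝓕⁻ (m.toLp) : L2R)] with k hk hk'
  rw [hk', Pi.smul_apply, hk, cauchyTransform_eq_integral_fourier h (by simpa using hη),
    Real.fourierInv_eq', smul_eq_mul]
  congr 2; ext t
  simp only [fourierKernel]
  have : (k + η * Complex.I : ℂ).im = (η * Complex.I : ℂ).im := by simp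
  rw [this, smul_eq_mul, mul_left_comm, mul_assoc (signCut _ _), mul_assoc (signCut _ _),
    ← mul_assoc (Complex.exp _) (Complex.exp _), ← Complex.exp_add]
  congr 3
  simp
  ring

lemma memLp_cauchyTransform_line (h : L2R) {η : ℝ} (hη : η ≠ 0) :
    MemLp (fun k : ℝ => cauchyTransform h (k + η * Complex.I)) 2 volume :=
  (Lp.memLp _).ae_eq (cauchyTransform_line_ae h hη).symm

lemma tendsto_eLpNorm_of_dominated {f : ℝ → ℝ → ℂ} {g : ℝ → ℂ} {l : Filter ℝ}
    [l.IsCountablyGenerated] (hf : ∀ n, AEStronglyMeasurable (f n) volume)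
    (hg : MemLp g 2 volume) (hb : ∀ᶠ n in l, ∀ᵐ t, ‖f n t‖ ≤ ‖g t‖)
    (hlim : ∀ᵐ t, Tendsto (fun n => f n t) l (𝓝 0)) :
    Tendsto (fun n => eLpNorm (f n) 2 volume) l (𝓝 0) := by
  have h2 : ∀ n, eLpNorm (f n) 2 volume = (∫⁻ t, ‖f n t‖ₑ ^ (2 : ℝ)) ^ (1 / 2 : ℝ) := fun n => by
    rw [eLpNorm_eq_lintegral_rpow_enorm_toReal (by norm_num) (by norm_num)]
    simp
  simp_rw [h2]
  have h3 : Tendsto (fun n => ∫⁻ t, ‖f n t‖ₑ ^ (2 : ℝ)) l (𝓝 (∫⁻ _ : ℝ, 0)) := by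
    refine tendsto_lintegral_filter_of_dominated_convergence' (fun t => ‖g t‖ₑ ^ (2 : ℝ))
      (Eventually.of_forall fun n => (hf n).enorm.pow_const _) ?_ ?_ ?_
    · filter_upwards [hb] with n hn
      filter_upwards [hn] with t ht
      gcongr
      exact enorm_le_iff_norm_le.2 ht
    · have := hg.2
      rw [eLpNorm_lt_top_iff_lintegral_rpow_enorm_lt_top (by norm_num) (by norm_num)] at this
      simpa using this.ne
    · filter_upwards [hlim] with t ht
      have := (ENNReal.continuous_rpow_const (y := 2)).tendsto _ |>.comp
        ((continuous_enorm.tendsto _).comp ht)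
      simpa [Function.comp_def] using this
  have := (ENNReal.continuous_rpow_const (y := (1 / 2 : ℝ))).tendsto _ |>.comp h3
  simpa [Function.comp_def] using this

/-- The boundary values are limits in `L²(ℝ)`. -/
lemma tendsto_cauchyTransform_bdry {s : ℝ} (hs : s ≠ 0) (h : L2R) :
    Tendsto (fun ε : ℝ => eLpNorm (fun k : ℝ =>
      cauchyTransform h (k + ((s * ε : ℝ) : ℂ) * Complex.I) - bdry s h k) 2 volume)
      (𝓝[>] 0) (𝓝 0) := by
  -- Plancherel turns the distance in `L²` into one between the two multipliers applied to `𝓕 h`.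
  have key : ∀ ε : ℝ, 0 < ε → eLpNorm (fun k : ℝ =>
      cauchyTransform h (k + ((s * ε : ℝ) : ℂ) * Complex.I) - bdry s h k) 2 volume =
      ‖(2 * π * Complex.I : ℂ)‖ₑ * eLpNorm (fun t => fourierKernel (((s * ε : ℝ) : ℂ) * Complex.I) t *
        (𝓕 h : L2R) t - signCut s t * (𝓕 h : L2R) t) 2 volume := fun ε hε => by
    set m := memLp_bdd_mul (measurable_fourierKernel (((s * ε : ℝ) : ℂ) * Complex.I))
        (norm_fourierKernel_le_one _) (𝓕 h)
    set m' := memLp_bdd_mul (measurable_signCut s) (norm_signCut_le s) (𝓕 h)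
    have e1 : eLpNorm (fun k : ℝ =>
      cauchyTransform h (k + ((s * ε : ℝ) : ℂ) * Complex.I) - bdry s h k) 2 volume =
      eLpNorm ((2 * π * Complex.I : ℂ) • (𝓕⁻ (m.toLp - m'.toLp : L2R) : L2R) : L2R) 2 volume := by
      apply eLpNorm_congr_ae
      have : ((2 * π * Complex.I : ℂ) • (𝓕⁻ (m.toLp - m'.toLp : L2R) : L2R) : L2R) =
          (2 * π * Complex.I : ℂ) • (𝓕⁻ m.toLp : L2R) - bdry s h := by
        have : (𝓕⁻ (m.toLp - m'.toLp : L2R) : L2R) = 𝓕⁻ m.toLp - 𝓕⁻ m'.toLp :=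
          (Lp.fourierTransformₗᵢ ℝ ℂ).symm.map_sub _ _
        rw [this, smul_sub]; rfl
      rw [this]
      filter_upwards [cauchyTransform_line_ae h (mul_ne_zero hs hε.ne'), Lp.coeFn_sub
        ((2 * π * Complex.I : ℂ) • (𝓕⁻ m.toLp : L2R)) (bdry s h)] with k hk hk'
      rw [hk', Pi.sub_apply, ← hk]
    have e3 : ‖(𝓕⁻ (m.toLp - m'.toLp : L2R) : L2R)‖ = ‖(m.toLp - m'.toLp : L2R)‖ :=
      (Lp.fourierTransformₗᵢ ℝ ℂ).symm.norm_map _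
    rw [e1, ← Lp.enorm_def, enorm_smul]
    congr 1
    rw [← ofReal_norm, e3, ofReal_norm, Lp.enorm_def]
    apply eLpNorm_congr_ae
    filter_upwards [Lp.coeFn_sub m.toLp m'.toLp, m.coeFn_toLp, m'.coeFn_toLp] with t h1 h2 h3
    rw [h1, Pi.sub_apply, h2, h3]
  have lim : Tendsto (fun ε : ℝ => eLpNorm (fun t => fourierKernel (((s * ε : ℝ) : ℂ) * Complex.I) t *
        (𝓕 h : L2R) t - signCut s t * (𝓕 h : L2R) t) 2 volume) (𝓝[>] 0) (𝓝 0) := by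
    -- The factor 2 appears because both multipliers have modulus at most 1.
    apply tendsto_eLpNorm_of_dominated (g := fun t => 2 * (𝓕 h : L2R) t)
    · exact fun ε => ((measurable_fourierKernel _).aestronglyMeasurable.mul
        (Lp.aestronglyMeasurable _)).sub
        ((measurable_signCut _).aestronglyMeasurable.mul (Lp.aestronglyMeasurable _))
    · exact (Lp.memLp _).const_mul 2
    · refine Eventually.of_forall fun ε => Eventually.of_forall fun t => ?_
      rw [← sub_mul, norm_mul, norm_mul]
      gcongr
      refine (norm_sub_le _ _).trans ?_
      have := norm_fourierKernel_le_one (((s * ε : ℝ) : ℂ) * Complex.I) t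
      have := norm_signCut_le s t
      rw [Complex.norm_ofNat]
      linarith
    · refine Eventually.of_forall fun t => ?_
      have h1 : Tendsto (fun ε : ℝ => signCut s t * Complex.exp (2 * π * Complex.I *
          (((s * ε : ℝ) : ℂ) * Complex.I) * t) * (𝓕 h : L2R) t - signCut s t * (𝓕 h : L2R) t)
          (𝓝 0) (𝓝 0) := by
        have : Continuous (fun ε : ℝ => signCut s t * Complex.exp (2 * π * Complex.I *
          (((s * ε : ℝ) : ℂ) * Complex.I) * t) * (𝓕 h : L2R) t - signCut s t * (𝓕 h : L2R) t) := by
          fun_prop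
        simpa using this.tendsto 0
      refine (h1.mono_left nhdsWithin_le_nhds).congr' ?_
      filter_upwards [self_mem_nhdsWithin] with ε hε
      simp only [fourierKernel]
      have : (((s * ε : ℝ) : ℂ) * Complex.I).im = s * ε := by simp
      rw [this, signCut_mul_pos s t hε]
  have := ENNReal.Tendsto.const_mul (a := ‖(2 * π * Complex.I : ℂ)‖ₑ) lim
    (Or.inr enorm_ne_top)
  rw [mul_zero] at this
  refine this.congr' ?_
  filter_upwards [self_mem_nhdsWithin] with ε hε using (key ε hε).symm

/-! ### Boundary values -/

lemma aestronglyMeasurable_cauchyTransform_line {h : ℝ → ℂ} (hh : AEStronglyMeasurable h volume)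
    (η : ℝ) : AEStronglyMeasurable (fun k : ℝ => cauchyTransform h (k + η * Complex.I)) volume := by
  have : AEStronglyMeasurable (fun p : ℝ × ℝ => h p.2 / ((p.2 : ℂ) - (p.1 + η * Complex.I)))
      (volume.prod volume) := by
    simp_rw [div_eq_mul_inv]
    refine hh.comp_snd.mul (Measurable.aestronglyMeasurable ?_)
    fun_prop
  exact this.integral_prod_right'

lemma tendstoInMeasure_bdry {s : ℝ} (hs : s ≠ 0) (h : L2R) :
    TendstoInMeasure volume
      (fun (ε : ℝ) (k : ℝ) => cauchyTransform h (k + ((s * ε : ℝ) : ℂ) * Complex.I))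
      (𝓝[>] 0) (bdry s h) :=
  tendstoInMeasure_of_tendsto_eLpNorm two_ne_zero
    (fun _ => aestronglyMeasurable_cauchyTransform_line (Lp.aestronglyMeasurable h) _)
    (Lp.aestronglyMeasurable _) (tendsto_cauchyTransform_bdry hs h)

/-- Limits in measure give no pointwise limits directly; the almost-everywhere identities below are
read off along a common sequence. -/
lemma exists_common_seq {ι : Type*} {f g : ι → ℝ → ℂ} {F G : ℝ → ℂ} {l : Filter ι} [NeBot l]
    [l.IsCountablyGenerated] (hf : TendstoInMeasure volume f l F)
    (hg : TendstoInMeasure volume g l G) :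
    ∃ u : ℕ → ι, Tendsto u atTop l ∧
      ∀ᵐ k : ℝ, Tendsto (fun n => f (u n) k) atTop (𝓝 (F k)) ∧
        Tendsto (fun n => g (u n) k) atTop (𝓝 (G k)) := by
  obtain ⟨u, hu, hu'⟩ := hf.exists_seq_tendsto_ae'
  obtain ⟨v, hv, hv'⟩ := (hg.comp hu).exists_seq_tendsto_ae'
  refine ⟨u ∘ v, hu.comp hv, ?_⟩
  filter_upwards [hu', hv'] with k h1 h2 using ⟨h1.comp hv, h2⟩

/-- The jump of the Cauchy transform across the real line. -/
lemma bdry_sub_bdry (h : L2R) : bdry 1 h - bdry (-1) h = (2 * π * Complex.I : ℂ) • h := by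
  rw [bdry, bdry, ← smul_sub]
  congr 1
  rw [← (Lp.fourierTransformₗᵢ ℝ ℂ).symm_apply_apply h]
  have := ((Lp.fourierTransformₗᵢ ℝ ℂ).symm.map_sub
    ((memLp_bdd_mul (measurable_signCut 1) (norm_signCut_le 1) (𝓕 h)).toLp : L2R)
    ((memLp_bdd_mul (measurable_signCut (-1)) (norm_signCut_le (-1)) (𝓕 h)).toLp : L2R)).symm
  rw [(Lp.fourierTransformₗᵢ ℝ ℂ).symm_apply_apply]
  refine this.trans ?_
  rw [LinearIsometryEquiv.symm_apply_eq]
  ext1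
  -- At `t = 0` both cuts vanish; elsewhere their difference is 1.
  have h0 : ∀ᵐ t : ℝ, t ≠ 0 := by simp [ae_iff]
  filter_upwards [Lp.coeFn_sub
    ((memLp_bdd_mul (measurable_signCut 1) (norm_signCut_le 1) (𝓕 h)).toLp : L2R)
    ((memLp_bdd_mul (measurable_signCut (-1)) (norm_signCut_le (-1)) (𝓕 h)).toLp : L2R),
    (memLp_bdd_mul (measurable_signCut 1) (norm_signCut_le 1) (𝓕 h)).coeFn_toLp,
    (memLp_bdd_mul (measurable_signCut (-1)) (norm_signCut_le (-1)) (𝓕 h)).coeFn_toLp,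
    h0] with t h1 h2 h3 ht
  rw [h1, Pi.sub_apply, h2, h3]
  change _ = (𝓕 h : L2R) t
  rcases lt_or_gt_of_ne ht with ht | ht
  · simp [signCut, ht, ht.le]
  · simp [signCut, ht, ht.le]

lemma bdry_sub_bdry_ae (h : L2R) :
    ∀ᵐ k : ℝ, bdry 1 h k - bdry (-1) h k = 2 * π * Complex.I * h k := by
  have := bdry_sub_bdry h
  filter_upwards [Lp.coeFn_sub (bdry 1 h) (bdry (-1) h),
    Lp.coeFn_smul (2 * π * Complex.I : ℂ) h] with k h1 h2
  rw [← smul_eq_mul, ← Pi.smul_apply, ← h2, ← this, h1, Pi.sub_apply]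

lemma fourier_bdry_ae (s : ℝ) (h : L2R) :
    ∀ᵐ t : ℝ, (𝓕 (bdry s h) : L2R) t = 2 * π * Complex.I * (signCut s t * (𝓕 h : L2R) t) := by
  set m := memLp_bdd_mul (measurable_signCut s) (norm_signCut_le s) (𝓕 h)
  have : (𝓕 (bdry s h) : L2R) = (2 * π * Complex.I : ℂ) • m.toLp := by
    have := (Lp.fourierTransformₗᵢ ℝ ℂ).map_smul (2 * π * Complex.I : ℂ) (𝓕⁻ m.toLp : L2R)
    refine this.trans ?_
    congr 1
    exact (Lp.fourierTransformₗᵢ ℝ ℂ).apply_symm_apply m.toLp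
  rw [this]
  filter_upwards [Lp.coeFn_smul (2 * π * Complex.I : ℂ) m.toLp, m.coeFn_toLp] with t h1 h2
  rw [h1, Pi.smul_apply, h2, smul_eq_mul]

/-- `bdry s h` keeps the frequencies with the sign of `s`, the kernel at `z` those with the sign of
`z.im`. These half-lines coincide here and are disjoint in `cauchyTransform_bdry_of_neg`. -/
lemma cauchyTransform_bdry_of_pos {s : ℝ} (h : L2R) {z : ℂ} (hz : 0 < s * z.im) :
    cauchyTransform (bdry s h) z =
      ((s / |s| : ℝ) : ℂ) * (2 * π * Complex.I) * cauchyTransform h z := by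
  have hz0 : z.im ≠ 0 := fun h' => by simp [h'] at hz
  rw [cauchyTransform_eq_integral_fourier _ hz0, cauchyTransform_eq_integral_fourier _ hz0,
    mul_left_comm]
  congr 1
  rw [← integral_const_mul]
  apply integral_congr_ae
  filter_upwards [fourier_bdry_ae s h] with t ht
  rw [ht, fourierKernel]
  have : signCut z.im t * signCut s t = ((s / |s| : ℝ) : ℂ) * signCut z.im t := by
    unfold signCut
    by_cases h1 : 0 < z.im * t
    · have h2 : 0 < s * t := by
        by_contra h3
        have h4 : 0 < (s * z.im) * (z.im * t) := mul_pos hz h1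
        have h5 : (s * z.im) * (z.im * t) = z.im ^ 2 * (s * t) := by ring
        have := mul_nonpos_of_nonneg_of_nonpos (sq_nonneg z.im) (not_lt.1 h3)
        linarith
      simp only [h2, if_true, mul_comm]
    · simp [h1]
  linear_combination (2 * π * Complex.I * (𝓕 h : L2R) t *
    Complex.exp (2 * π * Complex.I * z * t)) * this

lemma cauchyTransform_bdry_of_neg {s : ℝ} (h : L2R) {z : ℂ} (hz : s * z.im < 0) :
    cauchyTransform (bdry s h) z = 0 := by
  have hz0 : z.im ≠ 0 := fun h' => by simp [h'] at hz
  rw [cauchyTransform_eq_integral_fourier _ hz0]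
  refine mul_eq_zero_of_right _ (integral_eq_zero_of_ae ?_)
  filter_upwards [fourier_bdry_ae s h] with t ht
  rw [ht, fourierKernel]
  have : signCut z.im t * signCut s t = 0 := by
    unfold signCut
    by_cases h1 : 0 < z.im * t
    · have h2 : ¬ 0 < s * t := fun h3 => by
        have h4 : 0 < (z.im * t) * (s * t) := mul_pos h1 h3
        have h5 : (z.im * t) * (s * t) = (s * z.im) * t ^ 2 := by ring
        have := mul_nonpos_of_nonpos_of_nonneg hz.le (sq_nonneg t)
        linarith
      simp [h1, h2]
    · simp [h1]
  simp only [Pi.zero_apply]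
  linear_combination (2 * π * Complex.I * (𝓕 h : L2R) t *
    Complex.exp (2 * π * Complex.I * z * t)) * this

lemma cauchyTransform_congr {f g : ℝ → ℂ} (h : f =ᵐ[volume] g) (z : ℂ) :
    cauchyTransform f z = cauchyTransform g z :=
  integral_congr_ae (by filter_upwards [h] with x hx; rw [hx])

lemma cauchyTransform_conj (f : ℝ → ℂ) (z : ℂ) :
    cauchyTransform (fun x => conj (f x)) (conj z) = conj (cauchyTransform f z) := by
  rw [cauchyTransform, cauchyTransform, ← integral_conj]
  simp

lemma coeFn_star_ae (f : L2R) : ∀ᵐ x : ℝ, (star f : L2R) x = conj (f x) :=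
  Lp.coeFn_star f

lemma cauchyTransform_star (f : L2R) (z : ℂ) :
    cauchyTransform (star f : L2R) (conj z) = conj (cauchyTransform f z) := by
  rw [← cauchyTransform_conj, cauchyTransform_congr (coeFn_star_ae f)]

lemma bdry_star {s : ℝ} (hs : s ≠ 0) (f : L2R) :
    ∀ᵐ k : ℝ, bdry s (star f) k = conj (bdry (-s) f k) := by
  obtain ⟨u, hu, hu'⟩ := exists_common_seq (tendstoInMeasure_bdry hs (star f))
    (tendstoInMeasure_bdry (neg_ne_zero.2 hs) f)
  filter_upwards [hu'] with k hk
  refine tendsto_nhds_unique hk.1 (((Complex.continuous_conj.tendsto _).comp hk.2).congr fun n => ?_)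
  rw [Function.comp_apply, ← cauchyTransform_star]
  congr 1
  simp

/-- The Fourier transforms live on opposite half-lines. -/
lemma inner_bdry_bdry_neg (s : ℝ) (f g : L2R) : inner ℂ (bdry (-s) f) (bdry s g) = 0 := by
  rw [← Lp.inner_fourier_eq, L2.inner_def]
  apply integral_eq_zero_of_ae
  filter_upwards [fourier_bdry_ae s g, fourier_bdry_ae (-s) f] with t h1 h2
  rw [h1, h2, RCLike.inner_apply, Pi.zero_apply]
  by_cases h : 0 < s * t
  · have : ¬ 0 < -s * t := by rw [neg_mul]; linarith
    simp only [signCut, this, if_false]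
    simp
  · simp [signCut, h]

/-- Products of boundary values from the same half-plane have mean value zero. -/
lemma integral_bdry_mul_bdry {s : ℝ} (hs : s ≠ 0) (f g : L2R) :
    ∫ x, bdry s f x * bdry s g x = 0 := by
  rw [← inner_bdry_bdry_neg s (star f) g, L2.inner_def]
  apply integral_congr_ae
  filter_upwards [bdry_star (neg_ne_zero.2 hs) f] with x hx
  rw [hx, neg_neg, RCLike.inner_apply, Complex.conj_conj, mul_comm]

lemma memLp_inv_sub_mul {z : ℂ} (hz : z.im ≠ 0) (h : L2R) :
    MemLp (fun x : ℝ => ((x : ℂ) - z)⁻¹ * h x) 2 volume :=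
  (Lp.memLp h).mul (memLp_top_inv_sub hz)

/-- Multiplication by `1 / (x - z)`. -/
def mulInvSub {z : ℂ} (hz : z.im ≠ 0) (h : L2R) : L2R := (memLp_inv_sub_mul hz h).toLp

lemma coeFn_mulInvSub {z : ℂ} (hz : z.im ≠ 0) (h : L2R) :
    ∀ᵐ x : ℝ, mulInvSub hz h x = ((x : ℂ) - z)⁻¹ * h x :=
  (memLp_inv_sub_mul hz h).coeFn_toLp

lemma cauchyTransform_mulInvSub {z ζ : ℂ} (hz : z.im ≠ 0) (hζ : ζ.im ≠ 0) (hne : ζ ≠ z) (h : L2R) :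
    cauchyTransform (mulInvSub hz h) ζ =
      (cauchyTransform h ζ - cauchyTransform h z) / (ζ - z) := by
  rw [cauchyTransform_congr (coeFn_mulInvSub hz h), cauchyTransform, cauchyTransform,
    cauchyTransform, ← integral_sub (integrable_div_sub h hζ) (integrable_div_sub h hz),
    ← integral_div]
  congr 1; ext x
  have h1 := ofReal_sub_ne_zero hz x
  have h2 := ofReal_sub_ne_zero hζ x
  have h3 := sub_ne_zero.2 hne
  field_simp
  ring

/-- The partial fraction identity `cauchyTransform_mulInvSub` passes to the boundary, since `z` is
not real and the points approaching `k` eventually avoid it. -/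
lemma bdry_mulInvSub {s : ℝ} (hs : s ≠ 0) {z : ℂ} (hz : z.im ≠ 0) (h : L2R) :
    ∀ᵐ k : ℝ, bdry s (mulInvSub hz h) k = (bdry s h k - cauchyTransform h z) / ((k : ℂ) - z) := by
  obtain ⟨u, hu, hu'⟩ := exists_common_seq (tendstoInMeasure_bdry hs (mulInvSub hz h))
    (tendstoInMeasure_bdry hs h)
  filter_upwards [hu'] with k hk
  have hz' : Tendsto (fun n => (k : ℂ) + ((s * u n : ℝ) : ℂ) * Complex.I) atTop (𝓝 k) := by
    have h0 : Tendsto u atTop (𝓝 0) := hu.mono_right nhdsWithin_le_nhds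
    have h1 : Continuous fun t : ℝ => (k : ℂ) + ((s * t : ℝ) : ℂ) * Complex.I := by fun_prop
    simpa [Function.comp_def] using (h1.tendsto 0).comp h0
  refine tendsto_nhds_unique hk.1 (((hk.2.sub_const _).div (hz'.sub_const z)
    (ofReal_sub_ne_zero hz k)).congr' ?_)
  have hne : ∀ᶠ n in atTop, (k : ℂ) + ((s * u n : ℝ) : ℂ) * Complex.I ≠ z :=
    hz'.eventually_ne (sub_ne_zero.1 (ofReal_sub_ne_zero hz k))
  filter_upwards [hne, hu.eventually self_mem_nhdsWithin] with n h1 h2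
  have h3 : u n ≠ 0 := (Set.mem_Ioi.1 h2).ne'
  rw [cauchyTransform_mulInvSub hz (by simp [hs, h3]) h1]
  rfl

lemma integrable_mul_L2R (f g : L2R) : Integrable fun x : ℝ => f x * g x :=
  (Lp.memLp f).integrable_mul (Lp.memLp g)

/-- Multiplicativity of the Cauchy transform on boundary values from the same half-plane. -/
lemma cauchyTransform_bdry_mul_bdry {s : ℝ} (hs : s ≠ 0) (f g : L2R) {z : ℂ} (hz : z.im ≠ 0) :
    cauchyTransform (fun x => bdry s f x * bdry s g x) z =
      cauchyTransform g z * cauchyTransform (bdry s f) z := by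
  -- The function `bdry s g / (x - z)` is the boundary value of `mulInvSub hz g` plus a multiple of
  -- the Cauchy kernel; the first part integrates to zero against `bdry s f`.
  have e : ∀ᵐ x : ℝ, bdry s f x * bdry s g x / ((x : ℂ) - z) =
      bdry s f x * bdry s (mulInvSub hz g) x +
        cauchyTransform g z * (bdry s f x / ((x : ℂ) - z)) := by
    filter_upwards [bdry_mulInvSub hs hz g] with x hx
    rw [hx]
    have := ofReal_sub_ne_zero hz x
    field_simp
    ring
  rw [cauchyTransform, integral_congr_ae e, integral_add
    (integrable_mul_L2R _ _) ((integrable_div_sub _ hz).const_mul _),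
    integral_bdry_mul_bdry hs, zero_add, integral_const_mul, cauchyTransform, cauchyTransform]

lemma bdry_eq_zero {s : ℝ} (hs : s ≠ 0) (h : L2R)
    (h0 : ∀ z : ℂ, 0 < s * z.im → cauchyTransform h z = 0) : ∀ᵐ k : ℝ, bdry s h k = 0 := by
  obtain ⟨u, hu, hu'⟩ := (tendstoInMeasure_bdry hs h).exists_seq_tendsto_ae'
  filter_upwards [hu'] with k hk
  refine tendsto_nhds_unique hk (tendsto_const_nhds.congr' ?_)
  filter_upwards [hu.eventually self_mem_nhdsWithin] with n h2
  have h3 : 0 < u n := h2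
  rw [h0]
  have : 0 < s ^ 2 * u n := by positivity
  simp
  linarith

/-! ### Holomorphic functions in a half-plane -/

/-- The hypothesis covers both `L²` and `L¹` densities. For `z` within `|z₀.im| / 2` of `z₀` one has
`|x - z| ≥ |x - z₀| / 2`, which dominates the derivative of the integrand. -/
lemma differentiableAt_cauchyTransform {f : ℝ → ℂ} {z₀ : ℂ} (hz₀ : z₀.im ≠ 0)
    (hf : Integrable fun x : ℝ => f x / ((x : ℂ) - z₀)) :
    DifferentiableAt ℂ (cauchyTransform f) z₀ := by
  have hpos : 0 < |z₀.im| := abs_pos.2 hz₀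
  have hfm : AEStronglyMeasurable f volume := by
    have : AEStronglyMeasurable (fun x : ℝ => f x / ((x : ℂ) - z₀) * ((x : ℂ) - z₀)) volume :=
      hf.1.mul (by fun_prop : Continuous fun x : ℝ => (x : ℂ) - z₀).aestronglyMeasurable
    refine this.congr (Eventually.of_forall fun x => ?_)
    have := ofReal_sub_ne_zero hz₀ x
    field_simp
  have hm : ∀ z : ℂ, AEStronglyMeasurable (fun x : ℝ => f x / ((x : ℂ) - z)) volume := fun z => by
    simp_rw [div_eq_mul_inv]
    exact hfm.mul (Measurable.aestronglyMeasurable (by fun_prop))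
  have hlow : ∀ x : ℝ, ∀ z ∈ Metric.ball z₀ (|z₀.im| / 2), ‖(x : ℂ) - z₀‖ / 2 ≤ ‖(x : ℂ) - z‖ := by
    intro x z hz
    have h1 := abs_im_le_norm_ofReal_sub z₀ x
    have h2 : ‖z - z₀‖ < |z₀.im| / 2 := by simpa [dist_eq_norm] using hz
    have h3 : ‖(x : ℂ) - z₀‖ ≤ ‖(x : ℂ) - z‖ + ‖z - z₀‖ := by
      simpa using norm_add_le ((x : ℂ) - z) (z - z₀)
    linarith
  have hne : ∀ x : ℝ, ∀ z ∈ Metric.ball z₀ (|z₀.im| / 2), (x : ℂ) - z ≠ 0 := by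
    intro x z hz h0
    have := hlow x z hz
    rw [h0, norm_zero] at this
    have := abs_im_le_norm_ofReal_sub z₀ x
    linarith
  refine (hasDerivAt_integral_of_dominated_loc_of_deriv_le
    (F := fun z (x : ℝ) => f x / ((x : ℂ) - z)) (F' := fun z (x : ℝ) => f x / ((x : ℂ) - z) ^ 2)
    (bound := fun x : ℝ => 4 / |z₀.im| * ‖f x / ((x : ℂ) - z₀)‖)
    (Metric.ball_mem_nhds z₀ (half_pos hpos)) (Eventually.of_forall hm) hf ?_ ?_ ?_ ?_).2.differentiableAt
  · simp_rw [div_eq_mul_inv]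
    exact hfm.mul (Measurable.aestronglyMeasurable (by fun_prop))
  · refine Eventually.of_forall fun x z hz => ?_
    have h1 := hlow x z hz
    have h2 := abs_im_le_norm_ofReal_sub z₀ x
    have h3 : 0 < ‖(x : ℂ) - z₀‖ := hpos.trans_le h2
    rw [norm_div, norm_div, norm_pow]
    calc ‖f x‖ / ‖(x : ℂ) - z‖ ^ 2 ≤ ‖f x‖ / (‖(x : ℂ) - z₀‖ / 2) ^ 2 := by gcongr
      _ = 4 / ‖(x : ℂ) - z₀‖ * (‖f x‖ / ‖(x : ℂ) - z₀‖) := by field_simp; norm_num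
      _ ≤ _ := by gcongr
  · exact hf.norm.const_mul _
  · refine Eventually.of_forall fun x z hz => ?_
    have h1 : HasDerivAt (fun z : ℂ => (x : ℂ) - z) (-1) z := by
      simpa using (hasDerivAt_id z).const_sub (x : ℂ)
    have := (hasDerivAt_const z (f x)).div h1 (hne x z hz)
    simpa [Pi.div_def] using this

/-- A function that is holomorphic in the closed upper half-plane and decays quadratically has mean
value zero on the real line. -/
lemma integral_eq_zero_of_halfPlane {Q : ℂ → ℂ} (hd : ∀ ζ : ℂ, 0 ≤ ζ.im → DifferentiableAt ℂ Q ζ)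
    {C r : ℝ} (hb : ∀ ζ : ℂ, 0 ≤ ζ.im → r ≤ ‖ζ‖ → ‖Q ζ‖ ≤ C / ‖ζ‖ ^ 2)
    (hi : Integrable fun x : ℝ => Q x) : ∫ x : ℝ, Q x = 0 := by
  have h1 := intervalIntegral_tendsto_integral hi tendsto_neg_atTop_atBot tendsto_id
  refine tendsto_nhds_unique h1 ?_
  have hbound : ∀ᶠ R : ℝ in atTop, ‖∫ x in (-R)..R, Q x‖ ≤ 4 * C / R := by
    filter_upwards [eventually_gt_atTop 0, eventually_ge_atTop r] with R hR hRr
    have hC : ∀ ζ : ℂ, 0 ≤ ζ.im → R ≤ ‖ζ‖ → ‖Q ζ‖ ≤ C / R ^ 2 := fun ζ h2 h3 => by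
      have hC0 : 0 ≤ C := by
        have := (norm_nonneg _).trans (hb ζ h2 (hRr.trans h3))
        have h4 : 0 < ‖ζ‖ ^ 2 := by have := hR.trans_le h3; positivity
        by_contra h5
        exact absurd this (not_le.2 (div_neg_of_neg_of_pos (not_le.1 h5) h4))
      exact (hb ζ h2 (hRr.trans h3)).trans (by gcongr)
    -- On the rectangle `[-R, R] × [0, R]` the three sides off the real line have total length `4R`,
    -- and there `|Q| ≤ C / R²`.
    have key := Complex.integral_boundary_rect_eq_zero_of_differentiableOn Q
      (⟨-R, 0⟩ : ℂ) (⟨R, R⟩ : ℂ) (fun ζ hζ => by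
        refine (hd ζ ?_).differentiableWithinAt
        have := hζ.2
        simp only [Set.mem_preimage, Set.uIcc_of_le hR.le] at this
        exact this.1)
    simp only [Complex.ofReal_zero, zero_mul, add_zero] at key
    have t1 : ‖∫ x : ℝ in (-R)..R, Q (x + R * Complex.I)‖ ≤ C / R ^ 2 * |R - -R| := by
      apply intervalIntegral.norm_integral_le_of_norm_le_const
      intro x _
      apply hC
      · simpa using hR.le
      · have := Complex.abs_im_le_norm (x + R * Complex.I)
        simpa [abs_of_pos hR] using this
    have t2 : ‖∫ y : ℝ in (0 : ℝ)..R, Q ((R : ℝ) + y * Complex.I)‖ ≤ C / R ^ 2 * |R - 0| := by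
      apply intervalIntegral.norm_integral_le_of_norm_le_const
      intro y hy
      rw [Set.uIoc_of_le hR.le] at hy
      apply hC
      · simpa using hy.1.le
      · have := Complex.abs_re_le_norm ((R : ℝ) + y * Complex.I)
        simpa [abs_of_pos hR] using this
    have t3 : ‖∫ y : ℝ in (0 : ℝ)..R, Q ((-R : ℝ) + y * Complex.I)‖ ≤ C / R ^ 2 * |R - 0| := by
      apply intervalIntegral.norm_integral_le_of_norm_le_const
      intro y hy
      rw [Set.uIoc_of_le hR.le] at hy
      apply hC
      · simpa using hy.1.le
      · have := Complex.abs_re_le_norm ((-R : ℝ) + y * Complex.I)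
        simpa [abs_of_pos hR] using this
    have e : ∫ x in (-R)..R, Q x = (∫ x : ℝ in (-R)..R, Q (x + R * Complex.I)) -
        Complex.I • (∫ y : ℝ in (0 : ℝ)..R, Q ((R : ℝ) + y * Complex.I)) +
        Complex.I • (∫ y : ℝ in (0 : ℝ)..R, Q ((-R : ℝ) + y * Complex.I)) := by
      linear_combination key
    rw [e]
    have i1 : |R - -R| = 2 * R := by rw [abs_of_pos (by linarith)]; ring
    have i2 : |R - 0| = R := by rw [sub_zero, abs_of_pos hR]
    rw [i1] at t1
    rw [i2] at t2 t3
    refine (norm_add_le _ _).trans ((add_le_add_left (norm_sub_le _ _) _).trans ?_)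
    rw [norm_smul, norm_smul, Complex.norm_I, one_mul, one_mul]
    have : C / R ^ 2 * (2 * R) + C / R ^ 2 * R + C / R ^ 2 * R = 4 * C / R := by
      field_simp; ring
    linarith
  exact squeeze_zero_norm' hbound (tendsto_const_nhds.div_atTop tendsto_id)

/-- The Poisson formula at the point `i` for bounded holomorphic functions. -/
lemma integral_div_one_add_sq_of_halfPlane {s : ℂ → ℂ} {ε : ℝ} (hε : 0 < ε)
    (hd : ∀ ζ : ℂ, -ε < ζ.im → DifferentiableAt ℂ s ζ) {C : ℝ}
    (hb : ∀ ζ : ℂ, 0 ≤ ζ.im → ‖s ζ‖ ≤ C) :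
    Integrable (fun x : ℝ => s x * (((1 + x ^ 2)⁻¹ : ℝ) : ℂ)) ∧
      ∫ x : ℝ, s x * (((1 + x ^ 2)⁻¹ : ℝ) : ℂ) = π * s Complex.I := by
  have hI : 0 ≤ Complex.I.im := by simp
  have hC0 : 0 ≤ C := (norm_nonneg _).trans (hb _ hI)
  have hopen : IsOpen {ζ : ℂ | -ε < ζ.im} := isOpen_lt continuous_const Complex.continuous_im
  have hcont : Continuous fun x : ℝ => s x := by
    rw [continuous_iff_continuousAt]
    intro x
    exact ((hd x (by simpa using hε)).continuousAt).comp Complex.continuous_ofReal.continuousAt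
  have hint : ∀ g : ℝ → ℂ, Continuous g → (∀ x, ‖g x‖ ≤ 2 * C) →
      Integrable fun x : ℝ => g x * (((1 + x ^ 2)⁻¹ : ℝ) : ℂ) := fun g hg hg' =>
    (integrable_inv_one_add_sq.ofReal).bdd_mul hg.aestronglyMeasurable (Eventually.of_forall hg')
  have hre : ∀ x : ℝ, ‖s x‖ ≤ C := fun x => hb x (by simp)
  have hsI := hb _ hI
  have hint1 := hint _ hcont fun x => (hre x).trans (by linarith)
  refine ⟨hint1, ?_⟩
  have hds : ∀ ζ : ℂ, -ε < ζ.im → DifferentiableAt ℂ (dslope s Complex.I) ζ := fun ζ hζ =>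
    ((Complex.differentiableOn_dslope (hopen.mem_nhds (by simp; linarith))).2
      (fun w hw => (hd w hw).differentiableWithinAt)).differentiableAt (hopen.mem_nhds hζ)
  have hne : ∀ ζ : ℂ, 0 ≤ ζ.im → ζ + Complex.I ≠ 0 := fun ζ hζ h => by
    have := congrArg Complex.im h
    simp at this
    linarith
  -- The function `(s ζ - s i) / (ζ² + 1)` has a removable singularity at `i`, which `dslope` fills,
  -- and decays quadratically because `s` is bounded.
  have eQ : ∀ x : ℝ, dslope s Complex.I x / (x + Complex.I) =
      (s x - s Complex.I) * (((1 + x ^ 2)⁻¹ : ℝ) : ℂ) := fun x => by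
    have h1 : (x : ℂ) - Complex.I ≠ 0 := ofReal_sub_ne_zero (by simp) x
    have h2 := hne x (by simp)
    have h3 : ((1 + x ^ 2 : ℝ) : ℂ) = (x - Complex.I) * (x + Complex.I) := by
      push_cast
      linear_combination Complex.I_sq
    rw [dslope_of_ne _ (sub_ne_zero.1 h1), slope_def_field, Complex.ofReal_inv, h3]
    field_simp
  have hint2 := hint (fun x => s x - s Complex.I) (hcont.sub continuous_const) fun x =>
    (norm_sub_le _ _).trans (by linarith [hre x])
  have hQ : ∫ x : ℝ, dslope s Complex.I x / (x + Complex.I) = 0 := by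
    refine integral_eq_zero_of_halfPlane (Q := fun ζ => dslope s Complex.I ζ / (ζ + Complex.I))
      (C := 4 * C) (r := 2) (fun ζ hζ => ?_) (fun ζ hζ hr => ?_) ?_
    · exact (hds ζ (by linarith)).div (by fun_prop) (hne ζ hζ)
    · have hnI : ζ ≠ Complex.I := fun h => by rw [h, Complex.norm_I] at hr; norm_num at hr
      rw [dslope_of_ne _ hnI, slope_def_field, div_div, norm_div]
      have e1 : (ζ - Complex.I) * (ζ + Complex.I) = ζ ^ 2 + 1 := by
        linear_combination (-1 : ℂ) * Complex.I_sq
      have e2 : ‖ζ‖ ^ 2 / 2 ≤ ‖ζ ^ 2 + 1‖ := by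
        have := norm_sub_norm_le (ζ ^ 2) (-1)
        simp only [norm_neg, norm_one, sub_neg_eq_add, norm_pow] at this
        nlinarith
      rw [e1]
      calc ‖s ζ - s Complex.I‖ / ‖ζ ^ 2 + 1‖ ≤ (2 * C) / (‖ζ‖ ^ 2 / 2) := by
            gcongr
            exact (norm_sub_le _ _).trans (by linarith [hb ζ hζ])
        _ = _ := by field_simp; ring
    · simpa only [eQ] using hint2
  simp_rw [eQ, sub_mul] at hQ
  have hint3 : Integrable fun x : ℝ => s Complex.I * (((1 + x ^ 2)⁻¹ : ℝ) : ℂ) :=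
    (integrable_inv_one_add_sq.ofReal).const_mul _
  have hpi : ∫ x : ℝ, (((1 + x ^ 2)⁻¹ : ℝ) : ℂ) = π := by
    rw [integral_complex_ofReal, integral_univ_inv_one_add_sq]
  rw [integral_sub hint1 hint3, integral_const_mul, hpi, sub_eq_zero] at hQ
  rw [hQ, mul_comm]

/-! ### Cauchy transforms of integrable functions -/

lemma integrable_div_sub_of_integrable {f : ℝ → ℂ} (hf : Integrable f) {z : ℂ} (hz : z.im ≠ 0) :
    Integrable fun x : ℝ => f x / ((x : ℂ) - z) := by
  simp_rw [div_eq_inv_mul]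
  exact hf.bdd_mul (continuous_inv_sub hz).aestronglyMeasurable
    (Eventually.of_forall (norm_inv_sub_le hz))

lemma norm_cauchyTransform_le {f : ℝ → ℂ} (hf : Integrable f) {z : ℂ} (hz : z.im ≠ 0) :
    ‖cauchyTransform f z‖ ≤ |z.im|⁻¹ * ∫ x, ‖f x‖ := by
  rw [cauchyTransform, ← integral_const_mul]
  refine norm_integral_le_of_norm_le (hf.norm.const_mul _) (Eventually.of_forall fun x => ?_)
  rw [div_eq_inv_mul, norm_mul]
  gcongr
  exact norm_inv_sub_le hz x

lemma im_cauchyTransform_nonneg {p : ℝ → ℝ} (hp : Integrable p) (h0 : ∀ x, 0 ≤ p x) {z : ℂ}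
    (hz : 0 < z.im) : 0 ≤ (cauchyTransform (fun x => (p x : ℂ)) z).im := by
  have hi := integrable_div_sub_of_integrable hp.ofReal hz.ne'
  have : (cauchyTransform (fun x => (p x : ℂ)) z).im = ∫ x, ((p x : ℂ) / ((x : ℂ) - z)).im :=
    (integral_im hi).symm
  rw [this]
  refine integral_nonneg fun x => ?_
  rw [Pi.zero_apply, Complex.div_im]
  simp only [Complex.ofReal_im, zero_mul, zero_div, Complex.ofReal_re, Complex.sub_im, zero_sub,
    mul_neg, neg_div, sub_neg_eq_add, zero_add]
  exact div_nonneg (mul_nonneg (h0 x) hz.le) (Complex.normSq_nonneg _)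

/-- For the principal root `r`, positivity of `Re w = (Re r)² - (Im r)²` makes the real part
dominate, so `|w| = |r|² ≤ 2 (Re r)²`. -/
lemma norm_le_sq_re_sqrt {w : ℂ} (hw : 0 < w.re) :
    0 ≤ (w ^ ((2 : ℕ)⁻¹ : ℂ)).re ∧ √‖w‖ ≤ 2 * (w ^ ((2 : ℕ)⁻¹ : ℂ)).re := by
  set r := w ^ ((2 : ℕ)⁻¹ : ℂ) with hr
  have hw0 : w ≠ 0 := fun h => by simp [h] at hw
  have hre : 0 ≤ r.re := by
    rw [hr, Complex.cpow_def_of_ne_zero hw0, Complex.exp_re]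
    have h1 := Complex.abs_arg_le_pi_div_two_iff.2 hw.le
    have e : (Complex.log w * ((2 : ℕ)⁻¹ : ℂ)).im = Complex.arg w / 2 := by
      have : ((2 : ℕ)⁻¹ : ℂ) = ((2⁻¹ : ℝ) : ℂ) := by push_cast; rfl
      rw [this, Complex.im_mul_ofReal, Complex.log_im]
      ring
    rw [e]
    have h2 := abs_le.1 h1
    exact mul_nonneg (Real.exp_pos _).le (Real.cos_nonneg_of_mem_Icc
      ⟨by linarith [Real.pi_pos], by linarith [Real.pi_pos]⟩)
  refine ⟨hre, ?_⟩
  have hsq : r ^ 2 = w := Complex.cpow_nat_inv_pow w two_ne_zero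
  have h1 : w.re = r.re ^ 2 - r.im ^ 2 := by
    rw [← hsq, sq, Complex.mul_re]; ring
  have h2 : ‖w‖ = r.re ^ 2 + r.im ^ 2 := by
    rw [← hsq, norm_pow, ← Complex.normSq_eq_norm_sq, Complex.normSq_apply]; ring
  apply Real.sqrt_le_iff.2
  constructor
  · linarith
  · rw [h2]; nlinarith

/-- Kolmogorov's estimate for the Cauchy transform of a nonnegative integrable function. -/
lemma lintegral_sqrt_cauchyTransform_le {p : ℝ → ℝ} (hp : Integrable p) (h0 : ∀ x, 0 ≤ p x)
    {ε : ℝ} (hε : 0 < ε) :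
    ∫⁻ k : ℝ, ENNReal.ofReal (√‖cauchyTransform (fun x => (p x : ℂ)) (k + ε * Complex.I)‖ *
      (1 + k ^ 2)⁻¹) ≤ ENNReal.ofReal (2 * (π * √(1 + ∫ x, p x))) := by
  set P : ℂ → ℂ := cauchyTransform (fun x => (p x : ℂ)) with hP
  -- Since `Im P ≥ 0` in the upper half-plane, `Re g ≥ 1` and the principal root of `g` is
  -- holomorphic. The shift by `ε` makes it bounded up to the real line, so that the Poisson formula
  -- at `i` applies.
  set g : ℂ → ℂ := fun ζ => 1 - Complex.I * P (ζ + ε * Complex.I) with hg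
  set s : ℂ → ℂ := fun ζ => g ζ ^ ((2 : ℕ)⁻¹ : ℂ) with hs
  have him : ∀ ζ : ℂ, (ζ + ε * Complex.I).im = ζ.im + ε := fun ζ => by simp
  have hgre : ∀ ζ : ℂ, -ε < ζ.im → 1 ≤ (g ζ).re := fun ζ hζ => by
    have := im_cauchyTransform_nonneg hp h0 (z := ζ + ε * Complex.I) (by rw [him]; linarith)
    simp [hg]
    exact this
  have hgd : ∀ ζ : ℂ, -ε < ζ.im → DifferentiableAt ℂ g ζ := fun ζ hζ => by
    have h1 : (ζ + ε * Complex.I).im ≠ 0 := by rw [him]; linarith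
    have h2 := differentiableAt_cauchyTransform h1 (integrable_div_sub_of_integrable hp.ofReal h1)
    exact ((h2.comp ζ (by fun_prop : DifferentiableAt ℂ (fun ζ => ζ + ε * Complex.I) ζ)).const_mul
      Complex.I).const_sub 1
  have hsd : ∀ ζ : ℂ, -ε < ζ.im → DifferentiableAt ℂ s ζ := fun ζ hζ =>
    (hgd ζ hζ).cpow_const (Or.inl (by linarith [hgre ζ hζ]))
  have hsn : ∀ ζ, ‖s ζ‖ = √‖g ζ‖ := fun ζ => by
    rw [hs, Complex.norm_cpow_inv_nat, Real.sqrt_eq_rpow]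
    norm_num
  have hnn : ∫ x, ‖(p x : ℂ)‖ = ∫ x, p x := by
    congr 1; ext x; rw [Complex.norm_real, Real.norm_of_nonneg (h0 x)]
  have hip : 0 ≤ ∫ x, p x := integral_nonneg h0
  have hgn : ∀ ζ : ℂ, ∀ c > 0, c ≤ ζ.im + ε → ‖g ζ‖ ≤ 1 + c⁻¹ * ∫ x, p x := fun ζ c hc hζ => by
    refine (norm_sub_le _ _).trans ?_
    rw [norm_one, norm_mul, Complex.norm_I, one_mul]
    have h1 : 0 < ζ.im + ε := by linarith
    have := norm_cauchyTransform_le hp.ofReal (z := ζ + ε * Complex.I) (by rw [him]; exact h1.ne')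
    rw [him, abs_of_pos h1] at this
    simp only [RCLike.ofReal_eq_complex_ofReal, hnn] at this
    have h2 : (ζ.im + ε)⁻¹ * ∫ x, p x ≤ c⁻¹ * ∫ x, p x := by gcongr
    linarith
  have hsb : ∀ ζ : ℂ, 0 ≤ ζ.im → ‖s ζ‖ ≤ √(1 + ε⁻¹ * ∫ x, p x) := fun ζ hζ => by
    rw [hsn]
    exact Real.sqrt_le_sqrt (hgn ζ ε hε (by linarith))
  obtain ⟨hi, he⟩ := integral_div_one_add_sq_of_halfPlane hε hsd hsb
  have hre : ∫ x : ℝ, (s x).re * (1 + x ^ 2)⁻¹ = π * (s Complex.I).re := by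
    have h1 := integral_re hi
    rw [RCLike.re_eq_complex_re, he, Complex.re_ofReal_mul] at h1
    rw [← h1]
    congr 1; ext x
    exact (Complex.re_mul_ofReal _ _).symm
  have hire : Integrable fun x : ℝ => (s x).re * (1 + x ^ 2)⁻¹ := by
    refine hi.re.congr (Eventually.of_forall fun x => ?_)
    exact Complex.re_mul_ofReal _ _
  calc ∫⁻ k : ℝ, ENNReal.ofReal (√‖P (k + ε * Complex.I)‖ * (1 + k ^ 2)⁻¹)
      ≤ ∫⁻ k : ℝ, ENNReal.ofReal (2 * ((s k).re * (1 + k ^ 2)⁻¹)) := by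
        refine lintegral_mono fun k => ENNReal.ofReal_le_ofReal ?_
        have hk : -ε < (k : ℂ).im := by simpa using hε
        have h1 := (norm_le_sq_re_sqrt (w := g k) (by linarith [hgre k hk])).2
        have h2 : ‖P (k + ε * Complex.I)‖ ≤ ‖g k‖ := by
          have him' : 0 ≤ (P (k + ε * Complex.I)).im :=
            im_cauchyTransform_nonneg hp h0 (by simpa using hε)
          rw [Complex.norm_eq_sqrt_sq_add_sq, Complex.norm_eq_sqrt_sq_add_sq]
          apply Real.sqrt_le_sqrt
          simp [hg]
          nlinarith
        rw [← mul_assoc]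
        gcongr
        exact (Real.sqrt_le_sqrt h2).trans h1
    _ = ENNReal.ofReal (2 * (π * (s Complex.I).re)) := by
        rw [← hre, ← integral_const_mul, ofReal_integral_eq_lintegral_ofReal (hire.const_mul 2)]
        refine Eventually.of_forall fun x => ?_
        have hk : -ε < (x : ℂ).im := by simpa using hε
        have := (norm_le_sq_re_sqrt (w := g x) (by linarith [hgre x hk])).1
        have h3 : 0 ≤ (s x).re := this
        simp only [Pi.zero_apply]
        positivity
    _ ≤ _ := by
        gcongr
        refine (Complex.re_le_norm _).trans ?_
        rw [hsn]
        apply Real.sqrt_le_sqrt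
        simpa using hgn Complex.I 1 one_pos (by simp; linarith)

lemma norm_cauchyTransform_conj_ofReal (p : ℝ → ℝ) (z : ℂ) :
    ‖cauchyTransform (fun x => (p x : ℂ)) (conj z)‖ = ‖cauchyTransform (fun x => (p x : ℂ)) z‖ := by
  have := cauchyTransform_conj (fun x => (p x : ℂ)) z
  simp only [Complex.conj_ofReal] at this
  rw [this, RCLike.norm_conj]

/-- Cauchy transforms of integrable functions do not blow up at almost every point of the line. -/
lemma ae_frequently_norm_cauchyTransform_le {f : ℝ → ℂ} (hf : Integrable f) {u : ℕ → ℝ}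
    (hu : ∀ n, 0 < u n) :
    ∀ᵐ k : ℝ, ∃ M : ℝ, ∃ᶠ n in atTop,
      ‖cauchyTransform f (k + ((-1 * u n : ℝ) : ℂ) * Complex.I)‖ ≤ M := by
  -- Kolmogorov's estimate needs a nonnegative density, hence the four parts of `f`.
  let p : Fin 4 → ℝ → ℝ := ![fun x => max (f x).re 0, fun x => max (-(f x).re) 0,
    fun x => max (f x).im 0, fun x => max (-(f x).im) 0]
  have hp : ∀ j, Integrable (p j) := by
    intro j
    fin_cases j
    · exact hf.re.pos_part
    · exact hf.re.neg_part
    · exact hf.im.pos_part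
    · exact hf.im.neg_part
  have hp0 : ∀ j x, 0 ≤ p j x := by
    intro j x
    fin_cases j <;> exact le_max_right _ _
  set P : Fin 4 → ℂ → ℂ := fun j => cauchyTransform fun x => (p j x : ℂ) with hP
  have hfp : ∀ x, f x = p 0 x - p 1 x + Complex.I * (p 2 x - p 3 x) := fun x => by
    have h1 : ∀ a : ℝ, max a 0 - max (-a) 0 = a := fun a => max_zero_sub_eq_self a
    apply Complex.ext
    · simp [p, h1]
    · simp [p, h1]
  have hsum : ∀ z : ℂ, z.im ≠ 0 → ‖cauchyTransform f z‖ ≤ ∑ j, ‖P j z‖ := fun z hz => by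
    have hi : ∀ j, Integrable fun x : ℝ => (p j x : ℂ) / ((x : ℂ) - z) := fun j =>
      integrable_div_sub_of_integrable (hp j).ofReal hz
    have : cauchyTransform f z = P 0 z - P 1 z + Complex.I * (P 2 z - P 3 z) := by
      simp only [hP, cauchyTransform]
      have e : ∀ x : ℝ, f x / ((x : ℂ) - z) = ((p 0 x : ℂ) / ((x : ℂ) - z) -
          (p 1 x : ℂ) / ((x : ℂ) - z)) + Complex.I * ((p 2 x : ℂ) / ((x : ℂ) - z) -
          (p 3 x : ℂ) / ((x : ℂ) - z)) := fun x => by rw [hfp]; ring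
      simp_rw [e]
      have hi' : ∀ i j, Integrable fun x : ℝ => (p i x : ℂ) / ((x : ℂ) - z) -
          (p j x : ℂ) / ((x : ℂ) - z) := fun i j => (hi i).sub (hi j)
      rw [integral_add (hi' 0 1) ((hi' 2 3).const_mul _), integral_const_mul,
        integral_sub (hi 0) (hi 1), integral_sub (hi 2) (hi 3)]
    rw [this, Fin.sum_univ_four]
    refine (norm_add_le _ _).trans ?_
    rw [norm_mul, Complex.norm_I, one_mul]
    linarith [norm_sub_le (P 0 z) (P 1 z), norm_sub_le (P 2 z) (P 3 z)]
  let A : ℕ → ℝ → ℝ≥0∞ := fun n k => ∑ j, ENNReal.ofReal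
    (√‖P j (k + (u n : ℂ) * Complex.I)‖ * (1 + k ^ 2)⁻¹)
  have hAj : ∀ n j, AEMeasurable (fun k : ℝ => ENNReal.ofReal
      (√‖P j (k + (u n : ℂ) * Complex.I)‖ * (1 + k ^ 2)⁻¹)) := fun n j => by
    have h1 := aestronglyMeasurable_cauchyTransform_line (hp j).ofReal.1 (u n)
    exact ((h1.norm.aemeasurable.sqrt).mul (by fun_prop)).ennreal_ofReal
  have hA : ∀ n, AEMeasurable (A n) := fun n => by
    have := Finset.aemeasurable_sum (f := fun j (k : ℝ) => ENNReal.ofReal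
      (√‖P j (k + (u n : ℂ) * Complex.I)‖ * (1 + k ^ 2)⁻¹)) Finset.univ fun j _ => hAj n j
    refine this.congr (Eventually.of_forall fun k => ?_)
    simp [A]
  have hbound : ∀ n, ∫⁻ k, A n k ≤ ∑ j, ENNReal.ofReal (2 * (π * √(1 + ∫ x, p j x))) := fun n => by
    rw [lintegral_finsetSum' _ fun j _ => hAj n j]
    exact Finset.sum_le_sum fun j _ => lintegral_sqrt_cauchyTransform_le (hp j) (hp0 j) (hu n)
  -- Fatou's lemma controls only the lower limit, so the bound holds for infinitely many `n`,
  -- depending on `k`.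
  have hlim : ∫⁻ k, liminf (fun n => A n k) atTop ≠ ∞ := by
    refine ne_top_of_le_ne_top (b := ∑ j, ENNReal.ofReal (2 * (π * √(1 + ∫ x, p j x)))) ?_ ?_
    · exact ENNReal.sum_ne_top.2 fun j _ => ENNReal.ofReal_ne_top
    · refine (lintegral_liminf_le' hA).trans ?_
      exact liminf_le_of_le (by isBoundedDefault) fun b hb =>
        (hb.exists.choose_spec).trans (hbound _)
  have hmeas : AEMeasurable fun k => liminf (fun n => A n k) atTop := by
    simp_rw [liminf_eq_iSup_iInf_of_nat]
    exact AEMeasurable.iSup fun n => AEMeasurable.biInf _ (Set.to_countable _) fun i _ => hA i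
  filter_upwards [ae_lt_top' hmeas hlim] with k hk
  obtain ⟨N, hN1, hN2⟩ := ENNReal.lt_iff_exists_nnreal_btwn.1 hk
  have hfr := frequently_lt_of_liminf_lt (by isBoundedDefault) hN1
  refine ⟨∑ _j : Fin 4, ((N : ℝ) * (1 + k ^ 2)) ^ 2, hfr.mono fun n hn => ?_⟩
  have hk0 : 0 < 1 + k ^ 2 := by positivity
  refine (hsum _ (by simp [(hu n).ne'])).trans (Finset.sum_le_sum fun j _ => ?_)
  -- The densities are real, so values below the line are conjugate to values above it.
  have e1 : (k : ℂ) + ((-1 * u n : ℝ) : ℂ) * Complex.I = conj ((k : ℂ) + (u n : ℂ) * Complex.I) := by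
    simp
  have e2 : ‖P j (k + ((-1 * u n : ℝ) : ℂ) * Complex.I)‖ = ‖P j (k + (u n : ℂ) * Complex.I)‖ := by
    rw [e1]
    exact norm_cauchyTransform_conj_ofReal _ _
  rw [e2]
  have h1 : ENNReal.ofReal (√‖P j (k + (u n : ℂ) * Complex.I)‖ * (1 + k ^ 2)⁻¹) ≤ N :=
    (Finset.single_le_sum (f := fun j => ENNReal.ofReal
      (√‖P j (k + (u n : ℂ) * Complex.I)‖ * (1 + k ^ 2)⁻¹)) (fun _ _ => zero_le)
      (Finset.mem_univ j)).trans hn.le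
  have h2 : √‖P j (k + (u n : ℂ) * Complex.I)‖ * (1 + k ^ 2)⁻¹ ≤ N := by
    have := (ENNReal.ofReal_le_iff_le_toReal ENNReal.coe_ne_top).1 h1
    simpa using this
  rw [← div_eq_mul_inv, div_le_iff₀ hk0] at h2
  exact (Real.sqrt_le_left (by positivity)).1 h2

/-! ### The jump of the Cauchy transform of an integrable function -/

/-- The difference of the values of the Cauchy transform at `k + iε` and `k - iε`. -/
def cauchyJump (f : ℝ → ℂ) (ε k : ℝ) : ℂ :=
  cauchyTransform f (k + ((1 * ε : ℝ) : ℂ) * Complex.I) -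
    cauchyTransform f (k + ((-1 * ε : ℝ) : ℂ) * Complex.I)

lemma tendstoInMeasure_cauchyJump_L2R (h : L2R) :
    TendstoInMeasure volume (cauchyJump h) (𝓝[>] 0) fun k => 2 * π * Complex.I * h k := by
  have hm : ∀ η : ℝ, AEStronglyMeasurable
      (fun k : ℝ => cauchyTransform h (k + (η : ℂ) * Complex.I)) volume := fun η =>
    aestronglyMeasurable_cauchyTransform_line (Lp.aestronglyMeasurable h) η
  refine tendstoInMeasure_of_tendsto_eLpNorm (p := 2) two_ne_zero (fun ε => (hm _).sub (hm _))
    ((Lp.aestronglyMeasurable h).const_mul _) ?_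
  have h1 := (tendsto_cauchyTransform_bdry one_ne_zero h).add
    (tendsto_cauchyTransform_bdry (neg_ne_zero.2 one_ne_zero) h)
  rw [add_zero] at h1
  refine tendsto_of_tendsto_of_tendsto_of_le_of_le tendsto_const_nhds h1 (fun _ => zero_le)
    fun ε => ?_
  refine le_trans (le_of_eq (eLpNorm_congr_ae ?_)) (eLpNorm_sub_le
    ((hm _).sub (Lp.aestronglyMeasurable (bdry 1 h)))
    ((hm _).sub (Lp.aestronglyMeasurable (bdry (-1) h))) (by norm_num))
  filter_upwards [bdry_sub_bdry_ae h] with k hk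
  simp only [Pi.sub_apply, ← hk, cauchyJump]
  ring

/-- The jump is `i` times a Poisson integral whose kernel has total mass `2π`. -/
lemma cauchyJump_eq {f : ℝ → ℂ} (hf : Integrable f) {ε : ℝ} (hε : 0 < ε) (k : ℝ) :
    cauchyJump f ε k = ∫ x, f x * (Complex.I * ((2 * ε / ((x - k) ^ 2 + ε ^ 2) : ℝ) : ℂ)) := by
  have h1 : ((k : ℂ) + ((1 * ε : ℝ) : ℂ) * Complex.I).im ≠ 0 := by simp [hε.ne']
  have h2 : ((k : ℂ) + ((-1 * ε : ℝ) : ℂ) * Complex.I).im ≠ 0 := by simp [hε.ne']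
  rw [cauchyJump, cauchyTransform, cauchyTransform,
    ← integral_sub (integrable_div_sub_of_integrable hf h1) (integrable_div_sub_of_integrable hf h2)]
  congr 1; ext x
  have h3 := ofReal_sub_ne_zero h1 x
  have h4 := ofReal_sub_ne_zero h2 x
  have h5 : ((x : ℂ) - k) ^ 2 + ε ^ 2 = (x - (k + ((1 * ε : ℝ) : ℂ) * Complex.I)) *
      (x - (k + ((-1 * ε : ℝ) : ℂ) * Complex.I)) := by
    push_cast
    linear_combination (ε : ℂ) ^ 2 * Complex.I_sq
  have h6 : (x - (k + ((-1 * ε : ℝ) : ℂ) * Complex.I)) - (x - (k + ((1 * ε : ℝ) : ℂ) * Complex.I)) =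
      2 * ε * Complex.I := by
    push_cast
    ring
  have h7 : ((2 * ε / ((x - k) ^ 2 + ε ^ 2) : ℝ) : ℂ) = 2 * ε / (((x : ℂ) - k) ^ 2 + ε ^ 2) := by
    push_cast
    rfl
  rw [h7, h5, div_sub_div _ _ h3 h4, ← mul_div_assoc, ← mul_div_assoc, mul_comm Complex.I, ← h6]
  congr 1
  ring

lemma lintegral_poisson_kernel {ε : ℝ} (hε : 0 < ε) (x : ℝ) :
    ∫⁻ k : ℝ, ENNReal.ofReal (2 * ε / ((x - k) ^ 2 + ε ^ 2)) = ENNReal.ofReal (2 * π) := by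
  rw [lintegral_sub_left_eq_self (fun y : ℝ => ENNReal.ofReal (2 * ε / (y ^ 2 + ε ^ 2))) x]
  have e : ∀ y : ℝ, 2 * ε / (y ^ 2 + ε ^ 2) = 2 / ε * (1 + (y / ε) ^ 2)⁻¹ := fun y => by
    field_simp
    ring
  simp_rw [e]
  rw [← ofReal_integral_eq_lintegral_ofReal
    ((integrable_inv_one_add_sq.comp_div hε.ne').const_mul _)
    (Eventually.of_forall fun y => by simp only [Pi.zero_apply]; positivity), integral_const_mul,
    Measure.integral_comp_div (fun y : ℝ => (1 + y ^ 2)⁻¹) ε, integral_univ_inv_one_add_sq,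
    abs_of_pos hε, smul_eq_mul]
  congr 1
  field_simp

lemma lintegral_cauchyJump_le {f : ℝ → ℂ} (hf : Integrable f) {ε : ℝ} (hε : 0 < ε) :
    ∫⁻ k, ‖cauchyJump f ε k‖ₑ ≤ ENNReal.ofReal (2 * π) * ∫⁻ x, ‖f x‖ₑ := by
  calc ∫⁻ k, ‖cauchyJump f ε k‖ₑ
      ≤ ∫⁻ k, ∫⁻ x, ‖f x‖ₑ * ENNReal.ofReal (2 * ε / ((x - k) ^ 2 + ε ^ 2)) := by
        refine lintegral_mono fun k => ?_
        rw [cauchyJump_eq hf hε]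
        refine (enorm_integral_le_lintegral_enorm _).trans (lintegral_mono fun x => le_of_eq ?_)
        rw [enorm_mul, enorm_mul, ← ofReal_norm Complex.I, Complex.norm_I, ENNReal.ofReal_one,
          one_mul, ← ofReal_norm ((_ : ℝ) : ℂ), Complex.norm_real,
          Real.norm_of_nonneg (by positivity)]
    _ = ∫⁻ x, ∫⁻ k, ‖f x‖ₑ * ENNReal.ofReal (2 * ε / ((x - k) ^ 2 + ε ^ 2)) := by
        apply lintegral_lintegral_swap
        refine (hf.1.enorm.comp_snd (μ := volume)).mul (Measurable.aemeasurable ?_)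
        fun_prop
    _ = ∫⁻ x, ‖f x‖ₑ * ENNReal.ofReal (2 * π) := by
        refine lintegral_congr fun x => ?_
        rw [lintegral_const_mul' _ _ enorm_ne_top, lintegral_poisson_kernel hε]
    _ = _ := by
        rw [lintegral_mul_const' _ _ ENNReal.ofReal_ne_top, mul_comm]

lemma cauchyJump_sub {f g : ℝ → ℂ} (hf : Integrable f) (hg : Integrable g) {ε : ℝ} (hε : 0 < ε)
    (k : ℝ) : cauchyJump (fun x => f x - g x) ε k = cauchyJump f ε k - cauchyJump g ε k := by
  have h1 : ((k : ℂ) + ((1 * ε : ℝ) : ℂ) * Complex.I).im ≠ 0 := by simp [hε.ne']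
  have h2 : ((k : ℂ) + ((-1 * ε : ℝ) : ℂ) * Complex.I).im ≠ 0 := by simp [hε.ne']
  simp only [cauchyJump, cauchyTransform, sub_div]
  rw [integral_sub (integrable_div_sub_of_integrable hf h1) (integrable_div_sub_of_integrable hg h1),
    integral_sub (integrable_div_sub_of_integrable hf h2) (integrable_div_sub_of_integrable hg h2)]
  ring

/-- The Poisson integrals of an integrable function converge to it in measure. -/
lemma tendstoInMeasure_cauchyJump {f : ℝ → ℂ} (hf : Integrable f) :
    TendstoInMeasure volume (cauchyJump f) (𝓝[>] 0) fun k => 2 * π * Complex.I * f k := by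
  rw [tendstoInMeasure_iff_enorm]
  intro δ hδ hδt
  rw [ENNReal.tendsto_nhds_zero]
  intro η hη
  by_cases hηt : η = ∞
  · simp [hηt]
  set C : ℝ≥0∞ := ENNReal.ofReal (2 * π) with hC
  have hC0 : C ≠ 0 := by rw [hC, Ne, ENNReal.ofReal_eq_zero, not_le]; positivity
  have hCt : C ≠ ∞ := ENNReal.ofReal_ne_top
  have hδ2 : δ / 2 ≠ 0 := (ENNReal.half_pos hδ.ne').ne'
  have hδ2t : δ / 2 ≠ ∞ := ne_top_of_le_ne_top hδt ENNReal.half_le_self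
  -- The approximation error consists of the jump of `f - g` and of `2πi (f - g)`, each with `L¹`
  -- norm at most `C κ`; `κ` makes Markov's inequality at level `δ / 2` yield `η / 2`.
  obtain ⟨κ, hκ0, hκ⟩ : ∃ κ : ℝ≥0∞, κ ≠ 0 ∧ (C * κ + C * κ) / (δ / 2) ≤ η / 2 := by
    refine ⟨(η / 2) * (δ / 2) / (C + C), ?_, ?_⟩
    · exact (ENNReal.div_pos (mul_ne_zero (ENNReal.half_pos hη.ne').ne' hδ2)
        (ENNReal.add_ne_top.2 ⟨hCt, hCt⟩)).ne'
    · rw [← add_mul, ENNReal.mul_div_cancel (by simp [hC0]) (ENNReal.add_ne_top.2 ⟨hCt, hCt⟩),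
        ENNReal.mul_div_cancel_right hδ2 hδ2t]
  obtain ⟨g, hgs, hfg, hgc, hgi⟩ := hf.exists_hasCompactSupport_lintegral_sub_le hκ0
  have hg2 : MemLp g 2 volume := hgc.memLp_of_hasCompactSupport hgs
  have hgt := tendstoInMeasure_cauchyJump_L2R hg2.toLp
  rw [tendstoInMeasure_iff_enorm] at hgt
  have hgt' := ENNReal.tendsto_nhds_zero.1 (hgt (δ / 2) (pos_iff_ne_zero.2 hδ2) hδ2t) (η / 2)
    (ENNReal.half_pos hη.ne')
  filter_upwards [hgt', self_mem_nhdsWithin] with ε hε1 hε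
  have hε : 0 < ε := hε
  have hsubset : {k | δ ≤ ‖cauchyJump f ε k - 2 * π * Complex.I * f k‖ₑ} ⊆
      {k | δ / 2 ≤ ‖cauchyJump (fun x => f x - g x) ε k‖ₑ + C * ‖f k - g k‖ₑ} ∪
      {k | δ / 2 ≤ ‖cauchyJump g ε k - 2 * π * Complex.I * g k‖ₑ} := by
    intro k hk
    by_contra hcon
    simp only [Set.mem_union, Set.mem_ofPred_eq, not_or, not_le] at hcon
    refine absurd (show δ ≤ ‖cauchyJump f ε k - 2 * π * Complex.I * f k‖ₑ from hk) (not_le.2 ?_)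
    have e : cauchyJump f ε k - 2 * π * Complex.I * f k =
        (cauchyJump (fun x => f x - g x) ε k - 2 * π * Complex.I * (f k - g k)) +
        (cauchyJump g ε k - 2 * π * Complex.I * g k) := by
      rw [cauchyJump_sub hf hgi hε]; ring
    have e2 : ‖(2 * π * Complex.I : ℂ)‖ₑ = C := by
      rw [← ofReal_norm]
      simp [hC, abs_of_pos Real.pi_pos]
    calc ‖cauchyJump f ε k - 2 * π * Complex.I * f k‖ₑ
        ≤ (‖cauchyJump (fun x => f x - g x) ε k‖ₑ + C * ‖f k - g k‖ₑ) +
          ‖cauchyJump g ε k - 2 * π * Complex.I * g k‖ₑ := by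
          rw [e]
          refine (enorm_add_le _ _).trans (add_le_add_left ((enorm_sub_le).trans ?_) _)
          rw [enorm_mul _ (f k - g k), e2]
      _ < δ / 2 + δ / 2 := ENNReal.add_lt_add hcon.1 hcon.2
      _ = δ := ENNReal.add_halves δ
  have hfgm : AEStronglyMeasurable (fun x => f x - g x) volume := hf.1.sub hgi.1
  have hm : AEMeasurable fun k => ‖cauchyJump (fun x => f x - g x) ε k‖ₑ + C * ‖f k - g k‖ₑ :=
    (((aestronglyMeasurable_cauchyTransform_line hfgm _).sub
      (aestronglyMeasurable_cauchyTransform_line hfgm _)).enorm).add (hfgm.enorm.const_mul _)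
  have h1 : volume {k | δ / 2 ≤ ‖cauchyJump (fun x => f x - g x) ε k‖ₑ + C * ‖f k - g k‖ₑ} ≤
      η / 2 := by
    refine (meas_ge_le_lintegral_div hm hδ2 hδ2t).trans (le_trans ?_ hκ)
    gcongr
    rw [lintegral_add_right' _ (hfgm.enorm.const_mul _), lintegral_const_mul' _ _ hCt]
    gcongr
    exact (lintegral_cauchyJump_le (hf.sub hgi) hε).trans (by gcongr; exact hfg)
  have h2 : volume {k | δ / 2 ≤ ‖cauchyJump g ε k - 2 * π * Complex.I * g k‖ₑ} ≤ η / 2 := by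
    refine le_trans (le_of_eq (measure_congr (eventuallyEq_set.2 ?_))) hε1
    filter_upwards [hg2.coeFn_toLp] with k hk
    have : cauchyJump (hg2.toLp : L2R) ε k = cauchyJump g ε k := by
      simp only [cauchyJump, cauchyTransform_congr hg2.coeFn_toLp]
    simp only [this, hk]
  calc _ ≤ _ := measure_mono hsubset
    _ ≤ _ := measure_union_le _ _
    _ ≤ η / 2 + η / 2 := add_le_add h1 h2
    _ = η := ENNReal.add_halves η

/-! ### The uniqueness theorem -/

/-- With `F`, `G` the Cauchy transforms of `conj φ` and `hψ`, the jump of `F G` is `F₊ (G₊ - G₋) +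
(F₊ - F₋) G₋`. After multiplication by `ψ` the last term tends to zero, since `ψ conj φ = 0` and
`G₋` is bounded along a subsequence. -/
lemma mul_eq_zero_of_cauchyTransform_eq (φ ψ h : L2R) (hdisj : ∀ᵐ x : ℝ, φ x * ψ x = 0)
    (hid : ∀ z : ℂ, z.im ≠ 0 → cauchyTransform h z =
      cauchyTransform (star φ : L2R) z * cauchyTransform (fun x => h x * ψ x) z) :
    ∀ᵐ k : ℝ, h k * ψ k * (1 - ψ k * bdry 1 (star φ) k) = 0 := by
  have hi : Integrable fun x : ℝ => h x * ψ x := integrable_mul_L2R h ψ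
  obtain ⟨u, hu, hu'⟩ := exists_common_seq (tendstoInMeasure_cauchyJump_L2R h)
    (tendstoInMeasure_bdry one_ne_zero (star φ))
  obtain ⟨v, hv, hv'⟩ := exists_common_seq ((tendstoInMeasure_cauchyJump hi).comp hu)
    ((tendstoInMeasure_cauchyJump_L2R (star φ)).comp hu)
  -- The sequence is positive only eventually; the remaining terms are replaced by 1 to meet the
  -- positivity demanded for all `n`.
  set w : ℕ → ℝ := fun n => if 0 < u (v n) then u (v n) else 1 with hw
  have hw0 : ∀ n, 0 < w n := fun n => by
    simp only [hw]; split_ifs with h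
    · exact h
    · exact one_pos
  have hpos : ∀ᶠ n in atTop, 0 < u (v n) :=
    (hu.comp hv).eventually self_mem_nhdsWithin
  filter_upwards [hdisj, hu', hv', ae_frequently_norm_cauchyTransform_le hi hw0,
    coeFn_star_ae φ] with k h0 h1 h2 ⟨M, hM⟩ h5
  obtain ⟨hJh, hF⟩ := h1
  obtain ⟨hJg, hJF⟩ := h2
  rw [h5] at hJF
  simp only [Function.comp_apply] at hJg hJF
  have hLHS := ((hJh.comp hv).const_mul (ψ k)).sub (((hF.comp hv).mul hJg).const_mul (ψ k))
  have hRHS := hJF.const_mul (ψ k)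
  have hz : ψ k * (2 * π * Complex.I * conj (φ k)) = 0 := by
    rcases mul_eq_zero.1 h0 with h | h <;> simp [h]
  rw [hz] at hRHS
  have hle := le_of_tendsto_of_tendsto_of_frequently hLHS.norm (hRHS.norm.mul_const M) ?_
  · rw [norm_zero, zero_mul, norm_le_zero_iff] at hle
    have : 2 * π * Complex.I * (h k * ψ k * (1 - ψ k * bdry 1 (star φ) k)) = 0 := by
      rw [← hle]; ring
    exact (mul_eq_zero.1 this).resolve_left Complex.two_pi_I_ne_zero
  · refine (hM.and_eventually hpos).mono fun n hn => ?_
    obtain ⟨hn, hn'⟩ := hn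
    have hwn : w n = u (v n) := if_pos hn'
    rw [hwn] at hn
    have e : ψ k * (cauchyJump h ∘ u) (v n) k - ψ k *
        (cauchyTransform (star φ : L2R) (k + ((1 * u (v n) : ℝ) : ℂ) * Complex.I) *
          cauchyJump (fun x => h x * ψ x) (u (v n)) k) =
        ψ k * cauchyJump (star φ : L2R) (u (v n)) k *
        cauchyTransform (fun x => h x * ψ x) (k + ((-1 * u (v n) : ℝ) : ℂ) * Complex.I) := by
      simp only [Function.comp_apply, cauchyJump]
      rw [hid _ (by simp [hn'.ne']), hid _ (by simp [hn'.ne'])]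
      ring
    refine (le_of_eq (congrArg norm e)).trans ?_
    rw [norm_mul]
    gcongr

lemma eq_zero_of_cauchyTransform_eq_zero (h : L2R)
    (h0 : ∀ z : ℂ, z.im ≠ 0 → cauchyTransform h z = 0) : h = 0 := by
  rw [Lp.eq_zero_iff_ae_eq_zero]
  filter_upwards [bdry_sub_bdry_ae h,
    bdry_eq_zero one_ne_zero h fun z hz => h0 z (by rintro h; simp [h] at hz),
    bdry_eq_zero (neg_ne_zero.2 one_ne_zero) h fun z hz => h0 z (by rintro h; simp [h] at hz)]
    with k h1 h2 h3
  rw [h2, h3, sub_zero] at h1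
  exact (mul_eq_zero.1 h1.symm).resolve_left Complex.two_pi_I_ne_zero

theorem eq_zero_of_cauchyTransform_eq (φ ψ h : L2R) (hdisj : ∀ᵐ x : ℝ, φ x * ψ x = 0)
    (hne : ∀ᵐ k : ℝ, 1 - ψ k * bdry 1 (star φ) k ≠ 0)
    (hid : ∀ z : ℂ, z.im ≠ 0 → cauchyTransform h z =
      cauchyTransform (star φ : L2R) z * cauchyTransform (fun x => h x * ψ x) z) : h = 0 := by
  have hψ : (fun x => h x * ψ x) =ᵐ[volume] 0 := by
    filter_upwards [mul_eq_zero_of_cauchyTransform_eq φ ψ h hdisj hid, hne] with k h1 h2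
    exact (mul_eq_zero.1 h1).resolve_right h2
  refine eq_zero_of_cauchyTransform_eq_zero h fun z hz => ?_
  rw [hid z hz, cauchyTransform_congr hψ]
  simp [cauchyTransform]

/-! ### Bounded boundary values with prescribed support of the jump -/

lemma bdry_sub (s : ℝ) (f g : L2R) : bdry s (f - g) = bdry s f - bdry s g := by
  rw [bdry, bdry, bdry, ← smul_sub]
  congr 1
  refine Eq.trans (congrArg _ ?_) ((Lp.fourierTransformₗᵢ ℝ ℂ).symm.map_sub _ _)
  rw [← MemLp.toLp_sub]
  apply MemLp.toLp_congr
  have : (𝓕 (f - g) : L2R) = 𝓕 f - 𝓕 g := (Lp.fourierTransformₗᵢ ℝ ℂ).map_sub _ _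
  rw [this]
  filter_upwards [Lp.coeFn_sub (𝓕 f : L2R) (𝓕 g)] with t ht
  rw [ht, Pi.sub_apply, Pi.sub_apply, mul_sub]

lemma bdry_smul (s : ℝ) (c : ℂ) (f : L2R) : bdry s (c • f) = c • bdry s f := by
  rw [bdry, bdry, smul_comm]
  congr 1
  refine Eq.trans (congrArg _ ?_) ((Lp.fourierTransformₗᵢ ℝ ℂ).symm.map_smul _ _)
  rw [← MemLp.toLp_const_smul]
  apply MemLp.toLp_congr
  have : (𝓕 (c • f) : L2R) = c • 𝓕 f := (Lp.fourierTransformₗᵢ ℝ ℂ).map_smul _ _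
  rw [this]
  filter_upwards [Lp.coeFn_smul c (𝓕 f : L2R)] with t ht
  rw [ht, Pi.smul_apply, Pi.smul_apply, smul_eq_mul, smul_eq_mul]
  ring

/-- A Möbius transformation fixing the origin and bounded on the half-plane `-π ≤ Im w`. -/
def moebius (w : ℂ) : ℂ := (w + 4 * Complex.I)⁻¹ - (4 * Complex.I)⁻¹

/-- The pole `-4i` of `moebius` lies at distance `4 - π` below the half-plane that contains all
Cauchy transforms of indicator functions. -/
lemma four_sub_pi_pos : 0 < 4 - π := sub_pos.2 Real.pi_lt_four

lemma four_sub_pi_le_norm {w : ℂ} (hw : -π ≤ w.im) : 4 - π ≤ ‖w + 4 * Complex.I‖ := by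
  have h := Complex.abs_im_le_norm (w + 4 * Complex.I)
  have h2 := le_abs_self (w + 4 * Complex.I).im
  simp at h h2
  linarith

lemma add_four_I_ne_zero {w : ℂ} (hw : -π ≤ w.im) : w + 4 * Complex.I ≠ 0 :=
  norm_pos_iff.1 (four_sub_pi_pos.trans_le (four_sub_pi_le_norm hw))

lemma norm_moebius_sub_le {w w' : ℂ} (hw : -π ≤ w.im) (hw' : -π ≤ w'.im) :
    ‖moebius w - moebius w'‖ ≤ ((4 - π) ^ 2)⁻¹ * ‖w - w'‖ := by
  have h1 := add_four_I_ne_zero hw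
  have h2 := add_four_I_ne_zero hw'
  have e : moebius w - moebius w' =
      ((w + 4 * Complex.I) * (w' + 4 * Complex.I))⁻¹ * (w' - w) := by
    simp only [moebius]
    field_simp
    ring
  have := four_sub_pi_pos
  rw [e, norm_mul, norm_inv, norm_mul, norm_sub_rev w']
  gcongr
  rw [sq]
  gcongr
  · exact four_sub_pi_le_norm hw
  · exact four_sub_pi_le_norm hw'

lemma moebius_zero : moebius 0 = 0 := by simp [moebius]

lemma norm_moebius_le {w : ℂ} (hw : -π ≤ w.im) : ‖moebius w‖ ≤ ((4 - π) ^ 2)⁻¹ * ‖w‖ := by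
  simpa [moebius_zero] using norm_moebius_sub_le hw (w' := 0) (by simpa using Real.pi_pos.le)

lemma norm_moebius_le_const {w : ℂ} (hw : -π ≤ w.im) : ‖moebius w‖ ≤ (4 - π)⁻¹ + 1 := by
  refine (norm_sub_le _ _).trans (add_le_add ?_ ?_)
  · rw [norm_inv]
    exact inv_anti₀ four_sub_pi_pos (four_sub_pi_le_norm hw)
  · simp; norm_num

lemma moebius_injective {w w' : ℂ} (h : moebius w = moebius w') :
    w = w' := by
  have := inv_injective (sub_left_injective h)
  exact add_right_cancel this

lemma measurable_moebius : Measurable moebius := by unfold moebius; fun_prop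

/-- The indicator function of a set of finite measure. -/
def indL2 {E : Set ℝ} (hE : MeasurableSet E) (hv : volume E ≠ ∞) : L2R :=
  indicatorConstLp 2 hE hv (1 : ℂ)

lemma coeFn_indL2 {E : Set ℝ} (hE : MeasurableSet E) (hv : volume E ≠ ∞) :
    ∀ᵐ x : ℝ, indL2 hE hv x = E.indicator (fun _ => (1 : ℂ)) x :=
  indicatorConstLp_coeFn

lemma cauchyTransform_indL2 {E : Set ℝ} (hE : MeasurableSet E) (hv : volume E ≠ ∞) (z : ℂ) :
    cauchyTransform (indL2 hE hv) z = ∫ x : ℝ in E, ((x : ℂ) - z)⁻¹ := by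
  rw [cauchyTransform_congr (coeFn_indL2 hE hv), cauchyTransform, ← integral_indicator hE]
  congr 1; ext x
  by_cases h : x ∈ E <;> simp [h]

lemma cauchyTransform_indL2_conj {E : Set ℝ} (hE : MeasurableSet E) (hv : volume E ≠ ∞) (z : ℂ) :
    cauchyTransform (indL2 hE hv) (conj z) = conj (cauchyTransform (indL2 hE hv) z) := by
  rw [← cauchyTransform_conj]
  refine cauchyTransform_congr ?_ _
  filter_upwards [coeFn_indL2 hE hv] with x hx
  rw [hx]
  by_cases h : x ∈ E <;> simp [h]

/-- The density is real, so `2 |Im|` is the modulus of the jump between conjugate points, a Poisson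
integral of an indicator function and thus at most `2π`. -/
lemma abs_im_cauchyTransform_indL2_le {E : Set ℝ} (hE : MeasurableSet E) (hv : volume E ≠ ∞)
    {z : ℂ} (hz : z.im ≠ 0) : |(cauchyTransform (indL2 hE hv) z).im| ≤ π := by
  set w := cauchyTransform (indL2 hE hv) with hw
  have hi : Integrable (indL2 hE hv) :=
    integrable_indicatorConstLp hE hv _
  have hε : 0 < |z.im| := abs_pos.2 hz
  have h1 : ‖cauchyJump (indL2 hE hv) |z.im| z.re‖ₑ ≤ ENNReal.ofReal (2 * π) := by
    rw [cauchyJump_eq hi hε]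
    refine (enorm_integral_le_lintegral_enorm _).trans ?_
    rw [← lintegral_poisson_kernel hε z.re]
    apply lintegral_mono_ae
    filter_upwards [coeFn_indL2 hE hv] with x hx
    rw [hx, enorm_mul, enorm_mul, ← ofReal_norm Complex.I, Complex.norm_I, ENNReal.ofReal_one,
      one_mul, ← ofReal_norm ((_ : ℝ) : ℂ), Complex.norm_real,
      Real.norm_of_nonneg (by positivity), ← neg_sub, neg_sq]
    by_cases h : x ∈ E <;> simp [h]
  have h2 : ‖cauchyJump (indL2 hE hv) |z.im| z.re‖ = 2 * |(w z).im| := by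
    have h3 : ∀ ζ : ℂ, w ζ - w (conj ζ) = ((2 * (w ζ).im : ℝ) : ℂ) * Complex.I := fun ζ => by
      rw [hw, cauchyTransform_indL2_conj, Complex.sub_conj]
    have h4 : ∀ ζ : ℂ, ‖w ζ - w (conj ζ)‖ = 2 * |(w ζ).im| := fun ζ => by
      rw [h3, norm_mul, Complex.norm_I, mul_one, Complex.norm_real, Real.norm_eq_abs, abs_mul,
        abs_two]
    rcases lt_or_gt_of_ne hz with h | h
    · have e1 : (z.re : ℂ) + ((1 * |z.im| : ℝ) : ℂ) * Complex.I = conj z := by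
        apply Complex.ext <;> simp [abs_of_neg h]
      have e2 : (z.re : ℂ) + ((-1 * |z.im| : ℝ) : ℂ) * Complex.I = z := by
        apply Complex.ext <;> simp [abs_of_neg h]
      rw [cauchyJump, e1, e2, norm_sub_rev]
      exact h4 z
    · have e1 : (z.re : ℂ) + ((1 * |z.im| : ℝ) : ℂ) * Complex.I = z := by
        apply Complex.ext <;> simp [abs_of_pos h]
      have e2 : (z.re : ℂ) + ((-1 * |z.im| : ℝ) : ℂ) * Complex.I = conj z := by
        apply Complex.ext <;> simp [abs_of_pos h]
      rw [cauchyJump, e1, e2]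
      exact h4 z
  rw [← ofReal_norm, ENNReal.ofReal_le_ofReal_iff (by positivity), h2] at h1
  linarith

lemma neg_pi_le_im_cauchyTransform_indL2 {E : Set ℝ} (hE : MeasurableSet E) (hv : volume E ≠ ∞)
    {z : ℂ} (hz : z.im ≠ 0) : -π ≤ (cauchyTransform (indL2 hE hv) z).im :=
  (abs_le.1 (abs_im_cauchyTransform_indL2_le hE hv hz)).1

lemma neg_pi_le_im_bdry_indL2 {E : Set ℝ} (hE : MeasurableSet E) (hv : volume E ≠ ∞) {s : ℝ}
    (hs : s ≠ 0) : ∀ᵐ k : ℝ, -π ≤ (bdry s (indL2 hE hv) k).im := by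
  obtain ⟨u, hu, hu'⟩ := (tendstoInMeasure_bdry hs (indL2 hE hv)).exists_seq_tendsto_ae'
  filter_upwards [hu'] with k hk
  refine ge_of_tendsto ((Complex.continuous_im.tendsto _).comp hk) ?_
  filter_upwards [hu.eventually self_mem_nhdsWithin] with n h2
  have h3 : 0 < u n := h2
  exact neg_pi_le_im_cauchyTransform_indL2 hE hv (by simp [hs, h3.ne'])

lemma memLp_moebius_comp {f : ℝ → ℂ} (hf : MemLp f 2 volume) (h : ∀ᵐ k, -π ≤ (f k).im) :
    MemLp (fun k => moebius (f k)) 2 volume := by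
  refine (hf.const_mul ((((4 - π) ^ 2)⁻¹ : ℝ) : ℂ)).of_le
    (measurable_moebius.comp_aemeasurable hf.1.aemeasurable).aestronglyMeasurable ?_
  filter_upwards [h] with k hk
  rw [norm_mul, Complex.norm_real, Real.norm_of_nonneg (by positivity)]
  exact norm_moebius_le hk

lemma memLp_moebius_line {E : Set ℝ} (hE : MeasurableSet E) (hv : volume E ≠ ∞) {η : ℝ}
    (hη : η ≠ 0) : MemLp (fun k : ℝ =>
      moebius (cauchyTransform (indL2 hE hv) (k + (η : ℂ) * Complex.I))) 2 volume :=
  memLp_moebius_comp (memLp_cauchyTransform_line _ hη) (Eventually.of_forall fun k =>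
    neg_pi_le_im_cauchyTransform_indL2 hE hv (by simp [hη]))

lemma norm_cauchyTransform_indL2_le {E : Set ℝ} (hE : MeasurableSet E) (hv : volume E ≠ ∞)
    {M : ℝ} (hM : ∀ x ∈ E, |x| ≤ M) {z : ℂ} (hz : 2 * M < ‖z‖) :
    ‖cauchyTransform (indL2 hE hv) z‖ ≤ 2 / ‖z‖ * (volume E).toReal := by
  rw [cauchyTransform_indL2]
  refine norm_setIntegral_le_of_norm_le_const (lt_top_iff_ne_top.2 hv) fun x hx => ?_
  have h1 := hM x hx
  have h2 : ‖z‖ - ‖(x : ℂ)‖ ≤ ‖(x : ℂ) - z‖ := by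
    rw [norm_sub_rev]; exact norm_sub_norm_le _ _
  rw [Complex.norm_real, Real.norm_eq_abs] at h2
  have h0 : 0 ≤ |x| := abs_nonneg x
  have h3 : 0 < ‖z‖ := by linarith
  rw [norm_inv, show (2 : ℝ) / ‖z‖ = (‖z‖ / 2)⁻¹ by rw [inv_div]]
  exact inv_anti₀ (by positivity) (by linarith)

/-- Contour integration in the half-plane of all `z` for which `z.im` has the sign of `s`. -/
lemma cauchyTransform_moebius_line {E : Set ℝ} (hE : MeasurableSet E) (hv : volume E ≠ ∞)
    {M : ℝ} (hM : ∀ x ∈ E, |x| ≤ M) {s : ℝ} (hs : s = 1 ∨ s = -1) {z : ℂ} (hz : s * z.im < 0)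
    {ε : ℝ} (hε : 0 < ε) :
    cauchyTransform (fun k : ℝ => moebius (cauchyTransform (indL2 hE hv)
      (k + ((s * ε : ℝ) : ℂ) * Complex.I))) z = 0 := by
  set w := cauchyTransform (indL2 hE hv) with hw
  have hs0 : s ≠ 0 := by rcases hs with rfl | rfl <;> norm_num
  have hss : s * s = 1 := by rcases hs with rfl | rfl <;> norm_num
  have hsn : ‖(s : ℂ)‖ = 1 := by rcases hs with rfl | rfl <;> simp
  have hz0 : z.im ≠ 0 := fun h => by simp [h] at hz
  have hi := integrable_div_sub (memLp_moebius_line hE hv (mul_ne_zero hs0 hε.ne')).toLp hz0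
  have hi' : Integrable fun k : ℝ =>
      moebius (w (k + ((s * ε : ℝ) : ℂ) * Complex.I)) / ((k : ℂ) - z) := by
    refine hi.congr ?_
    filter_upwards [(memLp_moebius_line hE hv (mul_ne_zero hs0 hε.ne')).coeFn_toLp] with k hk
    rw [hk]
  -- The substitution `ζ ↦ s ζ` moves the half-plane of sign `s` to the upper one; `z` lies on the
  -- other side, so the denominator has no zero.
  set Q : ℂ → ℂ := fun ζ => moebius (w (s * (ζ + ε * Complex.I))) / (s * ζ - z) with hQ
  have hQx : ∀ x : ℝ, Q x = (fun k : ℝ =>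
      moebius (w (k + ((s * ε : ℝ) : ℂ) * Complex.I)) / ((k : ℂ) - z)) (s * x) := fun x => by
    simp only [hQ]
    push_cast
    rw [mul_add, mul_assoc]
  have him : ∀ ζ : ℂ, (s * (ζ + ε * Complex.I)).im = s * (ζ.im + ε) := fun ζ => by simp
  have him0 : ∀ ζ : ℂ, 0 ≤ ζ.im → (s * (ζ + ε * Complex.I)).im ≠ 0 := fun ζ hζ => by
    rw [him]; exact mul_ne_zero hs0 (by linarith)
  have hden : ∀ ζ : ℂ, 0 ≤ ζ.im → (s : ℂ) * ζ - z ≠ 0 := fun ζ hζ h => by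
    have h1 := congrArg Complex.im (sub_eq_zero.1 h)
    simp only [Complex.mul_im, Complex.ofReal_re, Complex.ofReal_im, zero_mul, add_zero] at h1
    rw [← h1, ← mul_assoc, hss] at hz
    linarith
  have hQ0 : ∫ x : ℝ, Q x = 0 := by
    -- Beyond radius `r` both `|ζ| > 2M` and `|ζ| ≥ 2 ‖z‖` hold. The Cauchy transform is then at
    -- most `2 |E| / |ζ|` and the denominator at least `|ζ| / 2`.
    refine integral_eq_zero_of_halfPlane (C := ((4 - π) ^ 2)⁻¹ * (2 * (volume E).toReal) * 2)
      (r := 2 * |M| + 2 * ‖z‖ + 1) (fun ζ hζ => ?_) (fun ζ hζ hr => ?_) ?_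
    · have h1 : DifferentiableAt ℂ w (s * (ζ + ε * Complex.I)) :=
        differentiableAt_cauchyTransform (him0 ζ hζ) (integrable_div_sub _ (him0 ζ hζ))
      have h2 : DifferentiableAt ℂ (fun ζ : ℂ => w (s * (ζ + ε * Complex.I))) ζ :=
        DifferentiableAt.comp (g := w) (f := fun ζ : ℂ => s * (ζ + ε * Complex.I)) ζ h1
          (by fun_prop)
      have h3 : DifferentiableAt ℂ (fun ζ : ℂ => moebius (w (s * (ζ + ε * Complex.I)))) ζ := by
        unfold moebius
        exact ((h2.add_const _).inv (add_four_I_ne_zero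
          (neg_pi_le_im_cauchyTransform_indL2 hE hv (him0 ζ hζ)))).sub_const _
      exact h3.div (by fun_prop) (hden ζ hζ)
    · have hζn : ‖ζ‖ ≤ ‖(s : ℂ) * (ζ + ε * Complex.I)‖ := by
        rw [norm_mul, hsn, one_mul, Complex.norm_eq_sqrt_sq_add_sq,
          Complex.norm_eq_sqrt_sq_add_sq]
        apply Real.sqrt_le_sqrt
        simp
        nlinarith
      have hM' := le_abs_self M
      have hM'' := abs_nonneg M
      have hzn := norm_nonneg z
      have hζ0 : 0 < ‖ζ‖ := by linarith
      have h1 : ‖w (s * (ζ + ε * Complex.I))‖ ≤ 2 / ‖ζ‖ * (volume E).toReal := by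
        refine (norm_cauchyTransform_indL2_le hE hv hM (by linarith)).trans ?_
        gcongr
      have h2 : ‖ζ‖ / 2 ≤ ‖(s : ℂ) * ζ - z‖ := by
        have := norm_sub_norm_le ((s : ℂ) * ζ) z
        rw [norm_mul, hsn, one_mul] at this
        linarith
      have h3 := norm_moebius_le (neg_pi_le_im_cauchyTransform_indL2 hE hv (him0 ζ hζ))
      rw [norm_div]
      have := four_sub_pi_pos
      calc ‖moebius (w (s * (ζ + ε * Complex.I)))‖ / ‖(s : ℂ) * ζ - z‖
          ≤ (((4 - π) ^ 2)⁻¹ * (2 / ‖ζ‖ * (volume E).toReal)) / (‖ζ‖ / 2) := by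
            gcongr
            exact h3.trans (by gcongr)
        _ = _ := by field_simp
    · simp only [hQx]
      exact hi'.comp_mul_left' hs0
  simp only [hQx] at hQ0
  rw [Measure.integral_comp_mul_left (fun k : ℝ =>
      moebius (w (k + ((s * ε : ℝ) : ℂ) * Complex.I)) / ((k : ℂ) - z)) s] at hQ0
  exact (smul_eq_zero.1 hQ0).resolve_left (by simp [hs0])

lemma memLp_moebius_bdry {E : Set ℝ} (hE : MeasurableSet E) (hv : volume E ≠ ∞) {s : ℝ}
    (hs : s ≠ 0) : MemLp (fun k : ℝ => moebius (bdry s (indL2 hE hv) k)) 2 volume :=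
  memLp_moebius_comp (Lp.memLp _) (neg_pi_le_im_bdry_indL2 hE hv hs)

/-- The kernel is in `L²`, so by Hölder the value at a fixed `z` depends continuously on the density
in `L²`. -/
lemma cauchyTransform_eq_zero_of_tendsto {f : ℝ → ℝ → ℂ} {g : ℝ → ℂ} {l : Filter ℝ} [NeBot l]
    (hf : ∀ᶠ ε in l, MemLp (f ε) 2 volume) (hg : MemLp g 2 volume)
    (hlim : Tendsto (fun ε => eLpNorm (fun k => f ε k - g k) 2 volume) l (𝓝 0)) {z : ℂ}
    (hz : z.im ≠ 0) (h0 : ∀ᶠ ε in l, cauchyTransform (f ε) z = 0) : cauchyTransform g z = 0 := by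
  set b := eLpNorm (fun x : ℝ => ((x : ℂ) - z)⁻¹) 2 volume with hb
  have hbt : b ≠ ∞ := (memLp_two_inv_sub hz).2.ne
  have hle : ∀ᶠ ε in l, ‖cauchyTransform g z‖ₑ ≤ b * eLpNorm (fun k => f ε k - g k) 2 volume := by
    filter_upwards [hf, h0] with ε h1 h2
    have hi : ∀ {q : ℝ → ℂ}, MemLp q 2 volume → Integrable fun x : ℝ => q x / ((x : ℂ) - z) := by
      intro q hq
      simpa only [div_eq_mul_inv] using! hq.integrable_mul (memLp_two_inv_sub hz)
    have h3 : cauchyTransform g z = - ∫ x : ℝ, ((x : ℂ) - z)⁻¹ • (f ε x - g x) := by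
      have : ∀ x : ℝ, ((x : ℂ) - z)⁻¹ • (f ε x - g x) =
          f ε x / ((x : ℂ) - z) - g x / ((x : ℂ) - z) := fun x => by
        rw [smul_eq_mul]; ring
      simp_rw [this]
      rw [integral_sub (hi h1) (hi hg)]
      change _ = - (cauchyTransform (f ε) z - cauchyTransform g z)
      rw [h2]; ring
    rw [h3, enorm_neg]
    refine (enorm_integral_le_lintegral_enorm _).trans ?_
    rw [← eLpNorm_one_eq_lintegral_enorm]
    have h4 : AEStronglyMeasurable (fun x => f ε x - g x) volume := h1.1.sub hg.1
    exact eLpNorm_smul_le_mul_eLpNorm (φ := fun x : ℝ => ((x : ℂ) - z)⁻¹) (p := 2) (q := 2) (r := 1)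
      h4 (continuous_inv_sub hz).aestronglyMeasurable
  have hlim' := ENNReal.Tendsto.const_mul (a := b) hlim (Or.inr hbt)
  rw [mul_zero] at hlim'
  have := ge_of_tendsto hlim' hle
  simpa using this

lemma cauchyTransform_moebius_bdry {E : Set ℝ} (hE : MeasurableSet E) (hv : volume E ≠ ∞)
    {M : ℝ} (hM : ∀ x ∈ E, |x| ≤ M) {s : ℝ} (hs : s = 1 ∨ s = -1) {z : ℂ} (hz : s * z.im < 0) :
    cauchyTransform (fun k : ℝ => moebius (bdry s (indL2 hE hv) k)) z = 0 := by
  have hs0 : s ≠ 0 := by rcases hs with rfl | rfl <;> norm_num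
  have hz0 : z.im ≠ 0 := fun h => by simp [h] at hz
  have hpos : ∀ᶠ ε : ℝ in 𝓝[>] 0, 0 < ε := self_mem_nhdsWithin
  refine cauchyTransform_eq_zero_of_tendsto (l := 𝓝[>] 0) (f := fun ε k =>
    moebius (cauchyTransform (indL2 hE hv) (k + ((s * ε : ℝ) : ℂ) * Complex.I))) ?_
    (memLp_moebius_bdry hE hv hs0) ?_ hz0 ?_
  · filter_upwards [hpos] with ε hε using memLp_moebius_line hE hv (mul_ne_zero hs0 hε.ne')
  · have h1 := ENNReal.Tendsto.const_mul (a := ENNReal.ofReal ((4 - π) ^ 2)⁻¹)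
      (tendsto_cauchyTransform_bdry hs0 (indL2 hE hv)) (Or.inr ENNReal.ofReal_ne_top)
    rw [mul_zero] at h1
    refine tendsto_of_tendsto_of_tendsto_of_le_of_le' tendsto_const_nhds h1
      (Eventually.of_forall fun _ => zero_le) ?_
    filter_upwards [hpos] with ε hε
    refine eLpNorm_le_mul_eLpNorm_of_ae_le_mul ?_ 2
    filter_upwards [neg_pi_le_im_bdry_indL2 hE hv hs0] with k hk
    exact norm_moebius_sub_le (neg_pi_le_im_cauchyTransform_indL2 hE hv
      (by simp [hs0, hε.ne'])) hk
  · filter_upwards [hpos] with ε hε using cauchyTransform_moebius_line hE hv hM hs hz hε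

/-- Every bounded measurable set carries a function whose Cauchy transform has bounded boundary
values. -/
theorem exists_bounded_bdry {E : Set ℝ} (hE : MeasurableSet E) {M : ℝ} (hM : ∀ x ∈ E, |x| ≤ M) :
    ∃ v : L2R, (∀ᵐ k : ℝ, v k = 0 ↔ k ∉ E) ∧
      ∃ C : ℝ, ∀ s : ℝ, s = 1 ∨ s = -1 → ∀ᵐ k : ℝ, ‖bdry s v k‖ ≤ C := by
  have hv : volume E ≠ ∞ := by
    refine ne_top_of_le_ne_top (b := volume (Set.Icc (-M) M)) (by simp)
      (measure_mono fun x hx => abs_le.1 (hM x hx))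
  have hm1 : (-1 : ℝ) ≠ 0 := by norm_num
  have hp := memLp_moebius_bdry hE hv (s := 1) one_ne_zero
  have hn := memLp_moebius_bdry hE hv (s := -1) hm1
  set G : L2R := hp.toLp with hG
  set H : L2R := hn.toLp with hH
  have hpi : (2 * π * Complex.I : ℂ) ≠ 0 := Complex.two_pi_I_ne_zero
  -- `G` extends holomorphically to the upper half-plane, so its Cauchy transform vanishes below;
  -- the jump formula then gives `bdry 1 G = 2πi G`. For `H` the half-planes are exchanged.
  have hGm : bdry (-1) G = 0 := by
    rw [Lp.eq_zero_iff_ae_eq_zero]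
    refine bdry_eq_zero hm1 G fun z hz => ?_
    rw [cauchyTransform_congr hp.coeFn_toLp]
    exact cauchyTransform_moebius_bdry hE hv hM (Or.inl rfl) (by linarith)
  have hHp : bdry 1 H = 0 := by
    rw [Lp.eq_zero_iff_ae_eq_zero]
    refine bdry_eq_zero one_ne_zero H fun z hz => ?_
    rw [cauchyTransform_congr hn.coeFn_toLp]
    exact cauchyTransform_moebius_bdry hE hv hM (Or.inr rfl) (by linarith)
  have hGp : bdry 1 G = (2 * π * Complex.I : ℂ) • G := by
    rw [← bdry_sub_bdry G, hGm, sub_zero]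
  have hHm : bdry (-1) H = -((2 * π * Complex.I : ℂ) • H) := by
    rw [← bdry_sub_bdry H, hHp, zero_sub, neg_neg]
  set v : L2R := (2 * π * Complex.I : ℂ)⁻¹ • (G - H) with hvdef
  have hv1 : bdry 1 v = G := by
    rw [hvdef, bdry_smul, bdry_sub, hHp, hGp, sub_zero, inv_smul_smul₀ hpi]
  have hv2 : bdry (-1) v = H := by
    rw [hvdef, bdry_smul, bdry_sub, hHm, hGm, zero_sub, neg_neg, inv_smul_smul₀ hpi]
  refine ⟨v, ?_, (4 - π)⁻¹ + 1, ?_⟩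
  · filter_upwards [bdry_sub_bdry_ae v, hp.coeFn_toLp, hn.coeFn_toLp,
      bdry_sub_bdry_ae (indL2 hE hv), coeFn_indL2 hE hv] with k h1 h2 h3 h4 h5
    rw [hv1, hv2, h2, h3] at h1
    rw [h5] at h4
    -- `moebius` is injective, so `v` vanishes exactly where the indicator of `E` has no jump, that
    -- is, off `E`.
    have h6 : v k = 0 ↔ moebius (bdry 1 (indL2 hE hv) k) = moebius (bdry (-1) (indL2 hE hv) k) := by
      rw [← sub_eq_zero (b := moebius _), h1]
      simp [hpi]
    rw [h6]
    constructor
    · intro h hk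
      rw [moebius_injective h, sub_self] at h4
      simp [hk] at h4
    · intro hk
      rw [Set.indicator_of_notMem hk, mul_zero, sub_eq_zero] at h4
      rw [h4]
  · rintro s (rfl | rfl)
    · rw [hv1]
      filter_upwards [hp.coeFn_toLp, neg_pi_le_im_bdry_indL2 hE hv (s := 1) one_ne_zero] with k h1 h2
      rw [h1]
      exact norm_moebius_le_const h2
    · rw [hv2]
      filter_upwards [hn.coeFn_toLp, neg_pi_le_im_bdry_indL2 hE hv hm1] with k h1 h2
      rw [h1]
      exact norm_moebius_le_const h2

/-! ### Failure of uniqueness -/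

theorem exists_cauchyTransform_eq (φ ψ : L2R) (hdisj : ∀ᵐ x : ℝ, φ x * ψ x = 0) {E : Set ℝ}
    (hE : MeasurableSet E) {M : ℝ} (hM : ∀ x ∈ E, |x| ≤ M)
    (hEψ : ∀ᵐ k : ℝ, k ∈ E → 1 - ψ k * bdry 1 (star φ) k = 0) :
    ∃ h : L2R, (∀ᵐ k : ℝ, h k * ψ k = 0 ↔ k ∉ E) ∧
      ∀ z : ℂ, z.im ≠ 0 → cauchyTransform h z =
        cauchyTransform (star φ : L2R) z * cauchyTransform (fun x => h x * ψ x) z := by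
  obtain ⟨v, hv, C, hC⟩ := exists_bounded_bdry hE hM
  have hpi : (2 * π * Complex.I : ℂ) ≠ 0 := Complex.two_pi_I_ne_zero
  have hmem : ∀ s : ℝ, s = 1 ∨ s = -1 →
      MemLp (fun k => bdry s (star φ) k * bdry s v k) 2 volume := fun s hs =>
    (memLp_top_of_bound (Lp.aestronglyMeasurable (bdry s v)) C (hC s hs)).mul
      (Lp.memLp (bdry s (star φ)))
  have hp := hmem 1 (Or.inl rfl)
  have hn := hmem (-1) (Or.inr rfl)
  -- The candidate is the jump of the product of the two Cauchy transforms; boundedness of `bdry s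
  -- v` keeps it in `L²`.
  have hh := (hp.sub hn).const_mul (2 * π * Complex.I : ℂ)⁻¹
  set H : L2R := hh.toLp
  have hcoe : H =ᵐ[volume] _ := hh.coeFn_toLp
  have hψ : ∀ᵐ k : ℝ, H k * ψ k = v k := by
    filter_upwards [hcoe, hdisj, bdry_sub_bdry_ae v, bdry_sub_bdry_ae (star φ), coeFn_star_ae φ,
      hv, hEψ] with k h1 h2 h3 h4 h5 h6 h7
    rw [h1, Pi.sub_apply]
    -- The boundary values of the transform of `conj φ` differ by `2πi conj φ`, which `ψ`
    -- annihilates.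
    have h8 : ψ k * bdry (-1) (star φ) k = ψ k * bdry 1 (star φ) k := by
      have : ψ k * conj (φ k) = 0 := by
        rcases mul_eq_zero.1 h2 with h | h <;> simp [h]
      rw [h5] at h4
      linear_combination -ψ k * h4 - 2 * π * Complex.I * this
    have h9 : (2 * π * Complex.I : ℂ)⁻¹ * (bdry 1 (star φ) k * bdry 1 v k -
        bdry (-1) (star φ) k * bdry (-1) v k) * ψ k = ψ k * bdry 1 (star φ) k * v k := by
      rw [mul_assoc, inv_mul_eq_iff_eq_mul₀ hpi]
      linear_combination -bdry (-1) v k * h8 + ψ k * bdry 1 (star φ) k * h3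
    rw [h9]
    by_cases hk : k ∈ E
    · rw [← sub_eq_zero.1 (h7 hk), one_mul]
    · rw [h6.2 hk, mul_zero]
  refine ⟨H, ?_, fun z hz => ?_⟩
  · filter_upwards [hψ, hv] with k h1 h2
    rw [h1, h2]
  · rw [cauchyTransform_congr hψ, cauchyTransform_congr hcoe]
    have hi : ∀ s : ℝ, s = 1 ∨ s = -1 → Integrable fun x : ℝ =>
        bdry s (star φ) x * bdry s v x / ((x : ℂ) - z) := fun s hs => by
      simpa only [div_eq_mul_inv] using! (hmem s hs).integrable_mul (memLp_two_inv_sub hz)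
    have e : cauchyTransform (fun x => (2 * π * Complex.I : ℂ)⁻¹ * ((fun k =>
        bdry 1 (star φ) k * bdry 1 v k) - fun k => bdry (-1) (star φ) k * bdry (-1) v k) x) z =
        (2 * π * Complex.I : ℂ)⁻¹ * (cauchyTransform (fun x => bdry 1 (star φ) x * bdry 1 v x) z -
          cauchyTransform (fun x => bdry (-1) (star φ) x * bdry (-1) v x) z) := by
      simp only [cauchyTransform]
      rw [← integral_sub (hi 1 (Or.inl rfl)) (hi (-1) (Or.inr rfl)), ← integral_const_mul]
      congr 1; ext x
      simp only [Pi.sub_apply]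
      ring
    rw [e, cauchyTransform_bdry_mul_bdry one_ne_zero _ _ hz,
      cauchyTransform_bdry_mul_bdry (by norm_num : (-1 : ℝ) ≠ 0) _ _ hz]
    rcases lt_or_gt_of_ne hz with h | h
    · rw [cauchyTransform_bdry_of_neg (s := 1) _ (by linarith),
        cauchyTransform_bdry_of_pos (s := -1) _ (by linarith)]
      simp
      field_simp
      simp [Complex.I_sq]
    · rw [cauchyTransform_bdry_of_neg (s := -1) _ (by linarith),
        cauchyTransform_bdry_of_pos (s := 1) _ (by linarith)]
      simp
      field_simp
      simp [Complex.I_sq]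

/-! ### Infinitely many independent solutions -/

/-- Cut by a small ball about a point all of whose neighbourhoods meet `E` in positive measure; a
ball of measure below that of `E` leaves a remainder of positive measure. -/
lemma exists_disjoint_pos_subset {E : Set ℝ} (hE : MeasurableSet E) (h0 : volume E ≠ 0) :
    ∃ A B : Set ℝ, MeasurableSet A ∧ MeasurableSet B ∧ A ⊆ E ∧ B ⊆ E ∧
      Disjoint A B ∧ volume A ≠ 0 ∧ volume B ≠ 0 := by
  obtain ⟨x, -, hx⟩ := exists_mem_forall_mem_nhdsWithin_pos_measure h0
  have hball : ∃ r > 0, volume (Metric.ball x r) < volume E := by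
    have ht := (tendsto_order.1 (show Tendsto (fun r : ℝ => ENNReal.ofReal (2 * r)) (𝓝[>] 0) (𝓝 0) by
      have : Continuous fun r : ℝ => ENNReal.ofReal (2 * r) :=
        ENNReal.continuous_ofReal.comp (continuous_const.mul continuous_id)
      simpa using (this.tendsto 0).mono_left nhdsWithin_le_nhds)).2 _ (pos_iff_ne_zero.2 h0)
    obtain ⟨r, hr1, hr2⟩ := (ht.and self_mem_nhdsWithin).exists
    exact ⟨r, hr2, by rwa [Real.volume_ball]⟩
  obtain ⟨r, hr, hrE⟩ := hball
  refine ⟨E ∩ Metric.ball x r, E \ Metric.ball x r, hE.inter measurableSet_ball,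
    hE.diff measurableSet_ball, Set.inter_subset_left, Set.sdiff_subset, ?_, ?_, ?_⟩
  · exact Set.disjoint_of_subset_left Set.inter_subset_right Set.disjoint_sdiff_right
  · exact (hx _ (inter_mem_nhdsWithin _ (Metric.ball_mem_nhds x hr))).ne'
  · intro h
    have := measure_le_inter_add_sdiff volume E (Metric.ball x r)
    rw [h, add_zero] at this
    exact absurd (this.trans (measure_mono Set.inter_subset_right)) (not_le.2 hrE)

lemma exists_seq_disjoint_pos_subset {E : Set ℝ} (hE : MeasurableSet E) (h0 : volume E ≠ 0) :
    ∃ A : ℕ → Set ℝ, (∀ n, MeasurableSet (A n) ∧ A n ⊆ E ∧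
      volume (A n) ≠ 0) ∧ Pairwise fun m n => Disjoint (A m) (A n) := by
  let S := {B : Set ℝ // MeasurableSet B ∧ B ⊆ E ∧ volume B ≠ 0}
  have step : ∀ B : S, ∃ p : Set ℝ × S, MeasurableSet p.1 ∧ p.1 ⊆ B.1 ∧ p.2.1 ⊆ B.1 ∧
      Disjoint p.1 p.2.1 ∧ volume p.1 ≠ 0 := fun ⟨B, hB, hBE, hB0⟩ => by
    obtain ⟨A, C, hA, hC, hAB, hCB, hd, hA0, hC0⟩ := exists_disjoint_pos_subset hB hB0
    exact ⟨(A, ⟨C, hC, hCB.trans hBE, hC0⟩), hA, hAB, hCB, hd, hA0⟩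
  choose p hp using step
  let R : ℕ → S := fun n => Nat.rec ⟨E, hE, subset_rfl, h0⟩ (fun _ B => (p B).2) n
  have hR : ∀ n, R (n + 1) = (p (R n)).2 := fun n => rfl
  have hanti : ∀ m n, m ≤ n → (R n).1 ⊆ (R m).1 := fun m n h => by
    induction n, h using Nat.le_induction with
    | base => exact subset_rfl
    | succ n _ ih => rw [hR]; exact (hp (R n)).2.2.1.trans ih
  have hlt : ∀ m n, m < n → Disjoint (p (R m)).1 (p (R n)).1 := fun m n h =>
    Set.disjoint_of_subset_right ((hp (R n)).2.1.trans (hanti (m + 1) n h))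
      (by rw [hR]; exact (hp (R m)).2.2.2.1)
  refine ⟨fun n => (p (R n)).1, fun n => ⟨(hp _).1, (hp _).2.1.trans (R n).2.2.1,
    (hp _).2.2.2.2⟩, fun m n hmn => ?_⟩
  rcases lt_or_gt_of_ne hmn with h | h
  · exact hlt m n h
  · exact (hlt n m h).symm

/-- Where `1 - ψ φ̂` vanishes on a set of positive measure, uniqueness fails to infinite order. -/
theorem exists_linearIndependent_cauchyTransform_eq (φ ψ : L2R)
    (hdisj : ∀ᵐ x : ℝ, φ x * ψ x = 0)
    (hne : ¬ ∀ᵐ k : ℝ, 1 - ψ k * bdry 1 (star φ) k ≠ 0) :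
    ∃ h : ℕ → L2R, (∀ s : Finset ℕ, ∀ c : ℕ → ℂ, ∑ i ∈ s, c i • h i = 0 → ∀ i ∈ s, c i = 0) ∧
      ∀ n, ∀ z : ℂ, z.im ≠ 0 → cauchyTransform (h n) z =
        cauchyTransform (star φ : L2R) z * cauchyTransform (fun x => h n x * ψ x) z := by
  set Z : Set ℝ := {k | 1 - ψ k * bdry 1 (star φ) k = 0} with hZ
  have hZm : MeasurableSet Z := by
    have h1 := (Lp.stronglyMeasurable ψ).measurable
    have h2 := (Lp.stronglyMeasurable (bdry 1 (star φ))).measurable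
    exact (measurable_const.sub (h1.mul h2)) (measurableSet_singleton 0)
  have hZ0 : volume Z ≠ 0 := fun h => hne (by
    rw [ae_iff]
    simpa [hZ] using h)
  -- `exists_bounded_bdry` needs a bounded set.
  obtain ⟨N, hN⟩ : ∃ N : ℕ, volume (Z ∩ Set.Icc (-(N : ℝ)) N) ≠ 0 := by
    by_contra! hcon
    refine hZ0 (measure_mono_null (fun x hx => ?_) (measure_iUnion_null hcon))
    obtain ⟨n, hn⟩ := exists_nat_ge |x|
    exact Set.mem_iUnion.2 ⟨n, hx, abs_le.1 hn⟩
  obtain ⟨A, hA, hAd⟩ := exists_seq_disjoint_pos_subset (hZm.inter measurableSet_Icc) hN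
  have key := fun n => exists_cauchyTransform_eq φ ψ hdisj (hA n).1 (M := N)
    (fun x hx => abs_le.2 ((hA n).2.1 hx).2)
    (Eventually.of_forall fun k hk => ((hA n).2.1 hk).1)
  choose h h1 h2 using key
  refine ⟨h, fun s c hs i hi => ?_, h2⟩
  by_contra hci
  refine (hA i).2.2 ?_
  have hall : ∀ᵐ k : ℝ, ∀ n, h n k * ψ k = 0 ↔ k ∉ A n := ae_all_iff.2 h1
  have hsum : ∀ᵐ k : ℝ, ∑ j ∈ s, c j * h j k = 0 := by
    have e1 : ∀ᵐ k : ℝ, (∑ j ∈ s, c j • h j : L2R) k = ∑ j ∈ s, (c j • h j : L2R) k := by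
      filter_upwards [Lp.coeFn_finsetSum s fun j => c j • h j] with k hk
      rw [hk, Finset.sum_apply]
    have e2 : ∀ᵐ k : ℝ, ∀ j, (c j • h j : L2R) k = c j * h j k :=
      ae_all_iff.2 fun j => Lp.coeFn_smul (c j) (h j)
    rw [hs] at e1
    filter_upwards [e1, e2, Lp.coeFn_zero ℂ 2 (volume : Measure ℝ)] with k h3 h4 h5
    simp only [h4] at h3
    rw [← h3, h5, Pi.zero_apply]
  have hnull : ∀ᵐ k : ℝ, k ∉ A i := by
    filter_upwards [hall, hsum] with k h3 h4 hk
    -- After multiplication by `ψ` the summands are supported on the disjoint sets `A j`, so on `A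
    -- i` only one survives.
    have h5 : c i * (h i k * ψ k) = 0 := by
      have : ∑ j ∈ s, c j * (h j k * ψ k) = 0 := by
        simp_rw [← mul_assoc]
        rw [← Finset.sum_mul, h4, zero_mul]
      rw [Finset.sum_eq_single_of_mem i hi fun j _ hj => ?_] at this
      · exact this
      · rw [(h3 j).2 fun hkj => Set.disjoint_left.1 (hAd hj) hkj hk, mul_zero]
    exact (h3 i).1 ((mul_eq_zero.1 h5).resolve_left hci) hk
  simpa [ae_iff] using hnull

/-! ### The minimal operator and its adjoint -/

lemma inner_L2R (f g : L2R) : inner ℂ f g = ∫ x : ℝ, g x * conj (f x) := by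
  rw [L2.inner_def]
  rfl

lemma inner_mulInvSub {z : ℂ} (hz : z.im ≠ 0) (hz' : (conj z).im ≠ 0) (f g : L2R) :
    inner ℂ f (mulInvSub hz g) = inner ℂ (mulInvSub hz' f) g := by
  rw [inner_L2R, inner_L2R]
  refine integral_congr_ae ?_
  filter_upwards [coeFn_mulInvSub hz g, coeFn_mulInvSub hz' f] with x h1 h2
  rw [h1, h2]
  simp only [map_mul, map_inv₀, map_sub, Complex.conj_ofReal, Complex.conj_conj]
  ring

/-- The function `x ↦ 1 / (x - z)` as an element of `L²(ℝ)`. -/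
def cauchyKernel {z : ℂ} (hz : z.im ≠ 0) : L2R := (memLp_two_inv_sub hz).toLp

lemma coeFn_cauchyKernel {z : ℂ} (hz : z.im ≠ 0) :
    ∀ᵐ x : ℝ, cauchyKernel hz x = ((x : ℂ) - z)⁻¹ :=
  (memLp_two_inv_sub hz).coeFn_toLp

lemma inner_cauchyKernel {z : ℂ} (hz : z.im ≠ 0) (g : L2R) :
    inner ℂ g (cauchyKernel hz) = cauchyTransform (star g : L2R) z := by
  rw [inner_L2R]
  refine integral_congr_ae ?_
  filter_upwards [coeFn_cauchyKernel hz, coeFn_star_ae g] with x h1 h2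
  rw [h1, h2]
  ring

lemma inner_cauchyKernel_left {z : ℂ} (hz : z.im ≠ 0) (g : L2R) :
    inner ℂ (cauchyKernel hz) g = cauchyTransform g (conj z) := by
  rw [← inner_conj_symm, inner_cauchyKernel, ← cauchyTransform_star, star_star]

lemma eq_zero_of_memLp_const {c : ℂ} (h : MemLp (fun _ : ℝ => c) 2 (volume : Measure ℝ)) :
    c = 0 := by
  simpa using (memLp_const_iff (by norm_num) (by norm_num)).1 h

/-- A line is closed, hence its own double orthogonal complement, and orthogonality to the Cauchy
kernel means that the Cauchy transform vanishes at `conj z`. -/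
lemma exists_eq_smul_cauchyKernel {z : ℂ} (hz : z.im ≠ 0) (w : L2R)
    (h : ∀ g : L2R, cauchyTransform g (conj z) = 0 → inner ℂ w g = 0) :
    ∃ c : ℂ, w = c • cauchyKernel hz := by
  have : w ∈ (Submodule.span ℂ {cauchyKernel hz})ᗮᗮ := by
    refine (Submodule.mem_orthogonal' _ _).2 fun g hg => h g ?_
    rw [← inner_cauchyKernel_left hz]
    exact Submodule.mem_orthogonal_singleton_iff_inner_right.1 hg
  rw [Submodule.orthogonal_orthogonal] at this
  obtain ⟨c, hc⟩ := Submodule.mem_span_singleton.1 this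
  exact ⟨c, hc.symm⟩

lemma integrable_of_memLp_mul {f : L2R} {c : ℂ}
    (hf : MemLp (fun x : ℝ => (x : ℂ) * f x - c) 2 volume) :
    Integrable fun x : ℝ => f x - c / ((x : ℂ) - Complex.I) := by
  have hI : Complex.I.im ≠ 0 := by simp
  have h1 : MemLp (fun x : ℝ => ((x : ℂ) * f x - c) - Complex.I * f x) 2 volume :=
    hf.sub ((Lp.memLp f).const_mul _)
  refine (h1.integrable_mul (memLp_two_inv_sub hI)).congr (Eventually.of_forall fun x => ?_)
  have := ofReal_sub_ne_zero hI x
  simp only [Pi.mul_apply]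
  field_simp
  ring

/-- Once `x f` is in `L²`, `f` is integrable and the symmetric limit is the Lebesgue integral. -/
lemma mem_minimalDomain_iff {f : L2R} :
    f ∈ minimalDomain ↔ MemLp (fun x : ℝ => (x : ℂ) * f x) 2 volume ∧ ∫ x, f x = 0 := by
  have key : MemLp (fun x : ℝ => (x : ℂ) * f x) 2 volume →
      Tendsto (fun R : ℝ => ∫ x in (-R)..R, f x) atTop (𝓝 (∫ x, f x)) := fun h => by
    have hi : Integrable f := by
      simpa using! integrable_of_memLp_mul (f := f) (c := 0) (by simpa using h)
    exact intervalIntegral_tendsto_integral hi tendsto_neg_atTop_atBot tendsto_id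
  constructor
  · rintro ⟨h1, h2⟩
    simp only [sub_zero] at h1
    exact ⟨h1, tendsto_nhds_unique (key h1) h2⟩
  · rintro ⟨h1, h2⟩
    refine ⟨by simpa using h1, ?_⟩
    rw [← h2]
    exact key h1

lemma ofReal_mul_mulInvSub {z : ℂ} (hz : z.im ≠ 0) (g : L2R) :
    ∀ᵐ x : ℝ, (x : ℂ) * mulInvSub hz g x = g x + z * mulInvSub hz g x := by
  filter_upwards [coeFn_mulInvSub hz g] with x h1
  rw [h1]
  have := ofReal_sub_ne_zero hz x
  field_simp
  ring

lemma mulInvSub_mem_minimalDomain {z : ℂ} (hz : z.im ≠ 0) {g : L2R}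
    (hg : cauchyTransform g z = 0) : mulInvSub hz g ∈ minimalDomain := by
  refine mem_minimalDomain_iff.2 ⟨?_, ?_⟩
  · refine ((Lp.memLp g).add ((Lp.memLp (mulInvSub hz g)).const_mul z)).ae_eq ?_
    filter_upwards [ofReal_mul_mulInvSub hz g] with x h1
    rw [h1]
    rfl
  · rw [← hg]
    refine integral_congr_ae ?_
    filter_upwards [coeFn_mulInvSub hz g] with x h1
    rw [h1, div_eq_inv_mul]

lemma coeFn_mulVar (f : minimalDomain) : ∀ᵐ x : ℝ, mulVar f x = (x : ℂ) * (f : L2R) x :=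
  (memLp_of_mem_minimalDomain f).coeFn_toLp

lemma mulVar_mulInvSub {z : ℂ} (hz : z.im ≠ 0) {g : L2R} (hg : cauchyTransform g z = 0) :
    mulVar ⟨mulInvSub hz g, mulInvSub_mem_minimalDomain hz hg⟩ = g + z • mulInvSub hz g := by
  refine Lp.ext ?_
  filter_upwards [coeFn_mulVar ⟨_, mulInvSub_mem_minimalDomain hz hg⟩,
    ofReal_mul_mulInvSub hz g, Lp.coeFn_add g (z • mulInvSub hz g),
    Lp.coeFn_smul z (mulInvSub hz g)] with x h0 h1 h2 h3
  rw [h0, h1, h2, Pi.add_apply, h3, Pi.smul_apply, smul_eq_mul]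

/-- If `f` is orthogonal to the domain, `f / (x + i)` is orthogonal to every `g` with `ĝ(i) = 0`,
hence a multiple of `1 / (x + i)`. So `f` is constant and, being in `L²`, zero. -/
lemma dense_minimalDomain : Dense (minimalDomain : Set L2R) := by
  have hI : Complex.I.im ≠ 0 := by simp
  have hI' : (conj Complex.I).im ≠ 0 := by simp
  rw [Submodule.dense_iff_topologicalClosure_eq_top,
    Submodule.topologicalClosure_eq_top_iff, Submodule.eq_bot_iff]
  intro f hf
  obtain ⟨c, hc⟩ := exists_eq_smul_cauchyKernel hI' (mulInvSub hI' f) fun g hg => by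
    rw [Complex.conj_conj] at hg
    rw [← inner_mulInvSub hI hI']
    exact (Submodule.mem_orthogonal' _ _).1 hf _ (mulInvSub_mem_minimalDomain hI hg)
  have hfc : ∀ᵐ x : ℝ, f x = c := by
    have e := coeFn_mulInvSub hI' f
    rw [hc] at e
    filter_upwards [e, Lp.coeFn_smul c (cauchyKernel hI'), coeFn_cauchyKernel hI'] with x h1 h2 h3
    rw [h2, Pi.smul_apply, h3, smul_eq_mul, mul_comm] at h1
    exact (mul_left_cancel₀ (inv_ne_zero (ofReal_sub_ne_zero hI' x)) h1).symm
  have h0 : c = 0 := eq_zero_of_memLp_const ((Lp.memLp f).ae_eq hfc)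
  refine Lp.ext ?_
  filter_upwards [hfc, Lp.coeFn_zero ℂ 2 (volume : Measure ℝ)] with x h1 h2
  rw [h1, h2, h0]
  rfl

lemma minimalOp_apply (φ ψ : L2R) (f : minimalDomain) :
    minimalOp φ ψ f = mulVar f + inner ℂ φ (f : L2R) • ψ := rfl

/-- The constant `c` contributes nothing because `∫ f = 0` on the minimal domain. -/
lemma inner_add_smul_eq (φ ψ u : L2R) {c : ℂ}
    (hc : MemLp (fun x : ℝ => (x : ℂ) * u x - c) 2 volume) (f : minimalDomain) :
    inner ℂ (hc.toLp + inner ℂ φ u • ψ) (f : L2R) = inner ℂ u (minimalOp ψ φ f) := by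
  obtain ⟨f, hf⟩ := f
  obtain ⟨h1, h2⟩ := mem_minimalDomain_iff.1 hf
  have e : inner ℂ hc.toLp f = inner ℂ u (mulVar ⟨f, hf⟩) := by
    have hi : Integrable f := by
      simpa using! integrable_of_memLp_mul (f := f) (c := 0) (by simpa using h1)
    rw [← sub_zero (inner ℂ u _), ← mul_zero (conj c), ← h2, ← integral_const_mul,
      inner_L2R, inner_L2R, ← integral_sub]
    · refine integral_congr_ae ?_
      filter_upwards [hc.coeFn_toLp, coeFn_mulVar ⟨f, hf⟩] with x h3 h4
      rw [h3, h4]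
      simp only [map_sub, map_mul, Complex.conj_ofReal]
      ring
    · exact (Lp.memLp _).integrable_mul (Lp.memLp u).star
    · exact hi.const_mul _
  rw [minimalOp_apply, inner_add_left, inner_add_right, e, inner_smul_left, inner_smul_right,
    inner_conj_symm, mul_comm]

lemma mem_maximalOp_domain (φ ψ u : L2R) {c : ℂ}
    (hc : MemLp (fun x : ℝ => (x : ℂ) * u x - c) 2 volume) : u ∈ (maximalOp φ ψ).domain :=
  LinearPMap.mem_adjoint_domain_of_exists _ ⟨_, inner_add_smul_eq φ ψ u hc⟩

lemma maximalOp_apply (φ ψ u : L2R) {c : ℂ}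
    (hc : MemLp (fun x : ℝ => (x : ℂ) * u x - c) 2 volume) (hu : u ∈ (maximalOp φ ψ).domain) :
    maximalOp φ ψ ⟨u, hu⟩ = hc.toLp + inner ℂ φ u • ψ :=
  LinearPMap.adjoint_apply_eq dense_minimalDomain _ (inner_add_smul_eq φ ψ u hc)

/-- As in the density proof, testing against `g / (x - i)` with `ĝ(i) = 0` shows that `(v + i u) /
(x + i) - u` is `c / (x + i)`. Hence `x u + c = v` is in `L²`. -/
lemma exists_memLp_of_mem_maximalOp_domain (φ ψ u : L2R) (hu : u ∈ (maximalOp φ ψ).domain) :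
    ∃ c : ℂ, MemLp (fun x : ℝ => (x : ℂ) * u x - c) 2 volume := by
  have hI : Complex.I.im ≠ 0 := by simp
  have hI' : (conj Complex.I).im ≠ 0 := by simp
  set v : L2R := maximalOp φ ψ ⟨u, hu⟩ - inner ℂ φ u • ψ with hv
  obtain ⟨c, hc⟩ := exists_eq_smul_cauchyKernel hI' (mulInvSub hI' (v + Complex.I • u) - u)
    fun g hg => by
      rw [Complex.conj_conj] at hg
      have h1 := LinearPMap.adjoint_isFormalAdjoint dense_minimalDomain
        ⟨u, hu⟩ (⟨_, mulInvSub_mem_minimalDomain hI hg⟩ : (minimalOp ψ φ).domain)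
      have h2 := minimalOp_apply ψ φ ⟨_, mulInvSub_mem_minimalDomain hI hg⟩
      rw [mulVar_mulInvSub hI hg] at h2
      have h3 : inner ℂ (maximalOp φ ψ ⟨u, hu⟩) (mulInvSub hI g) =
          inner ℂ u (g + Complex.I • mulInvSub hI g + inner ℂ ψ (mulInvSub hI g) • φ) := by
        rw [← h2]
        exact h1
      rw [inner_sub_left, ← inner_mulInvSub hI hI', hv, inner_add_left, inner_sub_left, h3]
      simp only [inner_add_right, inner_smul_left, inner_smul_right, inner_conj_symm,
        Complex.conj_I]
      ring
  refine ⟨-c, (Lp.memLp v).ae_eq ?_⟩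
  have e := Lp.coeFn_sub (mulInvSub hI' (v + Complex.I • u)) u
  rw [hc] at e
  filter_upwards [e, Lp.coeFn_smul c (cauchyKernel hI'), coeFn_cauchyKernel hI',
    coeFn_mulInvSub hI' (v + Complex.I • u), Lp.coeFn_add v (Complex.I • u),
    Lp.coeFn_smul Complex.I u] with x h1 h2 h3 h4 h5 h6
  rw [h2, Pi.smul_apply, h3, Pi.sub_apply, h4, h5, Pi.add_apply, h6, Pi.smul_apply, smul_eq_mul,
    smul_eq_mul] at h1
  have h7 := ofReal_sub_ne_zero hI' x
  rw [Complex.conj_I] at h1 h7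
  field_simp at h1
  linear_combination -h1

lemma HasTraces.ext_snd {u : L2R} {a b a' b' : ℂ} (h : HasTraces u a b) (h' : HasTraces u a' b') :
    b = b' := by
  have := h'.1.sub h.1
  refine sub_eq_zero.1 (eq_zero_of_memLp_const (this.ae_eq (Eventually.of_forall fun x => ?_)))
  simp only [Pi.sub_apply]
  ring

/-! ### The extensions -/

lemma exists_extensionOp_sub_eq {φ ψ : L2R} {B a b z : ℂ} {u v : L2R} (hu : HasTraces u a b)
    (hab : a - B * b = 0)
    (hv : ∀ᵐ x : ℝ, (x : ℂ) * u x - b + inner ℂ φ u * ψ x - z * u x = v x) :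
    ∃ h : u ∈ (extensionOp φ ψ B).domain, extensionOp φ ψ B ⟨u, h⟩ - z • u = v := by
  have hd := mem_maximalOp_domain φ ψ u hu.1
  refine ⟨⟨⟨a, b, hu, hab⟩, hd⟩, ?_⟩
  have e : extensionOp φ ψ B ⟨u, ⟨⟨a, b, hu, hab⟩, hd⟩⟩ = maximalOp φ ψ ⟨u, hd⟩ :=
    LinearPMap.domRestrict_apply rfl
  rw [e, maximalOp_apply φ ψ u hu.1]
  refine Lp.ext ?_
  filter_upwards [hv, hu.1.coeFn_toLp, Lp.coeFn_sub (hu.1.toLp + inner ℂ φ u • ψ) (z • u),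
    Lp.coeFn_add hu.1.toLp (inner ℂ φ u • ψ), Lp.coeFn_smul (inner ℂ φ u) ψ,
    Lp.coeFn_smul z u] with x h1 h2 h3 h4 h5 h6
  rw [h3, Pi.sub_apply, h4, Pi.add_apply, h5, h6, h2, ← h1]
  simp

lemma resolvent_apply_eq {φ ψ : L2R} {B a b z : ℂ} {u v : L2R} {R : L2R →L[ℂ] L2R}
    (hR : IsResolvent (extensionOp φ ψ B) z R) (hu : HasTraces u a b) (hab : a - B * b = 0)
    (hv : ∀ᵐ x : ℝ, (x : ℂ) * u x - b + inner ℂ φ u * ψ x - z * u x = v x) : R v = u := by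
  obtain ⟨h, rfl⟩ := exists_extensionOp_sub_eq (φ := φ) (ψ := ψ) (B := B) hu hab hv
  exact hR.2 ⟨u, h⟩

/-! ### Deficiency elements -/

lemma integral_inv_ofReal_sub {z : ℂ} (hz : z.im ≠ 0) (a b : ℝ) :
    ∫ x in a..b, ((x : ℂ) - z)⁻¹ = Complex.log (b - z) - Complex.log (a - z) := by
  refine intervalIntegral.integral_eq_sub_of_hasDerivAt (f := fun x : ℝ => Complex.log (x - z))
    (fun x _ => ?_) ((continuous_inv_sub hz).intervalIntegrable _ _)
  have h1 : HasDerivAt (fun x : ℝ => (x : ℂ) - z) 1 x := (hasDerivAt_id x).ofReal_comp.sub_const z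
  simpa using h1.clog_real (Complex.mem_slitPlane_iff.2 (Or.inr (by simpa using hz)))

/-- The principal logarithm is a primitive. The sign arises because `-1 - z / R` tends to `-1` from
below the branch cut when `z.im > 0` and from above when `z.im < 0`. -/
lemma tendsto_integral_inv_ofReal_sub {z : ℂ} (hz : z.im ≠ 0) :
    Tendsto (fun R : ℝ => ∫ x in (-R)..R, ((x : ℂ) - z)⁻¹) atTop
      (𝓝 (Real.sign z.im * (π * Complex.I))) := by
  have hinv : Tendsto (fun R : ℝ => z / (R : ℂ)) atTop (𝓝 0) := by
    have h : Tendsto (fun R : ℝ => ((R⁻¹ : ℝ) : ℂ)) atTop (𝓝 ((0 : ℝ) : ℂ)) :=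
      (Complex.continuous_ofReal.tendsto 0).comp tendsto_inv_atTop_zero
    simpa [div_eq_mul_inv] using h.const_mul z
  have h1 : Tendsto (fun R : ℝ => Complex.log (1 - z / R)) atTop (𝓝 0) := by
    have h := (continuousAt_clog (x := 1) (by simp)).tendsto
    rw [Complex.log_one] at h
    exact h.comp (by simpa using hinv.const_sub 1)
  have hn : Tendsto (fun R : ℝ => -1 - z / (R : ℂ)) atTop (𝓝 (-1)) := by
    simpa using hinv.const_sub (-1)
  have him : ∀ R : ℝ, (-1 - z / (R : ℂ)).im = -(z.im / R) := fun R => by simp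
  have h2 : Tendsto (fun R : ℝ => Complex.log (-1 - z / R)) atTop
      (𝓝 (-(Real.sign z.im * (π * Complex.I)))) := by
    rcases lt_or_gt_of_ne hz with h | h
    · have := (Complex.tendsto_log_nhdsWithin_im_nonneg_of_re_neg_of_im_zero
        (z := -1) (by simp) (by simp)).comp (tendsto_nhdsWithin_iff.2 ⟨hn, by
          filter_upwards [eventually_gt_atTop (0 : ℝ)] with R hR
          rw [him, neg_nonneg]
          exact div_nonpos_of_nonpos_of_nonneg h.le hR.le⟩)
      simpa [Function.comp_def, Real.sign_of_neg h] using this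
    · have := (Complex.tendsto_log_nhdsWithin_im_neg_of_re_neg_of_im_zero
        (z := -1) (by simp) (by simp)).comp (tendsto_nhdsWithin_iff.2 ⟨hn, by
          filter_upwards [eventually_gt_atTop (0 : ℝ)] with R hR
          rw [him, neg_lt_zero]
          exact div_pos h hR⟩)
      simpa [Function.comp_def, Real.sign_of_pos h] using this
  have h3 := h1.sub h2
  rw [zero_sub, neg_neg] at h3
  refine h3.congr' ?_
  filter_upwards [eventually_gt_atTop (0 : ℝ)] with R hR
  have hR' : (R : ℂ) ≠ 0 := by exact_mod_cast hR.ne'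
  have hne : ∀ w : ℂ, w.im = 0 → w - z / R ≠ 0 := fun w hw h => by
    have := congrArg Complex.im h
    simp [hw, hz, hR.ne'] at this
  have e1 : (R : ℂ) - z = R * (1 - z / R) := by field_simp
  have e2 : ((-R : ℝ) : ℂ) - z = R * (-1 - z / R) := by push_cast; field_simp
  rw [integral_inv_ofReal_sub hz, e1, e2, Complex.log_ofReal_mul hR (hne 1 (by simp)),
    Complex.log_ofReal_mul hR (hne (-1) (by simp))]
  ring

lemma hasTraces_cauchyKernel {z : ℂ} (hz : z.im ≠ 0) :
    HasTraces (cauchyKernel hz) (Real.sign z.im * (π * Complex.I)) 1 := by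
  constructor
  · refine ((Lp.memLp (cauchyKernel hz)).const_mul z).ae_eq ?_
    filter_upwards [coeFn_cauchyKernel hz] with x h
    rw [h]
    have := ofReal_sub_ne_zero hz x
    field_simp
    ring
  · refine (tendsto_integral_inv_ofReal_sub hz).congr fun R => ?_
    refine intervalIntegral.integral_congr_ae ?_
    filter_upwards [coeFn_cauchyKernel hz] with x h _
    rw [h]

lemma hasTraces_mulInvSub {z : ℂ} (hz : z.im ≠ 0) (g : L2R) :
    HasTraces (mulInvSub hz g) (cauchyTransform g z) 0 := by
  constructor
  · refine ((Lp.memLp g).add ((Lp.memLp (mulInvSub hz g)).const_mul z)).ae_eq ?_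
    filter_upwards [ofReal_mul_mulInvSub hz g] with x h
    rw [h, sub_zero]
    rfl
  · refine (intervalIntegral_tendsto_integral (integrable_div_sub g hz) tendsto_neg_atTop_atBot
      tendsto_id).congr fun R => ?_
    refine intervalIntegral.integral_congr_ae ?_
    filter_upwards [coeFn_mulInvSub hz g] with x h _
    rw [h, div_eq_inv_mul]

/-- The solution `u` of `(Ã^* - z) u = 0` with `Γ₂ u = 1`. -/
def deficiencyElement (φ ψ : L2R) {z : ℂ} (hz : z.im ≠ 0) : L2R :=
  cauchyKernel hz + (-cauchyTransform (star φ : L2R) z) • mulInvSub hz ψ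

/-- The value of `Γ₁ - B Γ₂` at the deficiency element. -/
def characteristicFn (φ ψ : L2R) (B z : ℂ) : ℂ :=
  Real.sign z.im * (π * Complex.I) - B -
    cauchyTransform (star φ : L2R) z * cauchyTransform ψ z

/-- The inner product of the deficiency element with `g`, where `h` is the conjugate of `g`. -/
def pairingFn (φ ψ h : L2R) (z : ℂ) : ℂ :=
  cauchyTransform h z - cauchyTransform (star φ : L2R) z * cauchyTransform (fun x => h x * ψ x) z

lemma hasTraces_deficiencyElement (φ ψ : L2R) (B : ℂ) {z : ℂ} (hz : z.im ≠ 0) :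
    HasTraces (deficiencyElement φ ψ hz) (characteristicFn φ ψ B z + B) 1 := by
  have := (hasTraces_cauchyKernel hz).add
    ((hasTraces_mulInvSub hz ψ).smul (-cauchyTransform (star φ : L2R) z))
  rw [mul_zero, add_zero] at this
  have e : characteristicFn φ ψ B z + B = Real.sign z.im * (π * Complex.I) +
      -cauchyTransform (star φ : L2R) z * cauchyTransform ψ z := by
    rw [characteristicFn]
    ring
  rw [e]
  exact this

lemma inner_deficiencyElement (φ ψ g : L2R) {z : ℂ} (hz : z.im ≠ 0) :
    inner ℂ g (deficiencyElement φ ψ hz) = pairingFn φ ψ (star g) z := by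
  have : inner ℂ g (mulInvSub hz ψ) = cauchyTransform (fun x => (star g : L2R) x * ψ x) z := by
    rw [inner_L2R]
    refine integral_congr_ae ?_
    filter_upwards [coeFn_mulInvSub hz ψ, coeFn_star_ae g] with x h1 h2
    rw [h1, h2]
    ring
  rw [deficiencyElement, inner_add_right, inner_smul_right, this, inner_cauchyKernel, pairingFn]
  ring

lemma cauchyTransform_star_mul_eq_zero {φ ψ : L2R} (hdisj : ∀ᵐ x : ℝ, φ x * ψ x = 0) (z : ℂ) :
    cauchyTransform (fun x => (star φ : L2R) x * ψ x) z = 0 := by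
  refine integral_eq_zero_of_ae ?_
  filter_upwards [hdisj, coeFn_star_ae φ] with x h1 h2
  rw [h2]
  rcases mul_eq_zero.1 h1 with h | h <;> simp [h]

lemma inner_self_deficiencyElement {φ ψ : L2R} (hdisj : ∀ᵐ x : ℝ, φ x * ψ x = 0) {z : ℂ}
    (hz : z.im ≠ 0) :
    inner ℂ φ (deficiencyElement φ ψ hz) = cauchyTransform (star φ : L2R) z := by
  rw [inner_deficiencyElement, pairingFn, cauchyTransform_star_mul_eq_zero hdisj, mul_zero, sub_zero]

lemma coeFn_deficiencyElement (φ ψ : L2R) {z : ℂ} (hz : z.im ≠ 0) :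
    ∀ᵐ x : ℝ, deficiencyElement φ ψ hz x =
      ((x : ℂ) - z)⁻¹ * (1 - cauchyTransform (star φ : L2R) z * ψ x) := by
  filter_upwards [Lp.coeFn_add (cauchyKernel hz)
    ((-cauchyTransform (star φ : L2R) z) • mulInvSub hz ψ),
    Lp.coeFn_smul (-cauchyTransform (star φ : L2R) z) (mulInvSub hz ψ), coeFn_cauchyKernel hz,
    coeFn_mulInvSub hz ψ] with x h1 h2 h3 h4
  rw [deficiencyElement, h1, Pi.add_apply, h2, Pi.smul_apply, h3, h4, smul_eq_mul]
  ring

lemma deficiencyElement_equation {φ ψ : L2R} (hdisj : ∀ᵐ x : ℝ, φ x * ψ x = 0) {z : ℂ}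
    (hz : z.im ≠ 0) : ∀ᵐ x : ℝ, (x : ℂ) * deficiencyElement φ ψ hz x - 1 +
      inner ℂ φ (deficiencyElement φ ψ hz) * ψ x - z * deficiencyElement φ ψ hz x = 0 := by
  filter_upwards [coeFn_deficiencyElement φ ψ hz] with x h
  rw [h, inner_self_deficiencyElement hdisj]
  have := ofReal_sub_ne_zero hz x
  field_simp
  ring

/-- Every solution of `(Ã^* - z) u = 0` is a multiple of the deficiency element. -/
lemma exists_eq_smul_deficiencyElement {φ ψ : L2R} (hdisj : ∀ᵐ x : ℝ, φ x * ψ x = 0) {z : ℂ}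
    (hz : z.im ≠ 0) {u : L2R} (hu : u ∈ (maximalOp φ ψ).domain)
    (h : maximalOp φ ψ ⟨u, hu⟩ - z • u = 0) : ∃ c : ℂ, u = c • deficiencyElement φ ψ hz := by
  obtain ⟨c, hc⟩ := exists_memLp_of_mem_maximalOp_domain φ ψ u hu
  rw [maximalOp_apply φ ψ u hc hu, sub_eq_zero] at h
  have e : ∀ᵐ x : ℝ, u x = ((x : ℂ) - z)⁻¹ * (c - inner ℂ φ u * ψ x) := by
    have e1 := Lp.coeFn_add hc.toLp (inner ℂ φ u • ψ)
    rw [h] at e1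
    filter_upwards [e1, hc.coeFn_toLp, Lp.coeFn_smul (inner ℂ φ u) ψ, Lp.coeFn_smul z u] with
      x h1 h2 h3 h4
    rw [h4, Pi.add_apply, h2, h3, Pi.smul_apply, Pi.smul_apply, smul_eq_mul, smul_eq_mul] at h1
    rw [eq_inv_mul_iff_mul_eq₀ (ofReal_sub_ne_zero hz x)]
    linear_combination -h1
  -- Pairing with `φ` removes the term with `ψ`, so the rank-one coefficient is determined by `c`.
  have e2 : inner ℂ φ u = c * cauchyTransform (star φ : L2R) z := by
    rw [inner_L2R, cauchyTransform, ← integral_const_mul]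
    refine integral_congr_ae ?_
    filter_upwards [e, hdisj, coeFn_star_ae φ] with x h1 h2 h3
    have : ψ x * conj (φ x) = 0 := by
      rcases mul_eq_zero.1 h2 with h | h <;> simp [h]
    rw [h1, h3]
    linear_combination (-((x : ℂ) - z)⁻¹ * inner ℂ φ u) * this
  refine ⟨c, Lp.ext ?_⟩
  filter_upwards [e, coeFn_deficiencyElement φ ψ hz, Lp.coeFn_smul c (deficiencyElement φ ψ hz)]
    with x h1 h2 h3
  rw [h3, Pi.smul_apply, h2, h1, e2, smul_eq_mul]
  ring

/-- A zero would make the deficiency element an eigenvector of `A_B`; it is not zero because its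
`Γ₂` is 1. -/
lemma characteristicFn_ne_zero {φ ψ : L2R} (hdisj : ∀ᵐ x : ℝ, φ x * ψ x = 0) {B z : ℂ}
    (hz : z.im ≠ 0) (hρ : z ∈ rho φ ψ B) : characteristicFn φ ψ B z ≠ 0 := fun h0 => by
  obtain ⟨R, hR⟩ := hρ
  have ht := hasTraces_deficiencyElement φ ψ B hz
  have hu : R 0 = deficiencyElement φ ψ hz := by
    refine resolvent_apply_eq hR ht (by rw [h0]; ring) ?_
    filter_upwards [deficiencyElement_equation hdisj hz, Lp.coeFn_zero ℂ 2 (volume : Measure ℝ)]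
      with x h1 h2
    rw [h1, h2, Pi.zero_apply]
  rw [map_zero] at hu
  rw [← hu] at ht
  exact one_ne_zero (ht.ext_snd hasTraces_zero)

/-- The resolvent of an extension on deficiency elements. -/
lemma resolvent_apply_deficiencyElement {φ ψ : L2R} (hdisj : ∀ᵐ x : ℝ, φ x * ψ x = 0)
    {B z δ : ℂ} (hz : z.im ≠ 0) (hδ : δ.im ≠ 0) (hne : z - δ ≠ 0) {R : L2R →L[ℂ] L2R}
    (hR : IsResolvent (extensionOp φ ψ B) δ R) :
    R (deficiencyElement φ ψ hz) = (z - δ)⁻¹ • (deficiencyElement φ ψ hz +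
      (-(characteristicFn φ ψ B z / characteristicFn φ ψ B δ)) • deficiencyElement φ ψ hδ) := by
  have hD := characteristicFn_ne_zero hdisj hδ ⟨R, hR⟩
  -- This coefficient cancels the value of `Γ₁ - B Γ₂`, so the combination lies in the domain of
  -- `A_B`.
  set κ := -(characteristicFn φ ψ B z / characteristicFn φ ψ B δ) with hκ
  refine resolvent_apply_eq hR (((hasTraces_deficiencyElement φ ψ B hz).add
    ((hasTraces_deficiencyElement φ ψ B hδ).smul κ)).smul (z - δ)⁻¹) ?_ ?_
  · rw [hκ]
    field_simp
    ring
  · filter_upwards [deficiencyElement_equation hdisj hz, deficiencyElement_equation hdisj hδ,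
      Lp.coeFn_smul (z - δ)⁻¹ (deficiencyElement φ ψ hz + κ • deficiencyElement φ ψ hδ),
      Lp.coeFn_add (deficiencyElement φ ψ hz) (κ • deficiencyElement φ ψ hδ),
      Lp.coeFn_smul κ (deficiencyElement φ ψ hδ)] with x h1 h2 h3 h4 h5
    rw [h3, Pi.smul_apply, h4, Pi.add_apply, h5, Pi.smul_apply, inner_smul_right, inner_add_right,
      inner_smul_right]
    simp only [smul_eq_mul]
    have h6 := inv_mul_cancel₀ hne
    linear_combination (z - δ)⁻¹ * h1 + (z - δ)⁻¹ * κ * h2 + h6 * deficiencyElement φ ψ hz x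

/-! ### The resolvent set -/

/-- Three disjoint steps against two linear conditions. On the resulting function every extension
acts as multiplication by `x`. -/
lemma exists_ne_zero_supported (φ : L2R) (d : ℝ) {t : ℝ} (ht : 0 < t) :
    ∃ u : L2R, u ≠ 0 ∧ (∀ᵐ x : ℝ, x ∉ Set.Ico d (d + 3 * t) → u x = 0) ∧
      ∫ x, u x = 0 ∧ inner ℂ φ u = 0 := by
  set S : Fin 3 → Set ℝ := fun j => Set.Ico (d + j * t) (d + (j + 1) * t) with hS
  have hfin : ∀ j, volume (S j) ≠ ∞ := fun j => measure_Ico_lt_top.ne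
  set J : Set ℝ := Set.Ico d (d + 3 * t) with hJ
  have hSJ : ∀ j, S j ⊆ J := fun j => by
    have h1 : (0 : ℝ) ≤ j := by positivity
    have h2 : (j : ℝ) + 1 ≤ 3 := by exact_mod_cast j.2
    refine Set.Ico_subset_Ico ?_ ?_ <;> nlinarith
  have hJfin : volume J ≠ ∞ := measure_Ico_lt_top.ne
  let e : Fin 3 → L2R := fun j => indicatorConstLp 2 (s := S j) measurableSet_Ico (hfin j) (1 : ℂ)
  let k : L2R := indicatorConstLp 2 (s := J) measurableSet_Ico hJfin (1 : ℂ)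
  let L : (Fin 3 → ℂ) →ₗ[ℂ] ℂ × ℂ :=
    ((innerSL ℂ k).toLinearMap.prod (innerSL ℂ φ).toLinearMap).comp (Fintype.linearCombination ℂ e)
  obtain ⟨c, hcL, hc⟩ := (Submodule.ne_bot_iff _).1
    (LinearMap.ker_ne_bot_of_finrank_lt (f := L) (by simp))
  set u := Fintype.linearCombination ℂ e c with hu
  have hk0 : inner ℂ k u = 0 := congrArg Prod.fst (LinearMap.mem_ker.1 hcL)
  have hφ0 : inner ℂ φ u = 0 := congrArg Prod.snd (LinearMap.mem_ker.1 hcL)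
  have hux : ∀ᵐ x : ℝ, u x = ∑ j, c j * (S j).indicator (fun _ => (1 : ℂ)) x := by
    have h1 := Lp.coeFn_finsetSum Finset.univ fun j => c j • e j
    have h2 : ∀ᵐ x : ℝ, ∀ j, (c j • e j : L2R) x = c j * e j x :=
      ae_all_iff.2 fun j => Lp.coeFn_smul (c j) (e j)
    have h3 : ∀ᵐ x : ℝ, ∀ j, e j x = (S j).indicator (fun _ => (1 : ℂ)) x :=
      ae_all_iff.2 fun j => indicatorConstLp_coeFn
    filter_upwards [h1, h2, h3] with x h4 h5 h6
    rw [hu, Fintype.linearCombination_apply, h4, Finset.sum_apply]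
    exact Finset.sum_congr rfl fun j _ => by rw [h5, h6]
  have hsupp : ∀ᵐ x : ℝ, x ∉ J → u x = 0 := by
    filter_upwards [hux] with x hx hxJ
    rw [hx]
    exact Finset.sum_eq_zero fun j _ => by
      rw [Set.indicator_of_notMem fun h => hxJ (hSJ j h), mul_zero]
  refine ⟨u, fun h0 => hc (funext fun i => ?_), hsupp, ?_, hφ0⟩
  · by_contra hci
    have hdis : ∀ j, j ≠ i → ∀ x ∈ S i, x ∉ S j := fun j hji x hxi hxj => by
      rcases lt_or_gt_of_ne hji with h | h
      · have : (j : ℝ) + 1 ≤ i := by exact_mod_cast h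
        have := hxi.1
        have := hxj.2
        nlinarith
      · have : (i : ℝ) + 1 ≤ j := by exact_mod_cast h
        have := hxj.1
        have := hxi.2
        nlinarith
    have hnull : ∀ᵐ x : ℝ, x ∉ S i := by
      rw [h0] at hux
      filter_upwards [hux, Lp.coeFn_zero ℂ 2 (volume : Measure ℝ)] with x h1 h2 hx
      rw [h2, Finset.sum_eq_single i (fun j _ hj => by
        rw [Set.indicator_of_notMem (hdis j hj x hx), mul_zero]) (by simp),
        Set.indicator_of_mem hx, mul_one] at h1
      exact hci h1.symm
    have : volume (S i) = 0 := by simpa [ae_iff] using hnull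
    simp only [hS, Real.volume_Ico, ENNReal.ofReal_eq_zero] at this
    linarith
  · rw [← hk0, inner_L2R]
    refine integral_congr_ae ?_
    filter_upwards [hsupp, indicatorConstLp_coeFn (p := 2) (s := J) (hs := measurableSet_Ico)
      (hμs := hJfin) (c := (1 : ℂ))] with x h1 h2
    by_cases hx : x ∈ J
    · simp [k, h2, hx]
    · simp [h1 hx]

/-- At a real `δ`, functions supported on short intervals starting at `δ` are approximate
eigenvectors. The length `3t = 1 / (‖R‖ + 1)` contradicts the bound `‖u‖ ≤ ‖R‖ · 3t ‖u‖`. -/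
theorem im_ne_zero_of_mem_rho {φ ψ : L2R} {B δ : ℂ} (hδ : δ ∈ rho φ ψ B) : δ.im ≠ 0 := fun h0 => by
  obtain ⟨R, hR⟩ := hδ
  have hδr : δ = (δ.re : ℂ) := Complex.ext rfl (by simpa using h0)
  set t : ℝ := (3 * (‖R‖ + 1))⁻¹ with ht
  have htpos : 0 < t := by positivity
  obtain ⟨u, hu0, hus, hui, huφ⟩ := exists_ne_zero_supported φ δ.re htpos
  have hb : ∀ᵐ x : ℝ, ‖((x : ℂ) - δ) * u x‖ ≤ 3 * t * ‖u x‖ := by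
    filter_upwards [hus] with x hx
    by_cases h : x ∈ Set.Ico δ.re (δ.re + 3 * t)
    · rw [norm_mul]
      gcongr
      rw [hδr, ← Complex.ofReal_sub, Complex.norm_real, Real.norm_eq_abs, abs_of_nonneg] <;>
        linarith [h.1, h.2]
    · simp [hx h]
  have hm : MemLp (fun x : ℝ => ((x : ℂ) - δ) * u x) 2 volume :=
    (Lp.memLp u).of_le_mul ((by fun_prop : Continuous fun x : ℝ => (x : ℂ) - δ).aestronglyMeasurable.mul
      (Lp.aestronglyMeasurable u)) hb
  have hmx : MemLp (fun x : ℝ => (x : ℂ) * u x) 2 volume := by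
    refine (hm.add ((Lp.memLp u).const_mul δ)).ae_eq (Eventually.of_forall fun x => ?_)
    simp only [Pi.add_apply]
    ring
  have hRu : R hm.toLp = u := by
    refine resolvent_apply_eq hR (mem_minimalDomain_iff.2 ⟨hmx, hui⟩ : HasTraces u 0 0) (by simp) ?_
    filter_upwards [hm.coeFn_toLp] with x h1
    rw [h1, huφ]
    ring
  have hn : ‖hm.toLp‖ ≤ 3 * t * ‖u‖ := by
    refine Lp.norm_le_mul_norm_of_ae_le_mul ?_
    filter_upwards [hb, hm.coeFn_toLp] with x h1 h2
    rwa [h2]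
  have h1 : ‖u‖ ≤ ‖R‖ * (3 * t * ‖u‖) := by
    calc ‖u‖ = ‖R hm.toLp‖ := by rw [hRu]
      _ ≤ ‖R‖ * ‖hm.toLp‖ := R.le_opNorm _
      _ ≤ _ := by gcongr
  have h2 : 3 * t * (‖R‖ + 1) = 1 := by rw [ht]; field_simp
  have h3 : 0 < ‖u‖ := norm_pos_iff.2 hu0
  nlinarith

lemma isOpen_rho (φ ψ : L2R) (B : ℂ) : IsOpen (rho φ ψ B) :=
  isOpen_iff_mem_nhds.2 fun _ ⟨_, hR⟩ => by
    obtain ⟨Q, hQ, -⟩ := eventually_isResolvent hR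
    exact hQ.mono fun w hw => ⟨Q w, hw⟩

/-! ### The orthogonal complement of the detectable subspace -/

/-- Dominated convergence: `|x - s i y| ≥ |x - i|` for `y ≥ 1`. The hypothesis admits both `L²` and
`L¹` densities. -/
lemma tendsto_cauchyTransform_mul_I {f : ℝ → ℂ}
    (hf : Integrable fun x : ℝ => f x / ((x : ℂ) - Complex.I)) {s : ℝ} (hs : s = 1 ∨ s = -1) :
    Tendsto (fun y : ℝ => cauchyTransform f (((s * y : ℝ) : ℂ) * Complex.I)) atTop (𝓝 0) := by
  have hI : Complex.I.im ≠ 0 := by simp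
  have hfm : AEStronglyMeasurable f volume := by
    have : AEStronglyMeasurable (fun x : ℝ => f x / ((x : ℂ) - Complex.I) * ((x : ℂ) - Complex.I))
        volume :=
      hf.1.mul (by fun_prop : Continuous fun x : ℝ => (x : ℂ) - Complex.I).aestronglyMeasurable
    refine this.congr (Eventually.of_forall fun x => ?_)
    exact div_mul_cancel₀ _ (ofReal_sub_ne_zero hI x)
  rw [← integral_zero ℝ ℂ (μ := volume)]
  refine tendsto_integral_filter_of_dominated_convergence
    (fun x => ‖f x / ((x : ℂ) - Complex.I)‖) ?_ ?_ hf.norm ?_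
  · filter_upwards [eventually_ge_atTop (1 : ℝ)] with y hy
    have hz : (((s * y : ℝ) : ℂ) * Complex.I).im ≠ 0 := by
      have : s ≠ 0 := by rcases hs with rfl | rfl <;> norm_num
      simp [this, (by linarith : y ≠ 0)]
    simp_rw [div_eq_mul_inv]
    exact hfm.mul (continuous_inv_sub hz).aestronglyMeasurable
  · filter_upwards [eventually_ge_atTop (1 : ℝ)] with y hy
    refine Eventually.of_forall fun x => ?_
    rw [norm_div, norm_div]
    refine div_le_div_of_nonneg_left (norm_nonneg _)
      (norm_pos_iff.2 (ofReal_sub_ne_zero hI x)) ?_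
    rw [← sq_le_sq₀ (norm_nonneg _) (norm_nonneg _),
      Complex.sq_norm, Complex.sq_norm, Complex.normSq_apply, Complex.normSq_apply]
    rcases hs with rfl | rfl <;> simp <;> nlinarith
  · refine Eventually.of_forall fun x => ?_
    rw [tendsto_zero_iff_norm_tendsto_zero]
    refine squeeze_zero' (Eventually.of_forall fun y => norm_nonneg _)
      (g := fun y => ‖f x‖ / y) ?_ (tendsto_const_nhds.div_atTop tendsto_id)
    filter_upwards [eventually_gt_atTop (0 : ℝ)] with y hy
    rw [norm_div]
    refine div_le_div_of_nonneg_left (norm_nonneg _) hy ?_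
    have h1 := abs_im_le_norm_ofReal_sub (((s * y : ℝ) : ℂ) * Complex.I) x
    have h2 : |s * y| = y := by
      rcases hs with rfl | rfl <;> simp [abs_of_pos hy]
    simpa [h2] using! h1

/-- The relation continues analytically to the whole half-plane, where the sign in
`characteristicFn` is constant. Letting `z → s i ∞` leaves only the constant part `s π i - B`. -/
lemma pairingFn_eq_zero_of_eventually {φ ψ h : L2R} {B D α z₁ : ℂ} {s : ℝ} (hs : s = 1 ∨ s = -1)
    (hz₁ : 0 < s * z₁.im)
    (hev : ∀ᶠ z in 𝓝 z₁, α * characteristicFn φ ψ B z = D * pairingFn φ ψ h z) :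
    α * (s * (π * Complex.I) - B) = 0 ∧
      (α = 0 → D ≠ 0 → ∀ z : ℂ, 0 < s * z.im → pairingFn φ ψ h z = 0) := by
  set F : ℂ → ℂ := fun z => α * (s * (π * Complex.I) - B - cauchyTransform (star φ : L2R) z *
    cauchyTransform ψ z) - D * pairingFn φ ψ h z with hF
  set U : Set ℂ := {z | 0 < s * z.im} with hU
  have hUo : IsOpen U := isOpen_lt continuous_const (continuous_const.mul Complex.continuous_im)
  have hUc : Convex ℝ U := by
    have : IsLinearMap ℝ fun z : ℂ => s * z.im :=
      ⟨fun x y => by simp [mul_add], fun c x => by simp; ring⟩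
    exact convex_halfSpace_gt this 0
  have him : ∀ z ∈ U, z.im ≠ 0 := fun z hz h => by
    have hz' : 0 < s * z.im := hz
    simp [h] at hz'
  have hsign : ∀ z ∈ U, Real.sign z.im = s := fun z hz => by
    have hz' : 0 < s * z.im := hz
    rcases hs with rfl | rfl
    · exact Real.sign_of_pos (by linarith)
    · exact Real.sign_of_neg (by linarith)
  have hFan : AnalyticOnNhd ℂ F U := by
    refine DifferentiableOn.analyticOnNhd (fun z hz => ?_) hUo
    have h1 := differentiableAt_cauchyTransform (him z hz) (integrable_div_sub (star φ) (him z hz))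
    have h2 := differentiableAt_cauchyTransform (him z hz) (integrable_div_sub ψ (him z hz))
    have h3 := differentiableAt_cauchyTransform (him z hz) (integrable_div_sub h (him z hz))
    have h4 := differentiableAt_cauchyTransform (him z hz)
      (integrable_div_sub_of_integrable (integrable_mul_L2R h ψ) (him z hz))
    exact (((((h1.mul h2).const_sub _).const_mul α)).sub
      ((h3.sub (h1.mul h4)).const_mul D)).differentiableWithinAt
  have hF0 : Set.EqOn F 0 U := by
    refine hFan.eqOn_zero_of_preconnected_of_eventuallyEq_zero hUc.isPreconnected hz₁ ?_
    filter_upwards [hev, hUo.mem_nhds hz₁] with z h1 h2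
    rw [characteristicFn, hsign z h2] at h1
    simp only [hF, h1, sub_self, Pi.zero_apply]
  constructor
  · have hI : Complex.I.im ≠ 0 := by simp
    have t1 := tendsto_cauchyTransform_mul_I (integrable_div_sub (star φ) hI) hs
    have t2 := tendsto_cauchyTransform_mul_I (integrable_div_sub ψ hI) hs
    have t3 := tendsto_cauchyTransform_mul_I (integrable_div_sub h hI) hs
    have t4 := tendsto_cauchyTransform_mul_I
      (integrable_div_sub_of_integrable (integrable_mul_L2R h ψ) hI) hs
    have t := ((((t1.mul t2).const_sub (s * (π * Complex.I) - B)).const_mul α)).sub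
      ((t3.sub (t1.mul t4)).const_mul D)
    have t' : Tendsto (fun y : ℝ => F (((s * y : ℝ) : ℂ) * Complex.I)) atTop (𝓝 0) := by
      refine tendsto_const_nhds.congr' ?_
      filter_upwards [eventually_gt_atTop (0 : ℝ)] with y hy
      refine (hF0 ?_).symm
      change 0 < s * _
      rcases hs with rfl | rfl <;> simpa
    simpa using tendsto_nhds_unique t t'
  · intro hα hD z hz
    have := hF0 hz
    simp only [hF, hα, Pi.zero_apply, zero_mul, zero_sub, neg_eq_zero] at this
    exact (mul_eq_zero.1 this).resolve_left hD

lemma isSolution_deficiencyElement {φ ψ : L2R} (hdisj : ∀ᵐ x : ℝ, φ x * ψ x = 0) {z : ℂ}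
    (hz : z.im ≠ 0) (B : ℂ) :
    IsSolution φ ψ B z (characteristicFn φ ψ B z) (deficiencyElement φ ψ hz) := by
  have ht := hasTraces_deficiencyElement φ ψ B hz
  refine ⟨⟨mem_maximalOp_domain φ ψ _ ht.1, ?_⟩, _, _, ht, by ring⟩
  rw [maximalOp_apply φ ψ _ ht.1]
  refine Lp.ext ?_
  set u := deficiencyElement φ ψ hz
  filter_upwards [deficiencyElement_equation hdisj hz, ht.1.coeFn_toLp,
    Lp.coeFn_sub (ht.1.toLp + inner ℂ φ u • ψ) (z • u), Lp.coeFn_add ht.1.toLp (inner ℂ φ u • ψ),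
    Lp.coeFn_smul (inner ℂ φ u) ψ, Lp.coeFn_smul z u, Lp.coeFn_zero ℂ 2 (volume : Measure ℝ)]
    with x h1 h2 h3 h4 h5 h6 h7
  rw [h3, Pi.sub_apply, h4, Pi.add_apply, h5, h6, h2, h7, Pi.zero_apply, ← h1]
  simp [u]

/-- The range of the solution operator lies on the line through one deficiency element, so
orthogonality is a relation between the values of `pairingFn` at `μ₀` and at `δ`. -/
theorem mem_orthogonal_detectableSpan_iff {φ ψ : L2R} (hdisj : ∀ᵐ x : ℝ, φ x * ψ x = 0) {B μ₀ : ℂ}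
    (hμ₀ : μ₀ ∈ rho φ ψ B) (hp : ∃ z ∈ rho φ ψ B, 0 < z.im) (hn : ∃ z ∈ rho φ ψ B, z.im < 0)
    (g : L2R) : g ∈ (detectableSpan φ ψ B μ₀)ᗮ ↔
      ∀ z : ℂ, z.im ≠ 0 → pairingFn φ ψ (star g) z = 0 := by
  have hμ := im_ne_zero_of_mem_rho hμ₀
  have hD := characteristicFn_ne_zero hdisj hμ hμ₀
  constructor
  · intro hg
    have key : ∀ δ ∈ rho φ ψ B, pairingFn φ ψ (star g) μ₀ * characteristicFn φ ψ B δ =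
        characteristicFn φ ψ B μ₀ * pairingFn φ ψ (star g) δ := fun δ hδ => by
      rcases eq_or_ne μ₀ δ with rfl | hne
      · ring
      have hδi := im_ne_zero_of_mem_rho hδ
      have hDδ := characteristicFn_ne_zero hdisj hδi hδ
      obtain ⟨R, hR⟩ := hδ
      have h1 := (Submodule.mem_orthogonal' _ _).1 hg _ (Submodule.subset_span
        ⟨δ, R, _, _, hR, isSolution_deficiencyElement hdisj hμ B, rfl⟩)
      rw [resolvent_apply_deficiencyElement hdisj hμ hδi (sub_ne_zero.2 hne) hR, inner_smul_right,
        inner_add_right, inner_smul_right, inner_deficiencyElement, inner_deficiencyElement] at h1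
      have h2 := (mul_eq_zero.1 h1).resolve_left (inv_ne_zero (sub_ne_zero.2 hne))
      field_simp at h2
      linear_combination h2
    obtain ⟨z₁, hz₁, hp⟩ := hp
    obtain ⟨z₂, hz₂, hn⟩ := hn
    obtain ⟨p1, p2⟩ := pairingFn_eq_zero_of_eventually (s := 1) (Or.inl rfl) (by linarith)
      (((isOpen_rho φ ψ B).eventually_mem hz₁).mono key)
    obtain ⟨n1, n2⟩ := pairingFn_eq_zero_of_eventually (s := -1) (Or.inr rfl) (by linarith)
      (((isOpen_rho φ ψ B).eventually_mem hz₂).mono key)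
    have h0 : pairingFn φ ψ (star g) μ₀ = 0 := by
      -- `πi - B` and `-πi - B` differ by `2πi`, so they cannot both vanish: points of `ρ(A_B)` in
      -- both half-planes are needed.
      have h : pairingFn φ ψ (star g) μ₀ * (2 * π * Complex.I) = 0 := by
        push_cast at p1 n1
        linear_combination p1 - n1
      exact (mul_eq_zero.1 h).resolve_right Complex.two_pi_I_ne_zero
    intro z hz
    rcases lt_or_gt_of_ne hz with h | h
    · exact n2 h0 hD z (by linarith)
    · exact p2 h0 hD z (by linarith)
  · intro hX
    have key : ∀ δ (R : L2R →L[ℂ] L2R), IsResolvent (extensionOp φ ψ B) δ R → μ₀ ≠ δ →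
        inner ℂ g (R (deficiencyElement φ ψ hμ)) = 0 := fun δ R hR hne => by
      have hδi := im_ne_zero_of_mem_rho ⟨R, hR⟩
      rw [resolvent_apply_deficiencyElement hdisj hμ hδi (sub_ne_zero.2 hne) hR, inner_smul_right,
        inner_add_right, inner_smul_right, inner_deficiencyElement, inner_deficiencyElement,
        hX _ hμ, hX _ hδi]
      simp
    have key' : ∀ δ (R : L2R →L[ℂ] L2R), IsResolvent (extensionOp φ ψ B) δ R →
        inner ℂ g (R (deficiencyElement φ ψ hμ)) = 0 := fun δ R hR => by
      rcases ne_or_eq μ₀ δ with hne | rfl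
      · exact key δ R hR hne
      -- The explicit formula divides by `μ₀ - δ`; at `δ = μ₀` the resolvent is a norm limit of
      -- resolvents at nearby points.
      obtain ⟨Q, hQ, hQt⟩ := eventually_isResolvent hR
      have h1 : Tendsto (fun w => inner ℂ g (Q w (deficiencyElement φ ψ hμ))) (𝓝[≠] μ₀)
          (𝓝 (inner ℂ g (R (deficiencyElement φ ψ hμ)))) := by
        have hc : Continuous fun S : L2R →L[ℂ] L2R => inner ℂ g (S (deficiencyElement φ ψ hμ)) :=
          by fun_prop
        exact ((hc.tendsto R).comp hQt).mono_left nhdsWithin_le_nhds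
      refine tendsto_nhds_unique h1 (tendsto_const_nhds.congr' ?_)
      filter_upwards [hQ.filter_mono nhdsWithin_le_nhds, self_mem_nhdsWithin] with w h2 h3
      exact (key w (Q w) h2 (Ne.symm h3)).symm
    refine (Submodule.mem_orthogonal' _ _).2 fun v hv => ?_
    refine Submodule.mem_orthogonal_singleton_iff_inner_right.1
      ((Submodule.span_le.2 ?_ : detectableSpan φ ψ B μ₀ ≤ (ℂ ∙ g)ᗮ) hv)
    rintro v ⟨δ, R, c, u, hR, ⟨⟨hu, hu'⟩, -⟩, rfl⟩
    obtain ⟨b, rfl⟩ := exists_eq_smul_deficiencyElement hdisj hμ hu hu'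
    refine Submodule.mem_orthogonal_singleton_iff_inner_right.2 ?_
    rw [map_smul, inner_smul_right, key' δ R hR, mul_zero]

/-- Complex conjugation on `L²(ℝ)`. -/
def starAddHom : L2R →+ L2R := AddMonoidHom.mk' star fun f g => by
  refine Lp.ext ?_
  filter_upwards [coeFn_star_ae (f + g), Lp.coeFn_add f g, Lp.coeFn_add (star f) (star g),
    coeFn_star_ae f, coeFn_star_ae g] with x h1 h2 h3 h4 h5
  rw [h1, h2, h3, Pi.add_apply, Pi.add_apply, h4, h5, map_add]

lemma starAddHom_smul (c : ℂ) (f : L2R) : starAddHom (c • f) = conj c • star f := by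
  refine Lp.ext ?_
  filter_upwards [coeFn_star_ae (c • f), Lp.coeFn_smul c f, Lp.coeFn_smul (conj c) (star f),
    coeFn_star_ae f] with x h1 h2 h3 h4
  exact h1.trans (by rw [h2, h3, Pi.smul_apply, Pi.smul_apply, h4, smul_eq_mul, smul_eq_mul, map_mul])

end Friedrichs

end

/-! ### Proof of the theorem -/

theorem theorem8p6 (φ ψ : L2R)
    (hdisj : ∀ᵐ x : ℝ, φ x * ψ x = 0)
    (hint : ((∃ ε : ℝ, 0 < ε ∧ MemLp φ (ENNReal.ofReal (2 + ε)) volume) ∧ MemLp ψ ∞ volume) ∨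
      (MemLp φ 4 volume ∧ MemLp ψ 4 volume)) :
    ∃ Φ : ℝ → ℂ, Friedrichs.IsUpperBoundaryValue (fun x => conj (φ x)) Φ ∧
      ∀ B μ₀ : ℂ, μ₀ ∈ Friedrichs.rho φ ψ B →
        (∃ z ∈ Friedrichs.rho φ ψ B, 0 < z.im) → (∃ z ∈ Friedrichs.rho φ ψ B, z.im < 0) →
        ((Friedrichs.detectableSpan φ ψ B μ₀).topologicalClosure = ⊤ ↔
            ∀ᵐ k : ℝ, 1 - ψ k * Φ k ≠ 0) ∧
        ((Friedrichs.detectableSpan φ ψ B μ₀).topologicalClosure = ⊤ →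
            Friedrichs.defect (Friedrichs.detectableSpan φ ψ B μ₀) = 0) ∧
        ((Friedrichs.detectableSpan φ ψ B μ₀).topologicalClosure ≠ ⊤ →
            Friedrichs.defect (Friedrichs.detectableSpan φ ψ B μ₀) = ⊤) := by
  open Friedrichs in
  refine ⟨bdry 1 (star φ), ⟨Lp.memLp _, ?_⟩, fun B μ₀ hμ₀ hp hn => ?_⟩
  · refine (tendsto_cauchyTransform_bdry one_ne_zero (star φ)).congr fun ε => ?_
    congr 1; ext k
    rw [one_mul, cauchyTransform_congr (coeFn_star_ae φ)]
  have horth := mem_orthogonal_detectableSpan_iff hdisj hμ₀ hp hn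
  rw [Submodule.topologicalClosure_eq_top_iff]
  set V := detectableSpan φ ψ B μ₀
  have hbot : (∀ᵐ k : ℝ, 1 - ψ k * bdry 1 (star φ) k ≠ 0) → Vᗮ = ⊥ := fun hne =>
    (Submodule.eq_bot_iff _).2 fun g hg => by
      have := eq_zero_of_cauchyTransform_eq φ ψ (star g) hdisj hne fun z hz =>
        sub_eq_zero.1 ((horth g).1 hg z hz)
      rw [← star_star g, this]
      exact map_zero starAddHom
  have hinf : (¬ ∀ᵐ k : ℝ, 1 - ψ k * bdry 1 (star φ) k ≠ 0) → defect V = ⊤ := fun hne => by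
    obtain ⟨h, h1, h2⟩ := exists_linearIndependent_cauchyTransform_eq φ ψ hdisj hne
    have hmem : ∀ n, star (h n) ∈ Vᗮ := fun n => (horth _).2 fun z hz => by
      rw [star_star]
      exact sub_eq_zero.2 (h2 n z hz)
    have hli : LinearIndependent ℂ fun n => (⟨star (h n), hmem n⟩ : Vᗮ) := by
      refine linearIndependent_iff'.2 fun s c hc i hi => star_eq_zero.1 ?_
      -- Conjugation is conjugate-linear, so a relation among the `star (h n)` becomes one among the
      -- `h n` with conjugated coefficients.
      refine h1 s (fun i => star (c i)) ?_ i hi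
      have := congrArg (fun v : Vᗮ => starAddHom (v : L2R)) hc
      simpa [map_sum, starAddHom_smul] using! this
    have := hli.aleph0_le_rank
    rw [defect, Cardinal.toENat_eq_top]
    exact this
  refine ⟨⟨fun h => ?_, hbot⟩, fun h => ?_, fun h => hinf fun hne =>
    h (Submodule.topologicalClosure_eq_top_iff.2 (hbot hne))⟩
  · by_contra hne
    have := hinf hne
    rw [defect, h] at this
    simp at this
  · rw [defect, h]
    simp
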